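/- **Setting.** Let $(\Omega,\mathcal F,\mathbb P)$ be a probability space with a filtration $(\mathcal F_t)_{t\ge 0}$, and let $\xi_1,\xi_2,\dots$ be random elements with common law $\nu$ such that $\xi_t$ is $\mathcal F_t$-measurable and $\xi_{t+1}$ is independent of $\mathcal F_t$ (for instance $\xi_1,\xi_2,\dots$ i.i.d., independent of $x_0$, and $\mathcal F_t=\sigma(x_0,\xi_1,\dots,\xi_t)$). Let $G(x,z)\in\mathbb R^d$ be jointly measurable, $g(x)=\mathbb E[G(x,\xi)]$ with $\xi\sim\nu$, and $g(x^*)=0$. Let $x_0$ be an $\mathcal F_0$-measurable random vector in $\mathbb R^d$ and $$x_{t+1}=x_t-\eta_t\,G(x_t,\xi_{t+1}),\qquad \eta_t=\eta_0t^{-a}\ (t\ge 1),\qquad \eta_0>0,\quad \tfrac12<a<1 .$$ Put $\varepsilon_t=g(x_{t-1})-G(x_{t-1},\xi_t)$, $\tilde\varepsilon_t=g(x^*)-G(x^*,\xi_t)$ and $\bar x_t=\frac1t\sum_{s=1}^t x_s$. **Assumptions.** 1. (Lyapunov function) There are a differentiable $V:\mathbb R^d\to\mathbb R$ and constants $\delta_V,\mu_V,L_V,\lambda_V>0$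 such that $V(0)=0$; $V(x-x^*)\ge\mu_V\|x-x^*\|^2$ for all $x$; $\|\nabla V(y)-\nabla V(z)\|\le L_V\|y-z\|$ for all $y,z$; $\nabla V(x-x^*)^\top g(x)>0$ for all $x\ne x^*$; and $\nabla V(x-x^*)^\top g(x)\ge\lambda_V V(x-x^*)$ whenever $\|x-x^*\|\le\delta_V$. 2. (Local linearity, nonlinear case) There are a matrix $H\in\mathbb R^{d\times d}$, all of whose eigenvalues have positive real part, and constants $L_H>0$, $\delta_H>0$, $0<\lambda\le 1$ such that $\|g(x)-H(x-x^*)\|\le L_H\|x-x^*\|^{1+\lambda}$ whenever $\|x-x^*\|\le\delta_H$. 3. (Lipschitzness) There is $L_G>0$ with $(\mathbb E\|G(x,\xi)-G(y,\xi)\|^2)^{1/2}\le L_G\|x-y\|$ for all $x,y$. 4. (Noise) (i) There is $L_\varepsilon>0$ with $\mathbb E(\|\varepsilon_t\|^2\mid\mathcal F_{t-1})+\|g(x_{t-1})\|^2\le L_\varepsilon(1+\|x_{t-1}-x^*\|^2)$ a.s. for all $t\ge1$. (ii) $\varepsilon_t=\varepsilon_t(0)+\zeta_t(x_{t-1})$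 with $\varepsilon_t(0)$ square integrable, where $\mathbb E(\varepsilon_t(0)\mid\mathcal F_{t-1})=0$ a.s.; $\mathbb E(\varepsilon_t(0)\varepsilon_t(0)^\top\mid\mathcal F_{t-1})\to S$ in probability as $t\to\infty$ for a symmetric positive definite $S$; $\sup_t\mathbb E(\|\varepsilon_t(0)\|^2\mathbf 1(\|\varepsilon_t(0)\|>C)\mid\mathcal F_{t-1})\to0$ in probability as $C\to\infty$; and, for all large $t$, $\mathbb E(\|\zeta_t(x_{t-1})\|^2\mid\mathcal F_{t-1})\le\delta(x_{t-1}-x^*)$ a.s., where $\delta(\Delta)\to0$ as $\Delta\to0$. (iii) For some $p\in(1,\infty]$, $\sup_{t\ge1}\|\varepsilon_t\|_{L^{2p}}<\infty$ and $\|G(x^*,\xi)\|_{L^{2p}}<\infty$ (for $p=\infty$: essential boundedness). 5. (Rate condition) $p>\frac{1+\lambda}{\lambda}$ and $\frac1{1+\lambda}<a<\frac{p-1}{p}$ (the upper bound is $1$ if $p=\infty$). For deterministic $r_t>0$, "$\tilde o(r_t)$ a.s." means: $o(r_t(\log t)^k)$ a.s. for some constant $k\in\mathbb R$; similarly $\tilde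 O$. For $p=\infty$ put $1/p=0$; expressions in $p$ are read as their limits. Let $$a^*=\frac{2p-1}{(2+\lambda)p},\qquad \rho^*=\frac{(1+\lambda)(2p-1)}{2(2+\lambda)p},$$ and, for $\epsilon>0$ and $a'\in(\frac12,1)$, let $$r_{t,\epsilon}(a')=t^{-1}(\log t)^{\epsilon}+t^{-\frac{a'(1+\lambda)}2}(\log t)^{1+\epsilon}+t^{\frac1{2p}-\frac{2-a'}2}(\log t)^{\frac1{2p}+\epsilon}+t^{-\frac{1+a'}2}(\log t)^{\frac12+\epsilon}.$$ **Conclusion.** (a) If $a=a^*$, then $$\bar x_t-x^*=\frac1t\sum_{j=1}^tH^{-1}\tilde\varepsilon_j+\tilde o\big(t^{-\rho^*}\big)\quad\text{a.s.}$$ (b) In particular, if $\lambda=1$, $p=\infty$ and $a=2/3$, this holds with error $\tilde o(t^{-2/3})$. (c) The rate is optimal in the choice of $a$ in the following sense. For every $a$ as in the assumptions and every $\epsilon>0$, $\bar x_t-x^*=\frac1t\sum_{j=1}^tH^{-1}\tilde\varepsilon_j+\tilde o(r_{t,\epsilon}(a))$ a.s. The exponent $a^*$ is admissible: $\frac12<a^*<1$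 and $\frac1{1+\lambda}<a^*<\frac{p-1}p$. For every $\epsilon>0$, $r_{t,\epsilon}(a^*)=\tilde O(t^{-\rho^*})$, whereas for every $a'\in(\frac12,1)$ with $a'\ne a^*$ and every $k\in\mathbb R$, $t^{-\rho^*}(\log t)^k=o(r_{t,\epsilon}(a'))$ as $t\to\infty$. -/

import Mathlib

open MeasureTheory ProbabilityTheory Filter Asymptotics
open scoped Topology ENNReal

namespace SA

variable {d : ℕ} {Ω Ξ : Type*} [mΩ : MeasurableSpace Ω] [MeasurableSpace Ξ]

/-- The mean field `g(x) = 𝔼[G(x, ξ)]`, where `ν` is the law of a data point `ξ`. -/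
noncomputable def meanField (ν : Measure Ξ)
    (G : EuclideanSpace ℝ (Fin d) → Ξ → EuclideanSpace ℝ (Fin d)) (x : EuclideanSpace ℝ (Fin d)) :
    EuclideanSpace ℝ (Fin d) :=
  ∫ z, G x z ∂ν

/-- The polynomial step sizes: `η_t = η₀ t^{-a}` for `t ≥ 1`, and `η₀` at `t = 0`. -/
noncomputable def stepSize (η₀ a : ℝ) (t : ℕ) : ℝ :=
  if t = 0 then η₀ else η₀ * (t : ℝ) ^ (-a)

/-- The recursion `x_{t+1} = x_t - η_t G(x_t, ξ_{t+1})`, driven by data `ξ_1, ξ_2, …` of common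
law `ν`, relative to a filtration `ℱ`: the initial point is `ℱ_0`-measurable, `ξ_t` is
`ℱ_t`-measurable and `ξ_{t+1}` is independent of `ℱ_t` (so the data are i.i.d. and independent of
`x_0`; the filtration `ℱ_t = σ(x_0, ξ_1, …, ξ_t)` is the basic example). The value `ξ 0` is not
used. -/
structure IsSAProcess (P : Measure Ω) (ℱ : Filtration ℕ mΩ) (ν : Measure Ξ)
    (G : EuclideanSpace ℝ (Fin d) → Ξ → EuclideanSpace ℝ (Fin d)) (η : ℕ → ℝ)
    (ξ : ℕ → Ω → Ξ) (x : ℕ → Ω → EuclideanSpace ℝ (Fin d)) : Prop where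
  measurable_G : Measurable (Function.uncurry G)
  measurable_init : Measurable[ℱ 0] (x 0)
  measurable_data : ∀ t, Measurable[ℱ (t + 1)] (ξ (t + 1))
  law_data : ∀ t, P.map (ξ (t + 1)) = ν
  indep_data : ∀ t, Indep (MeasurableSpace.comap (ξ (t + 1)) inferInstance) (ℱ t) P
  recursion : ∀ t ω, x (t + 1) ω = x t ω - η t • G (x t ω) (ξ (t + 1) ω)

/-- The Lyapunov condition for the mean field `g` at the root `xs`. -/
def LyapunovCondition (g : EuclideanSpace ℝ (Fin d) → EuclideanSpace ℝ (Fin d))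
    (xs : EuclideanSpace ℝ (Fin d)) : Prop :=
  ∃ (V : EuclideanSpace ℝ (Fin d) → ℝ) (δV μV LV lamV : ℝ),
    0 < δV ∧ 0 < μV ∧ 0 < LV ∧ 0 < lamV ∧
    Differentiable ℝ V ∧
    V 0 = 0 ∧
    (∀ x, μV * ‖x - xs‖ ^ 2 ≤ V (x - xs)) ∧
    (∀ y z, ‖gradient V y - gradient V z‖ ≤ LV * ‖y - z‖) ∧
    (∀ x, x ≠ xs → 0 < inner ℝ (gradient V (x - xs)) (g x)) ∧
    (∀ x, ‖x - xs‖ ≤ δV → lamV * V (x - xs) ≤ inner ℝ (gradient V (x - xs)) (g x))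

/-- Local linearity of `g` at `xs`, of order `1 + lam` with constant `LH`, with linearization
`H` all of whose (complex) eigenvalues have positive real part. -/
def LocalLinearity (g : EuclideanSpace ℝ (Fin d) → EuclideanSpace ℝ (Fin d))
    (xs : EuclideanSpace ℝ (Fin d)) (H : Matrix (Fin d) (Fin d) ℝ) (LH lam : ℝ) : Prop :=
  (∃ δH : ℝ, 0 < δH ∧ ∀ x, ‖x - xs‖ ≤ δH →
    ‖g x - Matrix.toEuclideanLin H (x - xs)‖ ≤ LH * ‖x - xs‖ ^ (1 + lam)) ∧
  ∀ μ ∈ spectrum ℂ (H.map (algebraMap ℝ ℂ)), 0 < μ.re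

/-- Lipschitz continuity of `x ↦ G(x, ξ)` in `L²`. -/
def LipschitzCondition (ν : Measure Ξ)
    (G : EuclideanSpace ℝ (Fin d) → Ξ → EuclideanSpace ℝ (Fin d)) : Prop :=
  ∃ LG : ℝ, 0 < LG ∧ ∀ x y,
    eLpNorm (fun z => G x z - G y z) 2 ν ≤ ENNReal.ofReal (LG * ‖x - y‖)

/-- The noise at time `t + 1`: `ε_{t+1} = g(x_t) - G(x_t, ξ_{t+1})`. -/
noncomputable def noise (ν : Measure Ξ)
    (G : EuclideanSpace ℝ (Fin d) → Ξ → EuclideanSpace ℝ (Fin d))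
    (ξ : ℕ → Ω → Ξ) (x : ℕ → Ω → EuclideanSpace ℝ (Fin d)) (t : ℕ) (ω : Ω) :
    EuclideanSpace ℝ (Fin d) :=
  meanField ν G (x t ω) - G (x t ω) (ξ (t + 1) ω)

/-- The noise at time `t + 1` evaluated at the root: `ε̃_{t+1} = g(xs) - G(xs, ξ_{t+1})`. -/
noncomputable def rootNoise (ν : Measure Ξ)
    (G : EuclideanSpace ℝ (Fin d) → Ξ → EuclideanSpace ℝ (Fin d))
    (ξ : ℕ → Ω → Ξ) (xs : EuclideanSpace ℝ (Fin d)) (t : ℕ) (ω : Ω) :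
    EuclideanSpace ℝ (Fin d) :=
  meanField ν G xs - G xs (ξ (t + 1) ω)

/-- The decomposition `ε_{t+1} = ε_{t+1}(0) + ζ_{t+1}(x_t)` of the noise; `ε0 t` and `ζ t` stand
for `ε_{t+1}(0)` and `ζ_{t+1}`. -/
def NoiseDecomposition (P : Measure Ω) (ℱ : Filtration ℕ mΩ) (ν : Measure Ξ)
    (G : EuclideanSpace ℝ (Fin d) → Ξ → EuclideanSpace ℝ (Fin d))
    (ξ : ℕ → Ω → Ξ) (x : ℕ → Ω → EuclideanSpace ℝ (Fin d)) (xs : EuclideanSpace ℝ (Fin d))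
    (S : Matrix (Fin d) (Fin d) ℝ) : Prop :=
  ∃ (ε0 : ℕ → Ω → EuclideanSpace ℝ (Fin d))
    (ζ : ℕ → EuclideanSpace ℝ (Fin d) → Ω → EuclideanSpace ℝ (Fin d))
    (δ : EuclideanSpace ℝ (Fin d) → ℝ),
    (∀ t, MemLp (ε0 t) 2 P) ∧
    (∀ t ω, noise ν G ξ x t ω = ε0 t ω + ζ t (x t ω) ω) ∧
    (∀ t, P[ε0 t | ℱ t] =ᵐ[P] 0) ∧
    (∀ i j, TendstoInMeasure P (fun t => P[fun ω => ε0 t ω i * ε0 t ω j | ℱ t]) atTop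
      (fun _ => S i j)) ∧
    TendstoInMeasure P
      (fun (C : ℝ) (ω : Ω) => ⨆ t : ℕ, ENNReal.ofReal
        ((P[{ω' | C < ‖ε0 t ω'‖}.indicator (fun ω' => ‖ε0 t ω'‖ ^ 2) | ℱ t]) ω))
      atTop (fun _ => 0) ∧
    Tendsto δ (𝓝[≠] 0) (𝓝 0) ∧
    (∀ᶠ t in atTop, ∀ᵐ ω ∂P,
      (P[fun ω' => ‖ζ t (x t ω') ω'‖ ^ 2 | ℱ t]) ω ≤ δ (x t ω - xs))

/-- The noise condition with moment index `p ∈ (1, ∞]`: the `2p`-th moments are bounded, which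
for `p = ∞` means that the noise is essentially bounded. -/
structure NoiseCondition (P : Measure Ω) (ℱ : Filtration ℕ mΩ) (ν : Measure Ξ)
    (G : EuclideanSpace ℝ (Fin d) → Ξ → EuclideanSpace ℝ (Fin d))
    (ξ : ℕ → Ω → Ξ) (x : ℕ → Ω → EuclideanSpace ℝ (Fin d)) (xs : EuclideanSpace ℝ (Fin d))
    (S : Matrix (Fin d) (Fin d) ℝ) (p : ℝ≥0∞) : Prop where
  growth : ∃ Lε : ℝ, 0 < Lε ∧ ∀ t, ∀ᵐ ω ∂P,
    (P[fun ω' => ‖noise ν G ξ x t ω'‖ ^ 2 | ℱ t]) ω + ‖meanField ν G (x t ω)‖ ^ 2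
      ≤ Lε * (1 + ‖x t ω - xs‖ ^ 2)
  posDef : S.PosDef
  decomposition : NoiseDecomposition P ℱ ν G ξ x xs S
  one_lt : 1 < p
  moments : ∃ C : ℝ, (∀ t, eLpNorm (noise ν G ξ x t) (2 * p) P ≤ ENNReal.ofReal C) ∧
    eLpNorm (G xs) (2 * p) ν ≤ ENNReal.ofReal C

/-- The rate condition in the nonlinear case; `a < (p - 1) / p` is written `a < 1 - 1 / p`, with
`1 / ∞ = 0`. -/
def RateCondition (lam a : ℝ) (p : ℝ≥0∞) : Prop :=
  ENNReal.ofReal ((1 + lam) / lam) < p ∧ 1 / (1 + lam) < a ∧ a < 1 - (p⁻¹).toReal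

/-- The averaged iterate `x̄_t = t⁻¹ ∑_{s=1}^t x_s`. -/
noncomputable def average (x : ℕ → Ω → EuclideanSpace ℝ (Fin d)) (t : ℕ) (ω : Ω) :
    EuclideanSpace ℝ (Fin d) :=
  (t : ℝ)⁻¹ • ∑ s ∈ Finset.range t, x (s + 1) ω

/-- `x̄_t - xs = t⁻¹ ∑_{j=1}^t H⁻¹ ε̃_j + õ(r_t)` almost surely, where `õ(r_t)` means
`o(r_t (log t)^k)` for some `k`. -/
def AveragedExpansion (P : Measure Ω) (ν : Measure Ξ)
    (G : EuclideanSpace ℝ (Fin d) → Ξ → EuclideanSpace ℝ (Fin d))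
    (ξ : ℕ → Ω → Ξ) (x : ℕ → Ω → EuclideanSpace ℝ (Fin d)) (xs : EuclideanSpace ℝ (Fin d))
    (H : Matrix (Fin d) (Fin d) ℝ) (r : ℕ → ℝ) : Prop :=
  ∃ k : ℝ, ∀ᵐ ω ∂P,
    (fun t : ℕ => average x t ω - xs -
      (t : ℝ)⁻¹ • ∑ j ∈ Finset.range t, Matrix.toEuclideanLin H⁻¹ (rootNoise ν G ξ xs j ω))
    =o[atTop] fun t : ℕ => r t * Real.log t ^ k

/-- The guaranteed approximation rate `r_{t,ε}` as a function of the step exponent `a`: the sum of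
the rates of the initialization, linearization, matrix-inverse and calibration errors. -/
noncomputable def overallRate (lam : ℝ) (p : ℝ≥0∞) (ε a : ℝ) (t : ℕ) : ℝ :=
  (t : ℝ) ^ (-1 : ℝ) * Real.log t ^ ε
    + (t : ℝ) ^ (-(a * (1 + lam) / 2)) * Real.log t ^ (1 + ε)
    + (t : ℝ) ^ (((2 * p)⁻¹).toReal - (2 - a) / 2) * Real.log t ^ (((2 * p)⁻¹).toReal + ε)
    + (t : ℝ) ^ (-((1 + a) / 2)) * Real.log t ^ (1 / 2 + ε)

/-- The step exponent `(2p - 1) / ((2 + lam) p)`, with its limit value at `p = ∞`. -/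
noncomputable def optStep (lam : ℝ) (p : ℝ≥0∞) : ℝ :=
  if p = ⊤ then 2 / (2 + lam) else (2 * p.toReal - 1) / ((2 + lam) * p.toReal)

/-- The exponent `(1 + lam)(2p - 1) / (2 (2 + lam) p)`, with its limit value at `p = ∞`. -/
noncomputable def optExponent (lam : ℝ) (p : ℝ≥0∞) : ℝ :=
  if p = ⊤ then (1 + lam) / (2 + lam)
  else (1 + lam) * (2 * p.toReal - 1) / (2 * (2 + lam) * p.toReal)

end SA

namespace SA

/-! Write $\Delta_s=x_s-x^*$ and $q=1/p$. With time indices aligned, solving the recursion for the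
linear part gives
$H\Delta_s=\eta_s^{-1}(\Delta_s-\Delta_{s+1})+\varepsilon_{s+1}-(g(x_s)-H\Delta_s)$. Sum over $s<t$,
apply $H^{-1}$ and replace $\varepsilon$ by $\tilde\varepsilon$. This leaves the root-noise average,
a boundary term $\Delta_t-\Delta_0$, and three errors: (i) summation by parts turns
$\sum\eta_s^{-1}(\Delta_s-\Delta_{s+1})$ into $t^{(q+a)/2}$, given $\|\Delta_s\|\lesssim
s^{(q-a)/2}$; (ii) the linearization error is at most $\sum\|\Delta_s\|^{1+\lambda}\approx
t^{1-a(1+\lambda)/2}$, given the mean-square size $s^{-a}$ of $\|\Delta_s\|^2$; (iii)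
$\sum(\varepsilon-\tilde\varepsilon)$ is a martingale whose increments have variance of order
$s^{-a}$, hence has size $t^{(1-a)/2}$. All bounds hold up to logarithms; division by $t$ gives the
terms of `overallRate`. The pathwise algebra is `exists_norm_sum_sub_le`.

The inputs on $\Delta$ come in two stages. A supermartingale argument with the Lyapunov function
gives $\Delta_t\to0$ almost surely (`IsNoisyDescent.ae_tendsto_zero`). On the event that $\Delta$
stays in a small ball from time $n$ on, $W_t=V(\Delta_t)/\eta_t$ satisfies
$W_{t+1}\le(1-c\eta_t)W_t+\text{martingale term}+K\eta_t\|\varepsilon_{t+1}\|^2$. Hence $\mathbb E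
W_t^p$ stays bounded for $p<\infty$, and $\mathbb E e^{\theta W_t}$ for $p=\infty$. Because $\sum
1/(s\log^2 s)<\infty$, bounded expectations become almost sure bounds $W_t\lesssim t^{q}\log t$.
Every path that converges lies in one of these countably many localized regimes, so the bounds
transfer to almost every path.

The exponent of (ii) after division decreases in $a$ and that of (i) increases; they cross exactly
at $a^*$. There the other two terms are no larger, and away from $a^*$ one of the crossing terms is
polynomially larger. -/

/-! ### Logarithmic weights and Kronecker's lemma -/

/-- The logarithmic weight `1 + log (s + 1)`, which is at least `1`. -/
noncomputable def logWeight (s : ℕ) : ℝ := 1 + Real.log ((s : ℝ) + 1)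

lemma one_le_logWeight (s : ℕ) : 1 ≤ logWeight s := by
  have : 0 ≤ Real.log ((s : ℝ) + 1) := Real.log_nonneg (by linarith [Nat.cast_nonneg (α := ℝ) s])
  unfold logWeight; linarith

lemma logWeight_pos (s : ℕ) : 0 < logWeight s := lt_of_lt_of_le one_pos (one_le_logWeight s)

lemma logWeight_mono : Monotone logWeight := by
  intro s t h
  unfold logWeight
  have : (s : ℝ) ≤ t := by exact_mod_cast h
  have := Real.log_le_log (by positivity) (add_le_add_left this 1)
  linarith

lemma sum_inv_le_logWeight (t : ℕ) :
    ∑ s ∈ Finset.range t, ((s : ℝ) + 1)⁻¹ ≤ logWeight t := by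
  have h := harmonic_le_one_add_log t
  have h2 : ((harmonic t : ℚ) : ℝ) = ∑ s ∈ Finset.range t, ((s : ℝ) + 1)⁻¹ := by
    simp [harmonic]
  rw [h2] at h
  refine h.trans ?_
  unfold logWeight
  rcases Nat.eq_zero_or_pos t with rfl | ht
  · simp
  · have : Real.log t ≤ Real.log ((t : ℝ) + 1) :=
      Real.log_le_log (by exact_mod_cast ht) (by linarith)
    linarith

/-- The sum telescopes against the reciprocal of `logWeight`: since log((m+2)/(m+1)) ≥ 1/(m+2), each
term is at most the drop of that reciprocal. Keeping the subtracted term lets the induction close.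
This summable weight is what later turns bounded expectations into almost sure bounds. -/
lemma sum_inv_mul_logWeight_sq_le (t : ℕ) :
    ∑ s ∈ Finset.range t, (((s : ℝ) + 1) * logWeight s ^ 2)⁻¹ ≤ 2 - (logWeight (t - 1))⁻¹ := by
  induction t with
  | zero => simp [logWeight]
  | succ n ih =>
    rw [Finset.sum_range_succ]
    rcases Nat.eq_zero_or_pos n with rfl | hn
    · simp [logWeight]; norm_num
    · obtain ⟨m, rfl⟩ : ∃ m, n = m + 1 := ⟨n - 1, by omega⟩
      simp only [Nat.add_sub_cancel] at ih ⊢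
      have h1 := logWeight_pos m
      have h2 := logWeight_pos (m + 1)
      have h3 : ((m : ℝ) + 1 + 1)⁻¹ ≤ logWeight (m + 1) - logWeight m := by
        have hm : (0 : ℝ) < (m : ℝ) + 1 := by positivity
        have := Real.one_sub_inv_le_log_of_pos (x := ((m : ℝ) + 1 + 1) / (m + 1)) (by positivity)
        rw [Real.log_div (by positivity) (by positivity)] at this
        unfold logWeight
        push_cast
        refine le_trans (le_of_eq ?_) (this.trans (le_of_eq (by ring)))
        field_simp
        ring
      have hmono := logWeight_mono (Nat.le_succ m)
      simp only [Nat.succ_eq_add_one] at hmono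
      have h4 : ((((m + 1 : ℕ) : ℝ) + 1) * logWeight (m + 1) ^ 2)⁻¹
          ≤ (logWeight m)⁻¹ - (logWeight (m + 1))⁻¹ := by
        push_cast
        rw [mul_inv, inv_sub_inv h1.ne' h2.ne']
        calc ((m : ℝ) + 1 + 1)⁻¹ * (logWeight (m + 1) ^ 2)⁻¹
            ≤ (logWeight (m + 1) - logWeight m) * (logWeight m * logWeight (m + 1))⁻¹ := by
              apply mul_le_mul h3 _ (by positivity) (by linarith)
              apply inv_anti₀ (by positivity)
              nlinarith
          _ = _ := by rw [div_eq_mul_inv]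
      linarith

lemma sum_inv_mul_logWeight_sq_le_two (t : ℕ) :
    ∑ s ∈ Finset.range t, (((s : ℝ) + 1) * logWeight s ^ 2)⁻¹ ≤ 2 := by
  have := sum_inv_mul_logWeight_sq_le t
  have h := inv_pos.2 (logWeight_pos (t - 1))
  linarith

/-- A quantitative form of Kronecker's lemma. -/
lemma norm_sum_le_of_norm_sum_smul_le {E : Type*} [NormedAddCommGroup E] [NormedSpace ℝ E]
    {b : ℕ → ℝ} (hb : ∀ s, 0 < b s) (hmono : Monotone b) {y : ℕ → E} {C : ℝ}
    (hC : ∀ t, ‖∑ s ∈ Finset.range t, (b s)⁻¹ • y s‖ ≤ C) (t : ℕ) :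
    ‖∑ s ∈ Finset.range t, y s‖ ≤ 2 * C * b t := by
  set S : ℕ → E := fun t => ∑ s ∈ Finset.range t, (b s)⁻¹ • y s with hS
  -- Abel summation. The increments of `b` are nonnegative and telescope to `b t - b 0`, so boundary
  -- and interior terms each cost at most `C * b t`.
  have key : ∀ t, ∑ s ∈ Finset.range t, y s
      = b t • S t - ∑ s ∈ Finset.range t, (b (s + 1) - b s) • S (s + 1) := by
    intro t
    induction t with
    | zero => simp [hS]
    | succ n ih =>
      have h1 : S (n + 1) = S n + (b n)⁻¹ • y n := by simp [hS, Finset.sum_range_succ]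
      have h2 : b n • S (n + 1) = b n • S n + y n := by
        rw [h1, smul_add, smul_smul, mul_inv_cancel₀ (hb n).ne', one_smul]
      rw [Finset.sum_range_succ, ih, Finset.sum_range_succ, sub_smul, h2]
      abel
  have hC0 : 0 ≤ C := (norm_nonneg _).trans (hC 0)
  rw [key]
  calc ‖b t • S t - ∑ s ∈ Finset.range t, (b (s + 1) - b s) • S (s + 1)‖
      ≤ ‖b t • S t‖ + ∑ s ∈ Finset.range t, ‖(b (s + 1) - b s) • S (s + 1)‖ :=
        (norm_sub_le _ _).trans (add_le_add le_rfl (norm_sum_le _ _))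
    _ ≤ b t * C + ∑ s ∈ Finset.range t, (b (s + 1) - b s) * C := by
        gcongr with s hs
        · rw [norm_smul, Real.norm_of_nonneg (hb t).le]
          exact mul_le_mul_of_nonneg_left (hC t) (hb t).le
        · have : 0 ≤ b (s + 1) - b s := sub_nonneg.2 (hmono (Nat.le_succ s))
          rw [norm_smul, Real.norm_of_nonneg this]
          exact mul_le_mul_of_nonneg_left (hC _) this
    _ = b t * C + (b t - b 0) * C := by
        rw [← Finset.sum_mul, Finset.sum_range_sub]
    _ ≤ 2 * C * b t := by nlinarith [mul_nonneg hC0 (hb 0).le]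

/-! ### One-step contraction inequalities for powers and exponentials -/

/-- A sequence that contracts towards a bounded perturbation stays bounded. -/
lemma le_max_of_contraction {w τ : ℕ → ℝ} {M : ℝ} {n : ℕ}
    (hτ : ∀ t, n ≤ t → 0 ≤ τ t ∧ τ t ≤ 1)
    (h : ∀ t, n ≤ t → w (t + 1) ≤ (1 - τ t) * w t + τ t * M) (t : ℕ) (ht : n ≤ t) :
    w t ≤ max (w n) M := by
  induction t, ht using Nat.le_induction with
  | base => exact le_max_left _ _
  | succ t ht ih =>
    have h1 := hτ t ht
    have h2 := h t ht
    have h3 := mul_le_mul_of_nonneg_left ih (sub_nonneg.2 h1.2)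
    have h4 := mul_le_mul_of_nonneg_left (le_max_right (w n) M) h1.1
    linarith

/-- The tangent line inequality for `x ↦ x ^ q`, `q ≥ 1`. -/
lemma rpow_sub_rpow_le {q a b : ℝ} (hq : 1 ≤ q) (ha : 0 ≤ a) (hb : 0 ≤ b) :
    a ^ q - b ^ q ≤ q * a ^ (q - 1) * (a - b) := by
  rcases ha.eq_or_lt with rfl | ha
  · rcases hq.eq_or_lt with rfl | hq
    · simp
    · rw [Real.zero_rpow (by linarith), Real.zero_rpow (by linarith)]
      have := Real.rpow_nonneg hb q
      simp; exact this
  -- Bernoulli's inequality at `b / a - 1 ≥ -1`, multiplied by `a ^ q`.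
  · have h := one_add_mul_self_le_rpow_one_add (s := b / a - 1) (by
      have : 0 ≤ b / a := by positivity
      linarith) hq
    rw [show 1 + (b / a - 1) = b / a by ring, Real.div_rpow hb ha.le] at h
    have hap : 0 < a ^ q := Real.rpow_pos_of_pos ha q
    rw [le_div_iff₀ hap] at h
    have h2 : a ^ q = a ^ (q - 1) * a := by
      rw [← Real.rpow_add_one ha.ne']; congr 1; ring
    have h3 : (1 + q * (b / a - 1)) * a ^ q = a ^ q + q * a ^ (q - 1) * (b - a) := by
      rw [add_mul, one_mul, h2]; field_simp
    linarith

/-- A second-order Taylor bound for `x ↦ x ^ p`, `p ≥ 2`. -/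
lemma rpow_add_le_taylor {p u v : ℝ} (hp : 2 ≤ p) (hu : 0 ≤ u) (huv : 0 ≤ u + v) :
    (u + v) ^ p ≤ u ^ p + p * u ^ (p - 1) * v + p * (p - 1) * (u + |v|) ^ (p - 2) * v ^ 2 := by
  have h1 := rpow_sub_rpow_le (q := p) (by linarith) huv hu
  -- The tangent bound at `u + v` leaves the derivative at the wrong endpoint; a second tangent
  -- bound, with exponent `p - 1`, moves it to `u`. The sign of `v` decides which endpoint is
  -- larger, and `u + |v|` dominates both.
  have h2 : ((u + v) ^ (p - 1) - u ^ (p - 1)) * v ≤ (p - 1) * (u + |v|) ^ (p - 2) * v ^ 2 := by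
    have e : p - 1 - 1 = p - 2 := by ring
    rcases le_total 0 v with hv | hv
    · have := rpow_sub_rpow_le (q := p - 1) (by linarith) huv hu
      rw [e, add_sub_cancel_left] at this
      rw [abs_of_nonneg hv]
      nlinarith [mul_le_mul_of_nonneg_right this hv]
    · have h3 := rpow_sub_rpow_le (q := p - 1) (by linarith) hu huv
      rw [e] at h3
      have h4 : u ^ (p - 2) ≤ (u + |v|) ^ (p - 2) :=
        Real.rpow_le_rpow hu (by linarith [abs_nonneg v]) (by linarith)
      have h5 := mul_le_mul_of_nonneg_right h3 (neg_nonneg.2 hv)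
      have h6 : (p - 1) * u ^ (p - 2) * v ^ 2 ≤ (p - 1) * (u + |v|) ^ (p - 2) * v ^ 2 := by
        have : 0 ≤ p - 1 := by linarith
        gcongr
      nlinarith
  have h3 : p * (u + v) ^ (p - 1) * v
      = p * u ^ (p - 1) * v + p * (((u + v) ^ (p - 1) - u ^ (p - 1)) * v) := by ring
  have h4 := mul_le_mul_of_nonneg_left h2 (show 0 ≤ p by linarith)
  rw [add_sub_cancel_left, h3] at h1
  linarith

/-- A Young inequality, by comparing `s` with `κ * x`. The coefficient of `x ^ p` is arbitrarily
small with `κ`, so a contraction in `x ^ p` can absorb it. -/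
lemma add_rpow_mul_le {p κ x s : ℝ} (hp : 1 ≤ p) (hκ : 0 < κ) (hx : 0 ≤ x) (hs : 0 ≤ s) :
    (x + s) ^ (p - 1) * s ≤ (1 + κ) ^ (p - 1) * κ * x ^ p + (κ⁻¹ + 1) ^ (p - 1) * s ^ p := by
  have aux : ∀ y : ℝ, 0 ≤ y → y ^ (p - 1) * y = y ^ p := fun y hy => by
    rcases hy.eq_or_lt with rfl | hy
    · rw [mul_zero, Real.zero_rpow (by linarith)]
    · rw [← Real.rpow_add_one hy.ne']; congr 1; ring
  have hp1 : 0 ≤ p - 1 := by linarith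
  rcases le_total s (κ * x) with h | h
  · have : (x + s) ^ (p - 1) * s ≤ ((1 + κ) * x) ^ (p - 1) * (κ * x) := by
      gcongr; linarith
    rw [Real.mul_rpow (by linarith) hx] at this
    have h2 : 0 ≤ (κ⁻¹ + 1) ^ (p - 1) * s ^ p := by positivity
    calc _ ≤ _ := this
      _ = (1 + κ) ^ (p - 1) * κ * (x ^ (p - 1) * x) := by ring
      _ ≤ _ := by rw [aux x hx]; linarith
  · have h' : x ≤ κ⁻¹ * s := by rwa [← div_eq_inv_mul, le_div_iff₀' hκ]
    have : (x + s) ^ (p - 1) * s ≤ ((κ⁻¹ + 1) * s) ^ (p - 1) * s := by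
      gcongr; linarith
    rw [Real.mul_rpow (by positivity) hs] at this
    have h2 : 0 ≤ (1 + κ) ^ (p - 1) * κ * x ^ p := by positivity
    calc _ ≤ _ := this
      _ = (κ⁻¹ + 1) ^ (p - 1) * (s ^ (p - 1) * s) := by ring
      _ ≤ _ := by rw [aux s hs]; linarith

set_option maxHeartbeats 800000 in
/-- One step of a noisy contraction, measured by a power. -/
lemma exists_rpow_contraction_step {p c K : ℝ} (hp : 2 ≤ p) (hc : 0 < c) (hK : 0 < K) :
    ∃ C : ℝ, 0 ≤ C ∧ ∀ η x s X w : ℝ, 0 < η → η ≤ 1 → c * η ≤ 1 → 0 ≤ x → 0 ≤ s →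
      X ^ 2 ≤ K * (η * x * s) → 0 ≤ w → w ≤ (1 - c * η) * x + X + K * η * s →
      w ^ p ≤ (1 - c / 2 * η) * x ^ p + p * ((1 - c * η) * x) ^ (p - 1) * X + C * η * s ^ p := by
  -- `B` bounds `u + |v|` in units of `x + s`; `D` is the total coefficient of `η * ((x + s) ^ (p -
  -- 1) * s)` coming from the drift `K * η * s` and the second-order Taylor term.
  set B : ℝ := 2 + 2 * K with hB
  set D : ℝ := p * K + p * (p - 1) * B ^ (p - 2) * (2 * K + 2 * K ^ 2) with hD
  have hB0 : 0 < B := by positivity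
  have hp1 : 0 < p - 1 := by linarith
  have hD0 : 0 < D := by positivity
  -- Half of the contraction rate `c` is spent on the `x ^ p` part of the Young inequality. The
  -- minimum with 1 gives `1 + κ ≤ 2`.
  obtain ⟨κ, hκ, hκ2⟩ : ∃ κ : ℝ, 0 < κ ∧ D * ((1 + κ) ^ (p - 1) * κ) ≤ c / 2 := by
    refine ⟨min 1 (c / (2 * D * 2 ^ (p - 1))), by positivity, ?_⟩
    set κ := min 1 (c / (2 * D * 2 ^ (p - 1)))
    have h0 : 0 < κ := by positivity
    have h1 : (1 + κ) ^ (p - 1) ≤ 2 ^ (p - 1) :=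
      Real.rpow_le_rpow (by linarith) (by linarith [min_le_left 1 (c / (2 * D * 2 ^ (p - 1)))])
        hp1.le
    have h2 : κ ≤ c / (2 * D * 2 ^ (p - 1)) := min_le_right _ _
    calc D * ((1 + κ) ^ (p - 1) * κ) ≤ D * (2 ^ (p - 1) * (c / (2 * D * 2 ^ (p - 1)))) := by
          gcongr
      _ = c / 2 := by
          have : (0 : ℝ) < 2 ^ (p - 1) := by positivity
          field_simp
  refine ⟨D * (κ⁻¹ + 1) ^ (p - 1), by positivity, ?_⟩
  intro η x s X w hη hη1 hcη hx hs hX hw hwle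
  set u := (1 - c * η) * x with hu
  set v := X + K * η * s with hv
  have hu0 : 0 ≤ u := mul_nonneg (by linarith) hx
  have hux : u ≤ x := by
    have : 0 ≤ c * η * x := by positivity
    rw [hu]; linarith
  have hwuv : w ≤ u + v := by rw [hu, hv]; linarith
  have huv : 0 ≤ u + v := hw.trans hwuv
  have h1 : w ^ p ≤ (u + v) ^ p := Real.rpow_le_rpow hw hwuv (by linarith)
  have h2 := rpow_add_le_taylor hp hu0 huv
  have hXabs : |X| ≤ (x + s) * ((1 + K) / 2) := by
    apply abs_le_of_sq_le_sq _ (by positivity)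
    have h4 : 0 ≤ x * s := by positivity
    calc X ^ 2 ≤ K * (1 * x * s) := hX.trans (by gcongr)
      _ ≤ (1 + K) ^ 2 * (x * s) := by nlinarith [mul_nonneg hK.le h4, sq_nonneg K]
      _ ≤ (1 + K) ^ 2 * ((x + s) ^ 2 / 4) := by gcongr; nlinarith [sq_nonneg (x - s)]
      _ = _ := by ring
  have hvabs : u + |v| ≤ B * (x + s) := by
    have h3 : |v| ≤ |X| + |K * η * s| := abs_add_le _ _
    rw [abs_of_nonneg (show 0 ≤ K * η * s by positivity)] at h3
    have h4 : K * η * s ≤ K * 1 * s := by gcongr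
    have h5 : 0 ≤ K * x := by positivity
    have h6 : 0 ≤ K * s := by positivity
    rw [hB]; linarith
  have hv2 : v ^ 2 ≤ (2 * K + 2 * K ^ 2) * η * ((x + s) * s) := by
    have h3 : v ^ 2 ≤ 2 * X ^ 2 + 2 * (K * η * s) ^ 2 := by
      rw [hv]; nlinarith [sq_nonneg (X - K * η * s)]
    have h4 : (K * η * s) ^ 2 ≤ K ^ 2 * η * (s * s) := by
      calc (K * η * s) ^ 2 = K ^ 2 * η * (s * s) * η := by ring
        _ ≤ K ^ 2 * η * (s * s) * 1 := by gcongr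
        _ = _ := mul_one _
    have h5 : 0 ≤ K * η * (s * s) := by positivity
    have h6 : 0 ≤ K ^ 2 * η * (x * s) := by positivity
    linarith
  have haux : (x + s) ^ (p - 2) * ((x + s) * s) = (x + s) ^ (p - 1) * s := by
    rcases (add_nonneg hx hs).eq_or_lt with h | h
    · have : s = 0 := by linarith
      simp [this]
    · rw [← mul_assoc, ← Real.rpow_add_one h.ne']; congr 2; ring
  have h3 : p * (p - 1) * (u + |v|) ^ (p - 2) * v ^ 2
      ≤ p * (p - 1) * B ^ (p - 2) * (2 * K + 2 * K ^ 2) * (η * ((x + s) ^ (p - 1) * s)) := by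
    calc p * (p - 1) * (u + |v|) ^ (p - 2) * v ^ 2
        ≤ p * (p - 1) * (B * (x + s)) ^ (p - 2) * ((2 * K + 2 * K ^ 2) * η * ((x + s) * s)) := by
          gcongr
      _ = p * (p - 1) * B ^ (p - 2) * (2 * K + 2 * K ^ 2)
            * (η * ((x + s) ^ (p - 2) * ((x + s) * s))) := by
          rw [Real.mul_rpow hB0.le (by positivity)]; ring
      _ = _ := by rw [haux]
  have h4 : p * u ^ (p - 1) * v ≤ p * u ^ (p - 1) * X + p * K * (η * ((x + s) ^ (p - 1) * s)) := by
    have : u ^ (p - 1) ≤ (x + s) ^ (p - 1) :=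
      Real.rpow_le_rpow hu0 (by linarith) hp1.le
    have h5 : p * K * (η * (u ^ (p - 1) * s)) ≤ p * K * (η * ((x + s) ^ (p - 1) * s)) := by gcongr
    rw [hv]; linarith
  have h5 : u ^ p ≤ (1 - c * η) * x ^ p := by
    rw [hu, Real.mul_rpow (by linarith) hx]
    gcongr
    calc (1 - c * η) ^ p ≤ (1 - c * η) ^ (1 : ℝ) :=
          Real.rpow_le_rpow_of_exponent_ge' (by linarith)
            (by linarith [mul_pos hc hη]) zero_le_one (by linarith)
      _ = _ := Real.rpow_one _
  have h6 := mul_le_mul_of_nonneg_left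
    (add_rpow_mul_le (p := p) (by linarith) hκ hx hs) (mul_nonneg hD0.le hη.le)
  have h7 : D * ((1 + κ) ^ (p - 1) * κ) * (η * x ^ p) ≤ c / 2 * (η * x ^ p) := by gcongr
  rw [hD] at h6 h7 ⊢
  linarith

/-- One step of a noisy contraction, measured by an exponential. -/
lemma exp_contraction_step {c K θ η x X w : ℝ} (hc : 0 < c) (hθ : 0 < θ)
    (hη : 0 < η) (hcη : c * η ≤ 1) (hx : 0 ≤ x) (hθK : θ * K ≤ c / 2)
    (hX : X ^ 2 ≤ K * (η * x)) (hw : w ≤ (1 - c * η) * x + X + K * η) :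
    Real.exp (θ * w) ≤ (1 - c / 2 * η) * Real.exp (θ * x)
      + θ * Real.exp (θ * ((1 - c * η) * x + K * η)) * X
      + c / 2 * η * Real.exp (θ * K / (c / 2)) := by
  -- In exp y ≤ y + exp(y²) the linear part stays a martingale term, while the remainder only sees
  -- `X ^ 2`, which is of order `η * x`.
  have hexp : ∀ y : ℝ, Real.exp y ≤ y + Real.exp (y ^ 2) := by
    intro y
    have h1 := Real.add_one_le_exp (y ^ 2)
    rcases le_total 1 |y| with hy | hy
    · rcases le_total 0 y with h0 | h0
      · rw [abs_of_nonneg h0] at hy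
        have : Real.exp y ≤ Real.exp (y ^ 2) := Real.exp_le_exp.2 (by nlinarith)
        linarith
      · have h2 : Real.exp (-y) ≤ Real.exp (y ^ 2) := by
          rw [abs_of_nonpos h0] at hy
          exact Real.exp_le_exp.2 (by nlinarith)
        have h4 : Real.exp y ≤ 1 := Real.exp_le_one_iff.2 h0
        have h5 := Real.quadratic_le_exp_of_nonneg (neg_nonneg.2 h0)
        nlinarith
    · have h2 := Real.abs_exp_sub_one_sub_id_le hy
      have h3 := (abs_le.1 h2).2
      linarith
  have h1 : Real.exp (θ * w)
      ≤ Real.exp (θ * ((1 - c * η) * x + K * η)) * (θ * X + Real.exp ((θ * X) ^ 2)) := by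
    calc Real.exp (θ * w) ≤ Real.exp (θ * ((1 - c * η) * x + K * η) + θ * X) := by
          apply Real.exp_le_exp.2
          nlinarith [mul_le_mul_of_nonneg_left hw hθ.le]
      _ = Real.exp (θ * ((1 - c * η) * x + K * η)) * Real.exp (θ * X) := Real.exp_add _ _
      _ ≤ _ := by gcongr; exact hexp _
  -- Since `θ * K ≤ c / 2`, the square `(θ * X) ^ 2` costs half of the contraction. What remains in
  -- the exponent is a convex combination of `θ * x` and a constant, so convexity of exp applies
  -- next.
  have h2 : Real.exp (θ * ((1 - c * η) * x + K * η)) * Real.exp ((θ * X) ^ 2)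
      ≤ Real.exp ((1 - c / 2 * η) * (θ * x) + c / 2 * η * (θ * K / (c / 2))) := by
    rw [← Real.exp_add]
    apply Real.exp_le_exp.2
    have h3 : (θ * X) ^ 2 ≤ θ * (c / 2) * (η * x) := by
      calc (θ * X) ^ 2 = θ ^ 2 * X ^ 2 := by ring
        _ ≤ θ ^ 2 * (K * (η * x)) := by gcongr
        _ = θ * (θ * K) * (η * x) := by ring
        _ ≤ _ := by gcongr
    have h4 : c / 2 * η * (θ * K / (c / 2)) = θ * (K * η) := by field_simp
    rw [h4]; linarith
  have h3 : Real.exp ((1 - c / 2 * η) * (θ * x) + c / 2 * η * (θ * K / (c / 2)))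
      ≤ (1 - c / 2 * η) * Real.exp (θ * x) + c / 2 * η * Real.exp (θ * K / (c / 2)) := by
    obtain ⟨-, hconv⟩ := convexOn_exp
    have := hconv (Set.mem_univ (θ * x)) (Set.mem_univ (θ * K / (c / 2)))
      (show 0 ≤ 1 - c / 2 * η by nlinarith) (show 0 ≤ c / 2 * η by positivity) (by ring)
    simpa [smul_eq_mul] using this
  have h4 : Real.exp (θ * ((1 - c * η) * x + K * η)) * (θ * X + Real.exp ((θ * X) ^ 2))
    = θ * Real.exp (θ * ((1 - c * η) * x + K * η)) * X
      + Real.exp (θ * ((1 - c * η) * x + K * η)) * Real.exp ((θ * X) ^ 2) := by ring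
  linarith

/-! ### Square-integrable martingale differences -/

section Probability

variable {Ω : Type*} {mΩ : MeasurableSpace Ω} {P : Measure Ω} {ℱ : Filtration ℕ mΩ}

/-- A series of nonnegative functions with summable integrals is almost surely summable. -/
lemma ae_summable_of_sum_integral_le {f : ℕ → Ω → ℝ} (hf0 : ∀ s ω, 0 ≤ f s ω)
    (hfi : ∀ s, Integrable (f s) P) {B : ℝ}
    (hB : ∀ t, ∑ s ∈ Finset.range t, ∫ ω, f s ω ∂P ≤ B) :
    ∀ᵐ ω ∂P, Summable fun s => f s ω := by
  have hs : Summable fun s => ∫ ω, f s ω ∂P :=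
    summable_of_sum_range_le (fun s => integral_nonneg (hf0 s)) hB
  have h1 : ∫⁻ ω, ∑' s, ENNReal.ofReal (f s ω) ∂P ≠ ⊤ := by
    rw [lintegral_tsum fun s => (hfi s).aestronglyMeasurable.aemeasurable.ennreal_ofReal]
    simp_rw [← ofReal_integral_eq_lintegral_ofReal (hfi _) (ae_of_all _ (hf0 _))]
    rw [← ENNReal.ofReal_tsum_of_nonneg (fun s => integral_nonneg (hf0 s)) hs]
    exact ENNReal.ofReal_ne_top
  have h2 := ae_lt_top' (AEMeasurable.tsum fun s =>
    (hfi s).aestronglyMeasurable.aemeasurable.ennreal_ofReal) h1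
  filter_upwards [h2] with ω hω
  have := ENNReal.summable_toReal hω.ne
  simpa only [ENNReal.toReal_ofReal (hf0 _ _)] using this

variable {E : Type*} [NormedAddCommGroup E] [InnerProductSpace ℝ E]

lemma integrable_inner_of_memLp_two {f g : Ω → E} (hf : MemLp f 2 P) (hg : MemLp g 2 P) :
    Integrable (fun ω => inner ℝ (f ω) (g ω)) P := by
  refine (hf.norm.integrable_mul hg.norm).mono
    (hf.aestronglyMeasurable.inner hg.aestronglyMeasurable) (ae_of_all _ fun ω => ?_)
  simpa using norm_inner_le_norm (𝕜 := ℝ) (f ω) (g ω)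

/-- Square-integrable martingale differences: `e t` is measurable at time `t + 1` and orthogonal
to every square-integrable vector known at time `t`. -/
structure IsMartingaleDiff (P : Measure Ω) (ℱ : Filtration ℕ mΩ) (e : ℕ → Ω → E) : Prop where
  stronglyMeasurable : ∀ t, StronglyMeasurable[ℱ (t + 1)] (e t)
  memLp : ∀ t, MemLp (e t) 2 P
  orthogonal : ∀ t (φ : Ω → E), StronglyMeasurable[ℱ t] φ → MemLp φ 2 P →
    ∫ ω, inner ℝ (φ ω) (e t ω) ∂P = 0

lemma IsMartingaleDiff.setIntegral_inner {e : ℕ → Ω → E} (he : IsMartingaleDiff P ℱ e) (t : ℕ)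
    {φ : Ω → E} (hφ : StronglyMeasurable[ℱ t] φ) {s : Set Ω} (hs : MeasurableSet[ℱ t] s)
    (hφ2 : MemLp φ 2 (P.restrict s)) :
    ∫ ω in s, inner ℝ (φ ω) (e t ω) ∂P = 0 := by
  rw [← integral_indicator (ℱ.le t s hs)]
  have h := he.orthogonal t (s.indicator φ) (hφ.indicator hs)
    ((memLp_indicator_iff_restrict (ℱ.le t s hs)).2 hφ2)
  rw [← h]
  congr 1 with ω
  by_cases hω : ω ∈ s <;> simp [hω]

/-- An event of `ℱ 0` is known at every time, so its indicator can be moved onto the test vector.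
This permits cutting down to bounded initial values. -/
lemma IsMartingaleDiff.restrict {e : ℕ → Ω → E} (he : IsMartingaleDiff P ℱ e)
    {s : Set Ω} (hs : MeasurableSet[ℱ 0] s) : IsMartingaleDiff (P.restrict s) ℱ e where
  stronglyMeasurable := he.stronglyMeasurable
  memLp t := (he.memLp t).restrict s
  orthogonal t _ hφ hφ2 := he.setIntegral_inner t hφ (ℱ.mono (Nat.zero_le t) s hs) hφ2

/-- Orthogonality survives multiplication by known indicators and deterministic weights. This is the
form taken by the localized, weighted noise. -/
lemma IsMartingaleDiff.indicator_smul {e : ℕ → Ω → E} (he : IsMartingaleDiff P ℱ e)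
    {A : ℕ → Set Ω} (hA : ∀ t, MeasurableSet[ℱ t] (A t)) (c : ℕ → ℝ) :
    IsMartingaleDiff P ℱ (fun t => (A t).indicator fun ω => c t • e t ω) where
  stronglyMeasurable t :=
    ((he.stronglyMeasurable t).const_smul (c t)).indicator (ℱ.mono (Nat.le_succ t) _ (hA t))
  memLp t := ((he.memLp t).const_smul (c t)).indicator (ℱ.le t _ (hA t))
  orthogonal t φ hφ hφ2 := by
    have h := he.setIntegral_inner t hφ (hA t) (hφ2.restrict _)
    rw [← integral_indicator (ℱ.le t _ (hA t))] at h
    rw [← mul_zero (c t), ← h, ← integral_const_mul]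
    congr 1 with ω
    by_cases hω : ω ∈ A t <;> simp [hω, inner_smul_right]

/-- An `L²`-bounded vector-valued martingale is almost surely bounded. -/
lemma IsMartingaleDiff.ae_bddAbove_norm_sum [IsFiniteMeasure P] {e : ℕ → Ω → E}
    (he : IsMartingaleDiff P ℱ e) {B : ℝ}
    (hB : ∀ t, ∑ s ∈ Finset.range t, ∫ ω, ‖e s ω‖ ^ 2 ∂P ≤ B) :
    ∀ᵐ ω ∂P, ∃ C, ∀ t, ‖∑ s ∈ Finset.range t, e s ω‖ ≤ C := by
  set M : ℕ → Ω → E := fun t ω => ∑ s ∈ Finset.range t, e s ω with hM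
  have hMsm : ∀ t, StronglyMeasurable[ℱ t] (M t) := fun t =>
    Finset.stronglyMeasurable_fun_sum _ fun s hs =>
      (he.stronglyMeasurable s).mono (ℱ.mono (Finset.mem_range.1 hs))
  have hML : ∀ t, MemLp (M t) 2 P := fun t => memLp_finsetSum _ fun s _ => he.memLp s
  have hint : ∀ t, Integrable (fun ω => ‖M t ω‖ ^ 2) P :=
    fun t => (hML t).integrable_norm_pow two_ne_zero
  have heint : ∀ t, Integrable (fun ω => ‖e t ω‖ ^ 2) P :=
    fun t => (he.memLp t).integrable_norm_pow two_ne_zero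
  have hin : ∀ t, Integrable (fun ω => inner ℝ (M t ω) (e t ω)) P := fun t =>
    integrable_inner_of_memLp_two (hML t) (he.memLp t)
  have hexp : ∀ t ω, ‖M (t + 1) ω‖ ^ 2
      = ‖M t ω‖ ^ 2 + 2 * inner ℝ (M t ω) (e t ω) + ‖e t ω‖ ^ 2 := fun t ω => by
    simp only [hM, Finset.sum_range_succ]
    exact norm_add_sq_real _ _
  have hset : ∀ t s, MeasurableSet[ℱ t] s → ∫ ω in s, ‖M (t + 1) ω‖ ^ 2 ∂P
      = ∫ ω in s, ‖M t ω‖ ^ 2 ∂P + ∫ ω in s, ‖e t ω‖ ^ 2 ∂P := fun t s hs => by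
    simp_rw [hexp]
    have hi : Integrable (fun ω => ‖M t ω‖ ^ 2 + 2 * inner ℝ (M t ω) (e t ω)) P :=
      (hint t).add ((hin t).const_mul 2)
    rw [integral_add hi.restrict (heint t).restrict,
      integral_add (hint t).restrict ((hin t).const_mul 2).restrict, integral_const_mul,
      he.setIntegral_inner t (hMsm t) hs ((hML t).restrict s)]
    ring
  -- The squared norm of the partial sums is a scalar submartingale because the cross term vanishes
  -- on every set of `ℱ t`. Being bounded in L¹ it converges almost surely, hence is bounded along
  -- almost every path.
  have hsub : Submartingale (fun t ω => ‖M t ω‖ ^ 2) ℱ P := by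
    refine submartingale_of_setIntegral_le_succ (fun t => ((hMsm t).norm.pow 2)) hint ?_
    intro t s hs
    rw [hset t s hs]
    have : 0 ≤ ∫ ω in s, ‖e t ω‖ ^ 2 ∂P := integral_nonneg fun ω => by positivity
    linarith
  have hval : ∀ t, ∫ ω, ‖M t ω‖ ^ 2 ∂P = ∑ s ∈ Finset.range t, ∫ ω, ‖e s ω‖ ^ 2 ∂P := by
    intro t
    induction t with
    | zero => simp [hM]
    | succ n ih =>
      have := hset n Set.univ MeasurableSet.univ
      rw [Measure.restrict_univ] at this
      rw [this, ih, Finset.sum_range_succ]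
  have hbdd : ∀ t, eLpNorm (fun ω => ‖M t ω‖ ^ 2) 1 P ≤ (B.toNNReal : ℝ≥0∞) := by
    intro t
    rw [eLpNorm_one_eq_lintegral_enorm, ← ofReal_integral_norm_eq_lintegral_enorm (hint t)]
    simp only [norm_pow, norm_norm]
    rw [hval]
    exact ENNReal.ofReal_le_ofReal (hB t)
  filter_upwards [hsub.exists_ae_tendsto_of_bdd hbdd] with ω ⟨c, hc⟩
  obtain ⟨K, hK⟩ := hc.bddAbove_range
  refine ⟨Real.sqrt K, fun t => ?_⟩
  exact Real.le_sqrt_of_sq_le (hK ⟨t, rfl⟩)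

end Probability

/-! ### Almost sure convergence through a Lyapunov function -/

section Descent

variable {E : Type*} [NormedAddCommGroup E] [InnerProductSpace ℝ E]

/-- `V` is a smooth Lyapunov function, with gradient `dV`, for the vector field `γ` vanishing at
the origin. -/
structure IsLyapunov (γ : E → E) (V : E → ℝ) (dV : E → E) (μ L Lγ : ℝ) : Prop where
  pos_lower : 0 < μ
  pos_upper : 0 < L
  continuous_field : Continuous γ
  field_le : ∀ y, ‖γ y‖ ≤ Lγ * ‖y‖
  continuous_grad : Continuous dV
  grad_le : ∀ y, ‖dV y‖ ≤ L * ‖y‖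
  continuous : Continuous V
  lower : ∀ y, μ * ‖y‖ ^ 2 ≤ V y
  upper : ∀ y, V y ≤ L * ‖y‖ ^ 2
  descent : ∀ y h, V (y + h) ≤ V y + inner ℝ (dV y) h + L * ‖h‖ ^ 2
  drift_pos : ∀ y, y ≠ 0 → 0 < inner ℝ (dV y) (γ y)

namespace IsLyapunov

variable {γ : E → E} {V : E → ℝ} {dV : E → E} {μ L Lγ : ℝ}

lemma nonneg (h : IsLyapunov γ V dV μ L Lγ) (y : E) : 0 ≤ V y :=
  (mul_nonneg h.pos_lower.le (sq_nonneg _)).trans (h.lower y)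

lemma norm_sq_le (h : IsLyapunov γ V dV μ L Lγ) (y : E) : ‖y‖ ^ 2 ≤ V y / μ := by
  rw [le_div_iff₀' h.pos_lower]; exact h.lower y

lemma drift_nonneg (h : IsLyapunov γ V dV μ L Lγ) (y : E) : 0 ≤ inner ℝ (dV y) (γ y) := by
  rcases eq_or_ne y 0 with rfl | hy
  · have : dV 0 = 0 := by simpa using h.grad_le 0
    simp [this]
  · exact (h.drift_pos y hy).le

/-- The quadratic term of the descent inequality is split between field and noise. Since the squared
field is at most a multiple of `V`, its share is only a factor 1 + O(η²), harmless when the squared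
steps are summable. -/
lemma step_le (h : IsLyapunov γ V dV μ L Lγ) (η : ℝ) (y e : E) :
    V (y - η • (γ y - e)) ≤ (1 + 2 * L * Lγ ^ 2 / μ * η ^ 2) * V y - η * inner ℝ (dV y) (γ y)
      + η * inner ℝ (dV y) e + 2 * L * η ^ 2 * ‖e‖ ^ 2 := by
  have h1 := h.descent y (-(η • (γ y - e)))
  rw [← sub_eq_add_neg, norm_neg, norm_smul, mul_pow, Real.norm_eq_abs, sq_abs, inner_neg_right,
    inner_smul_right, inner_sub_right] at h1
  have h2 : ‖γ y - e‖ ^ 2 ≤ 2 * ‖γ y‖ ^ 2 + 2 * ‖e‖ ^ 2 := by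
    have := norm_sub_le (γ y) e
    nlinarith [norm_nonneg (γ y - e), sq_nonneg (‖γ y‖ - ‖e‖), norm_nonneg (γ y), norm_nonneg e]
  have h3 : ‖γ y‖ ^ 2 ≤ Lγ ^ 2 * (V y / μ) := by
    calc ‖γ y‖ ^ 2 ≤ (Lγ * ‖y‖) ^ 2 := pow_le_pow_left₀ (norm_nonneg _) (h.field_le y) 2
      _ = Lγ ^ 2 * ‖y‖ ^ 2 := by ring
      _ ≤ _ := mul_le_mul_of_nonneg_left (h.norm_sq_le y) (sq_nonneg _)
  have h4 : L * (η ^ 2 * ‖γ y - e‖ ^ 2) ≤ L * (η ^ 2 * (2 * (Lγ ^ 2 * (V y / μ)) + 2 * ‖e‖ ^ 2)) := by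
    have := h.pos_upper.le
    gcongr
    linarith
  have h5 : L * (η ^ 2 * (2 * (Lγ ^ 2 * (V y / μ)) + 2 * ‖e‖ ^ 2))
      = 2 * L * Lγ ^ 2 / μ * η ^ 2 * V y + 2 * L * η ^ 2 * ‖e‖ ^ 2 := by
    have := h.pos_lower.ne'
    field_simp
  linarith

end IsLyapunov

variable {Ω : Type*} {mΩ : MeasurableSpace Ω} {P : Measure Ω} {ℱ : Filtration ℕ mΩ}

/-- The recursion `Δ_{t+1} = Δ_t - η_t (γ(Δ_t) - e_t)` driven by martingale differences `e`. -/
structure IsNoisyDescent (P : Measure Ω) (ℱ : Filtration ℕ mΩ) (η : ℕ → ℝ) (γ : E → E)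
    (Δ e : ℕ → Ω → E) : Prop where
  noise : IsMartingaleDiff P ℱ e
  stronglyMeasurable : ∀ t, StronglyMeasurable[ℱ t] (Δ t)
  step_pos : ∀ t, 0 < η t
  recursion : ∀ t ω, Δ (t + 1) ω = Δ t ω - η t • (γ (Δ t ω) - e t ω)

/-- A discrete Gronwall bound: the product of the factors 1 + a is at most the exponential of their
sum. -/
lemma bounded_of_perturbed_recursion {v a b : ℕ → ℝ} (hv : ∀ t, 0 ≤ v t) (ha : ∀ t, 0 ≤ a t)
    (hb : ∀ t, 0 ≤ b t) (has : Summable a) (hbs : Summable b)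
    (h : ∀ t, v (t + 1) ≤ (1 + a t) * v t + b t) (t : ℕ) :
    v t ≤ Real.exp (∑' s, a s) * (v 0 + ∑' s, b s) := by
  have key : ∀ t, v t ≤ Real.exp (∑ s ∈ Finset.range t, a s)
      * (v 0 + ∑ s ∈ Finset.range t, b s) := by
    intro t
    induction t with
    | zero => simp
    | succ n ih =>
      rw [Finset.sum_range_succ, Finset.sum_range_succ, Real.exp_add]
      set A := Real.exp (∑ s ∈ Finset.range n, a s)
      set B := v 0 + ∑ s ∈ Finset.range n, b s with hBdef
      have hA : 1 ≤ A := Real.one_le_exp (Finset.sum_nonneg fun s _ => ha s)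
      have hB : 0 ≤ B := add_nonneg (hv 0) (Finset.sum_nonneg fun s _ => hb s)
      have h1 : 1 + a n ≤ Real.exp (a n) := by linarith [Real.add_one_le_exp (a n)]
      have h2 : 1 ≤ A * Real.exp (a n) := one_le_mul_of_one_le_of_one_le hA (by linarith [ha n])
      calc v (n + 1) ≤ (1 + a n) * v n + b n := h n
        _ ≤ Real.exp (a n) * (A * B) + A * Real.exp (a n) * b n := by
            refine add_le_add (mul_le_mul h1 ih (hv n) (Real.exp_pos _).le) ?_
            exact le_mul_of_one_le_left (hb n) h2
        _ = A * Real.exp (a n) * (v 0 + (∑ s ∈ Finset.range n, b s + b n)) := by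
            rw [hBdef]; ring
  refine (key t).trans (mul_le_mul ?_ ?_ ?_ (Real.exp_pos _).le)
  · exact Real.exp_le_exp.2 (has.sum_le_tsum _ fun s _ => ha s)
  · exact add_le_add le_rfl (hbs.sum_le_tsum _ fun s _ => hb s)
  · exact add_nonneg (hv 0) (Finset.sum_nonneg fun s _ => hb s)

/-- The pathwise part of the convergence proof. -/
lemma IsLyapunov.tendsto_zero_of_tendsto [ProperSpace E] {γ : E → E} {V : E → ℝ} {dV : E → E}
    {μ L Lγ : ℝ} (h : IsLyapunov γ V dV μ L Lγ) {η : ℕ → ℝ} (hη : ∀ t, 0 < η t)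
    (hηs : ¬ Summable η) {y : ℕ → E} {c : ℝ}
    (hc : Tendsto (fun t => V (y t)
      + ∑ s ∈ Finset.range t, η s * inner ℝ (dV (y s)) (γ (y s))) atTop (𝓝 c)) :
    Tendsto y atTop (𝓝 0) := by
  set D : ℕ → ℝ := fun s => η s * inner ℝ (dV (y s)) (γ (y s)) with hD
  have hD0 : ∀ s, 0 ≤ D s := fun s => mul_nonneg (hη s).le (h.drift_nonneg _)
  obtain ⟨K, hK⟩ := hc.bddAbove_range
  -- Boundedness of the total and `V ≥ 0` bound the accumulated drift, so the drift series
  -- converges, and then `V (y t)` converges as well.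
  have hDs : Summable D := summable_of_sum_range_le hD0 (c := K) fun t => by
    have := hK ⟨t, rfl⟩
    simp only at this
    linarith [h.nonneg (y t)]
  have hV : Tendsto (fun t => V (y t)) atTop (𝓝 (c - ∑' s, D s)) := by
    have := hc.sub hDs.hasSum.tendsto_sum_nat
    simpa using this
  set v := c - ∑' s, D s
  have hv : 0 ≤ v := ge_of_tendsto' hV fun t => h.nonneg _
  rcases hv.eq_or_lt with hv0 | hv0
  · rw [← hv0] at hV
    rw [tendsto_zero_iff_norm_tendsto_zero]
    have h1 : Tendsto (fun t => Real.sqrt (V (y t) / μ)) atTop (𝓝 0) := by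
      have := (hV.div_const μ).sqrt
      simpa using this
    refine squeeze_zero (fun t => norm_nonneg _) (fun t => ?_) h1
    exact Real.le_sqrt_of_sq_le (h.norm_sq_le _)
  · exfalso
    -- With a positive limit `v`, the path ends up in a compact shell avoiding the origin, where the
    -- drift has a positive minimum. Convergence of the drift series would then force the steps to
    -- be summable.
    set S : Set E := {z | v / 2 ≤ V z ∧ V z ≤ 2 * v} with hS
    have hev : ∀ᶠ t in atTop, y t ∈ S := by
      have := hV.eventually (Icc_mem_nhds (show v / 2 < v by linarith) (show v < 2 * v by linarith))
      filter_upwards [this] with t ht using ⟨ht.1, ht.2⟩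
    have hcomp : IsCompact S := by
      apply Metric.isCompact_of_isClosed_isBounded
      · exact (isClosed_le continuous_const h.continuous).inter
          (isClosed_le h.continuous continuous_const)
      · refine isBounded_iff_forall_norm_le.2 ⟨Real.sqrt (2 * v / μ), fun z hz => ?_⟩
        refine Real.le_sqrt_of_sq_le ((h.norm_sq_le z).trans ?_)
        exact div_le_div_of_nonneg_right hz.2 h.pos_lower.le
    obtain ⟨t0, ht0⟩ := hev.exists
    obtain ⟨z, hz, hmin⟩ := hcomp.exists_isMinOn ⟨_, ht0⟩
      ((h.continuous_grad.inner (𝕜 := ℝ) h.continuous_field).continuousOn)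
    have hz0 : z ≠ 0 := by
      rintro rfl
      have := h.upper 0
      have h2 := hz.1
      simp at this
      linarith
    have hpos := h.drift_pos z hz0
    apply hηs
    have h1 : Summable fun t => (inner ℝ (dV z) (γ z))⁻¹ * D t := hDs.mul_left _
    refine Summable.of_norm_bounded_eventually_nat h1 ?_
    filter_upwards [hev] with t ht
    have h2 : inner ℝ (dV z) (γ z) ≤ inner ℝ (dV (y t)) (γ (y t)) := hmin ht
    rw [Real.norm_of_nonneg (hη t).le, ← div_eq_inv_mul, le_div_iff₀ hpos]
    exact mul_le_mul_of_nonneg_left h2 (hη t).le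

section

variable {γ : E → E} {V : E → ℝ} {dV : E → E} {μ L Lγ : ℝ} {η : ℕ → ℝ} {Δ e : ℕ → Ω → E}

lemma IsNoisyDescent.memLp (h : IsNoisyDescent P ℱ η γ Δ e) (hV : IsLyapunov γ V dV μ L Lγ)
    (h0 : MemLp (Δ 0) 2 P) (t : ℕ) : MemLp (Δ t) 2 P := by
  induction t with
  | zero => exact h0
  | succ n ih =>
    have h1 : MemLp (fun ω => γ (Δ n ω)) 2 P :=
      ih.of_le_mul (hV.continuous_field.comp_stronglyMeasurable
        ((h.stronglyMeasurable n).mono (ℱ.le n))).aestronglyMeasurable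
        (ae_of_all _ fun ω => hV.field_le _)
    have : Δ (n + 1) = Δ n - η n • ((fun ω => γ (Δ n ω)) - e n) := by
      ext1 ω; simp [h.recursion n ω]
    rw [this]
    exact ih.sub ((h1.sub (h.noise.memLp n)).const_smul _)

/-- The Robbins–Siegmund argument. Summable squared steps keep the expected Lyapunov values bounded,
so the perturbations `N` have summable expectation. The Lyapunov value plus accumulated drift minus
accumulated `N` is an L¹-bounded supermartingale; adding the almost surely convergent series of `N`
back gives exactly the quantity needed by the pathwise lemma. -/
lemma IsNoisyDescent.ae_tendsto_zero_of_memLp [ProperSpace E] [IsFiniteMeasure P]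
    (h : IsNoisyDescent P ℱ η γ Δ e)
    (hV : IsLyapunov γ V dV μ L Lγ) (h0 : MemLp (Δ 0) 2 P) {B : ℝ}
    (hB : ∀ t, ∫ ω, ‖e t ω‖ ^ 2 ∂P ≤ B) (hη2 : Summable fun t => η t ^ 2) (hηs : ¬ Summable η) :
    ∀ᵐ ω ∂P, Tendsto (fun t => Δ t ω) atTop (𝓝 0) := by
  have hμ := hV.pos_lower
  have hL := hV.pos_upper
  have hΔ := h.memLp hV h0
  have hΔm : ∀ t, StronglyMeasurable (Δ t) := fun t => (h.stronglyMeasurable t).mono (ℱ.le t)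
  have hsq : ∀ t, Integrable (fun ω => ‖Δ t ω‖ ^ 2) P :=
    fun t => (hΔ t).integrable_norm_pow two_ne_zero
  have heint : ∀ t, Integrable (fun ω => ‖e t ω‖ ^ 2) P :=
    fun t => (h.noise.memLp t).integrable_norm_pow two_ne_zero
  have hdV : ∀ t, MemLp (fun ω => dV (Δ t ω)) 2 P := fun t =>
    (hΔ t).of_le_mul (hV.continuous_grad.comp_stronglyMeasurable (hΔm t)).aestronglyMeasurable
      (ae_of_all _ fun ω => hV.grad_le _)
  have hγ : ∀ t, MemLp (fun ω => γ (Δ t ω)) 2 P := fun t =>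
    (hΔ t).of_le_mul (hV.continuous_field.comp_stronglyMeasurable (hΔm t)).aestronglyMeasurable
      (ae_of_all _ fun ω => hV.field_le _)
  have hVint : ∀ t, Integrable (fun ω => V (Δ t ω)) P := fun t =>
    ((hsq t).const_mul L).mono' (hV.continuous.comp_stronglyMeasurable (hΔm t)).aestronglyMeasurable
      (ae_of_all _ fun ω => by rw [Real.norm_of_nonneg (hV.nonneg _)]; exact hV.upper _)
  have hDint : ∀ t, Integrable (fun ω => inner ℝ (dV (Δ t ω)) (γ (Δ t ω))) P := fun t =>
    integrable_inner_of_memLp_two (hdV t) (hγ t)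
  have hXint : ∀ t, Integrable (fun ω => inner ℝ (dV (Δ t ω)) (e t ω)) P := fun t =>
    integrable_inner_of_memLp_two (hdV t) (h.noise.memLp t)
  set C := 2 * L * Lγ ^ 2 / μ with hC
  have hC0 : 0 ≤ C := by positivity
  have hB0 : 0 ≤ B := (integral_nonneg fun ω => by positivity).trans (hB 0)
  have hstep : ∀ t ω, V (Δ (t + 1) ω) ≤ (1 + C * η t ^ 2) * V (Δ t ω)
      - η t * inner ℝ (dV (Δ t ω)) (γ (Δ t ω)) + η t * inner ℝ (dV (Δ t ω)) (e t ω)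
      + 2 * L * η t ^ 2 * ‖e t ω‖ ^ 2 := fun t ω => by
    rw [h.recursion]; exact hV.step_le _ _ _
  -- the perturbation terms
  set N : ℕ → Ω → ℝ := fun t ω => C * η t ^ 2 * V (Δ t ω) + 2 * L * η t ^ 2 * ‖e t ω‖ ^ 2 with hN
  have hN0 : ∀ t ω, 0 ≤ N t ω := fun t ω => by
    have := hV.nonneg (Δ t ω); simp only [hN]; positivity
  have hNint : ∀ t, Integrable (N t) P := fun t =>
    ((hVint t).const_mul _).add ((heint t).const_mul _)
  have hset : ∀ t s, MeasurableSet[ℱ t] s → ∫ ω in s, V (Δ (t + 1) ω) ∂P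
      ≤ ∫ ω in s, (V (Δ t ω) - η t * inner ℝ (dV (Δ t ω)) (γ (Δ t ω)) + N t ω) ∂P := by
    intro t s hs
    have h1 := h.noise.setIntegral_inner t (φ := fun ω => dV (Δ t ω))
      (hV.continuous_grad.comp_stronglyMeasurable (h.stronglyMeasurable t)) hs ((hdV t).restrict s)
    have hi1 : Integrable (fun ω => V (Δ t ω) - η t * inner ℝ (dV (Δ t ω)) (γ (Δ t ω)) + N t ω)
        (P.restrict s) := (((hVint t).sub ((hDint t).const_mul _)).add (hNint t)).restrict
    have hi2 : Integrable (fun ω => η t * inner ℝ (dV (Δ t ω)) (e t ω)) (P.restrict s) :=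
      ((hXint t).const_mul _).restrict
    have h2 : ∫ ω in s, V (Δ (t + 1) ω) ∂P ≤ ∫ ω in s,
        (V (Δ t ω) - η t * inner ℝ (dV (Δ t ω)) (γ (Δ t ω)) + N t ω
          + η t * inner ℝ (dV (Δ t ω)) (e t ω)) ∂P := by
      refine integral_mono (hVint _).restrict (hi1.add hi2) fun ω => ?_
      have := hstep t ω
      simp only [hN]
      linarith
    rwa [integral_add hi1 hi2, integral_const_mul, h1, mul_zero, add_zero] at h2
  -- boundedness of the expected Lyapunov values
  have hvrec : ∀ t, ∫ ω, V (Δ (t + 1) ω) ∂P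
      ≤ (1 + C * η t ^ 2) * ∫ ω, V (Δ t ω) ∂P + 2 * L * B * η t ^ 2 := by
    intro t
    have h1 := hset t Set.univ MeasurableSet.univ
    rw [Measure.restrict_univ] at h1
    have h2 : ∫ ω, (V (Δ t ω) - η t * inner ℝ (dV (Δ t ω)) (γ (Δ t ω)) + N t ω) ∂P
        ≤ ∫ ω, ((1 + C * η t ^ 2) * V (Δ t ω) + 2 * L * η t ^ 2 * ‖e t ω‖ ^ 2) ∂P := by
      refine integral_mono (((hVint t).sub ((hDint t).const_mul _)).add (hNint t))
        (((hVint t).const_mul _).add ((heint t).const_mul _)) fun ω => ?_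
      have := mul_nonneg (h.step_pos t).le (hV.drift_nonneg (Δ t ω))
      simp only [hN]
      linarith
    rw [integral_add ((hVint t).const_mul _) ((heint t).const_mul _), integral_const_mul,
      integral_const_mul] at h2
    have h3 : 2 * L * η t ^ 2 * ∫ ω, ‖e t ω‖ ^ 2 ∂P ≤ 2 * L * η t ^ 2 * B :=
      mul_le_mul_of_nonneg_left (hB t) (by positivity)
    linarith
  obtain ⟨v, hv⟩ : ∃ v, ∀ t, ∫ ω, V (Δ t ω) ∂P ≤ v :=
    ⟨_, bounded_of_perturbed_recursion (fun t => integral_nonneg fun ω => hV.nonneg _)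
      (fun t => by positivity) (fun t => by positivity) (hη2.mul_left C)
      (hη2.mul_left (2 * L * B)) hvrec⟩
  have hNsum : ∀ t, ∑ s ∈ Finset.range t, ∫ ω, N s ω ∂P
      ≤ (C * v + 2 * L * B) * ∑' s, η s ^ 2 := by
    intro t
    have hv0 : 0 ≤ v := (integral_nonneg fun ω => hV.nonneg _).trans (hv 0)
    calc ∑ s ∈ Finset.range t, ∫ ω, N s ω ∂P
        ≤ ∑ s ∈ Finset.range t, (C * v + 2 * L * B) * η s ^ 2 := by
          refine Finset.sum_le_sum fun s _ => ?_
          simp only [hN]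
          rw [integral_add ((hVint s).const_mul _) ((heint s).const_mul _), integral_const_mul,
            integral_const_mul]
          have h1 := mul_le_mul_of_nonneg_left (hv s) (show 0 ≤ C * η s ^ 2 by positivity)
          have h2 := mul_le_mul_of_nonneg_left (hB s) (show 0 ≤ 2 * L * η s ^ 2 by positivity)
          linarith
      _ ≤ _ := by
          rw [← Finset.mul_sum]
          exact mul_le_mul_of_nonneg_left (hη2.sum_le_tsum _ fun s _ => sq_nonneg _) (by positivity)
  -- the supermartingale
  set U : ℕ → Ω → ℝ := fun t ω => V (Δ t ω)
    + ∑ s ∈ Finset.range t, (η s * inner ℝ (dV (Δ s ω)) (γ (Δ s ω)) - N s ω) with hU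
  have hincint : ∀ s, Integrable
      (fun ω => η s * inner ℝ (dV (Δ s ω)) (γ (Δ s ω)) - N s ω) P := fun s =>
    ((hDint s).const_mul _).sub (hNint s)
  have hUint : ∀ t, Integrable (U t) P := fun t =>
    (hVint t).add (integrable_finsetSum _ fun s _ => hincint s)
  have hUad : ∀ t, StronglyMeasurable[ℱ t] (U t) := by
    intro t
    have hVm : ∀ s ≤ t, StronglyMeasurable[ℱ t] fun ω => V (Δ s ω) := fun s hs =>
      hV.continuous.comp_stronglyMeasurable ((h.stronglyMeasurable s).mono (ℱ.mono hs))
    refine (hVm t le_rfl).add (Finset.stronglyMeasurable_fun_sum _ fun s hs => ?_)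
    have hst := Finset.mem_range.1 hs
    have hsm := (h.stronglyMeasurable s).mono (ℱ.mono hst.le)
    refine StronglyMeasurable.sub ?_ (((hVm s hst.le).const_mul _).add
      (((((h.noise.stronglyMeasurable s).mono (ℱ.mono hst)).norm).pow 2).const_mul _))
    exact ((hV.continuous_grad.comp_stronglyMeasurable hsm).inner
      (hV.continuous_field.comp_stronglyMeasurable hsm)).const_mul _
  have hsuper : Supermartingale U ℱ P := by
    refine supermartingale_of_setIntegral_succ_le hUad hUint fun t s hs => ?_
    have h1 : ∀ ω, U (t + 1) ω = V (Δ (t + 1) ω) + (U t ω - (V (Δ t ω)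
        - η t * inner ℝ (dV (Δ t ω)) (γ (Δ t ω)) + N t ω)) := fun ω => by
      simp only [hU, Finset.sum_range_succ]; ring
    have hi : Integrable (fun ω => V (Δ t ω)
        - η t * inner ℝ (dV (Δ t ω)) (γ (Δ t ω)) + N t ω) P :=
      ((hVint t).sub ((hDint t).const_mul _)).add (hNint t)
    have hi' : Integrable (fun ω => U t ω - (V (Δ t ω)
        - η t * inner ℝ (dV (Δ t ω)) (γ (Δ t ω)) + N t ω)) P := (hUint t).sub hi
    simp_rw [h1]
    rw [integral_add (hVint _).restrict hi'.restrict,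
      integral_sub (hUint t).restrict hi.restrict]
    linarith [hset t s hs]
  have hbdd : ∀ t, eLpNorm ((-U) t) 1 P
      ≤ ((∫ ω, V (Δ 0 ω) ∂P + 2 * ((C * v + 2 * L * B) * ∑' s, η s ^ 2)).toNNReal : ℝ≥0∞) := by
    intro t
    rw [Pi.neg_apply, eLpNorm_neg, eLpNorm_one_eq_lintegral_enorm,
      ← ofReal_integral_norm_eq_lintegral_enorm (hUint t)]
    refine ENNReal.ofReal_le_ofReal ?_
    have hsN : Integrable (fun ω => ∑ s ∈ Finset.range t, N s ω) P :=
      integrable_finsetSum _ fun s _ => hNint s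
    -- `U t` is bounded below by minus the accumulated `N`, so its absolute value is at most `U t`
    -- plus twice that sum; the expectation of `U` itself decreases.
    have h1 : ∫ ω, ‖U t ω‖ ∂P ≤ ∫ ω, (U t ω + 2 * ∑ s ∈ Finset.range t, N s ω) ∂P := by
      refine integral_mono (hUint t).norm ((hUint t).add (hsN.const_mul 2)) fun ω => ?_
      have hs0 : 0 ≤ ∑ s ∈ Finset.range t, N s ω := Finset.sum_nonneg fun s _ => hN0 s ω
      have hd0 : 0 ≤ ∑ s ∈ Finset.range t, η s * inner ℝ (dV (Δ s ω)) (γ (Δ s ω)) :=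
        Finset.sum_nonneg fun s _ => mul_nonneg (h.step_pos s).le (hV.drift_nonneg _)
      have hUge : -∑ s ∈ Finset.range t, N s ω ≤ U t ω := by
        simp only [hU, Finset.sum_sub_distrib]
        linarith [hV.nonneg (Δ t ω)]
      rw [Real.norm_eq_abs]
      exact abs_le.2 ⟨by linarith, by linarith⟩
    rw [integral_add (hUint t) (hsN.const_mul 2), integral_const_mul,
      integral_finsetSum _ fun s _ => hNint s] at h1
    have h2 : ∫ ω, U t ω ∂P ≤ ∫ ω, U 0 ω ∂P := by
      have := hsuper.setIntegral_le (Nat.zero_le t) MeasurableSet.univ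
      simpa using this
    have h3 : ∫ ω, U 0 ω ∂P = ∫ ω, V (Δ 0 ω) ∂P := by simp [hU]
    linarith [hNsum t]
  filter_upwards [hsuper.neg.exists_ae_tendsto_of_bdd hbdd,
    ae_summable_of_sum_integral_le hN0 hNint hNsum] with ω ⟨c, hc⟩ hNω
  refine hV.tendsto_zero_of_tendsto h.step_pos hηs (c := -c + ∑' s, N s ω) ?_
  refine (hc.neg.add hNω.hasSum.tendsto_sum_nat).congr fun t => ?_
  simp only [hU, Pi.neg_apply, neg_neg, Finset.sum_sub_distrib]
  ring

/-- Almost sure convergence of a noisy descent with a Lyapunov function. -/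
theorem IsNoisyDescent.ae_tendsto_zero [ProperSpace E] [IsFiniteMeasure P]
    (h : IsNoisyDescent P ℱ η γ Δ e)
    (hV : IsLyapunov γ V dV μ L Lγ) {B : ℝ}
    (hB : ∀ t, ∫ ω, ‖e t ω‖ ^ 2 ∂P ≤ B) (hη2 : Summable fun t => η t ^ 2) (hηs : ¬ Summable η) :
    ∀ᵐ ω ∂P, Tendsto (fun t => Δ t ω) atTop (𝓝 0) := by
  -- No moment of the initial value is assumed; the events `‖Δ 0 ω‖ ≤ K` lie in `ℱ 0`, exhaust the
  -- space, and make the initial value bounded.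
  have key : ∀ K : ℕ, ∀ᵐ ω ∂P, ω ∈ {ω | ‖Δ 0 ω‖ ≤ K} → Tendsto (fun t => Δ t ω) atTop (𝓝 0) := by
    intro K
    have hm0 : MeasurableSet[ℱ 0] {ω | ‖Δ 0 ω‖ ≤ K} :=
      (h.stronglyMeasurable 0).norm.measurableSet_le stronglyMeasurable_const
    have hm := ℱ.le 0 _ hm0
    rw [← ae_restrict_iff' hm]
    have hr : IsNoisyDescent (P.restrict {ω | ‖Δ 0 ω‖ ≤ K}) ℱ η γ Δ e :=
      ⟨h.noise.restrict hm0, h.stronglyMeasurable, h.step_pos, h.recursion⟩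
    refine hr.ae_tendsto_zero_of_memLp hV ?_ (B := B) (fun t => ?_) hη2 hηs
    · refine MemLp.of_bound ((h.stronglyMeasurable 0).mono (ℱ.le 0)).aestronglyMeasurable K ?_
      exact (ae_restrict_iff' hm).2 (ae_of_all _ fun ω hω => hω)
    · refine le_trans ?_ (hB t)
      exact setIntegral_le_integral ((h.noise.memLp t).integrable_norm_pow two_ne_zero)
        (ae_of_all _ fun ω => by positivity)
  filter_upwards [ae_all_iff.2 key] with ω hω
  obtain ⟨K, hK⟩ := exists_nat_ge ‖Δ 0 ω‖
  exact hω K hK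

end

end Descent

/-! ### Polynomial step sizes -/

section StepSize

lemma stepSize_pos {η₀ : ℝ} (hη₀ : 0 < η₀) (a : ℝ) (t : ℕ) : 0 < stepSize η₀ a t := by
  unfold stepSize
  split_ifs with h
  · exact hη₀
  · have : (0 : ℝ) < t := by exact_mod_cast Nat.pos_of_ne_zero h
    positivity

lemma stepSize_succ (η₀ a : ℝ) (t : ℕ) :
    stepSize η₀ a (t + 1) = η₀ * ((t : ℝ) + 1) ^ (-a) := by
  simp [stepSize]

lemma le_stepSize {η₀ a : ℝ} (hη₀ : 0 < η₀) (ha : 0 < a) (t : ℕ) :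
    η₀ * ((t : ℝ) + 1) ^ (-a) ≤ stepSize η₀ a t := by
  cases t with
  | zero => simp [stepSize]
  | succ t =>
    rw [stepSize_succ]
    gcongr η₀ * ?_
    push_cast
    exact Real.rpow_le_rpow_of_nonpos (by positivity) (by linarith) (by linarith)

lemma stepSize_le {η₀ a : ℝ} (hη₀ : 0 < η₀) (ha : 0 < a) (ha1 : a ≤ 1) (t : ℕ) :
    stepSize η₀ a t ≤ 2 * η₀ * ((t : ℝ) + 1) ^ (-a) := by
  cases t with
  | zero => simp [stepSize]; linarith
  | succ t =>
    rw [stepSize_succ]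
    have h1 : (0 : ℝ) < (t : ℝ) + 1 := by positivity
    have h2 : ((((t + 1 : ℕ) : ℝ) + 1) / 2) ^ (-a) ≥ ((t : ℝ) + 1) ^ (-a) :=
      Real.rpow_le_rpow_of_nonpos (by positivity) (by push_cast; linarith) (by linarith)
    rw [Real.div_rpow (by positivity) (by norm_num)] at h2
    have h3 : ((2 : ℝ) ^ (-a))⁻¹ ≤ 2 := by
      rw [← Real.rpow_neg (by norm_num), neg_neg]
      calc (2 : ℝ) ^ a ≤ 2 ^ (1 : ℝ) := Real.rpow_le_rpow_of_exponent_le (by norm_num) ha1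
        _ = 2 := Real.rpow_one 2
    have h4 : 0 ≤ (((t + 1 : ℕ) : ℝ) + 1) ^ (-a) := by positivity
    rw [div_eq_mul_inv] at h2
    nlinarith [mul_le_mul_of_nonneg_left h3 h4]

lemma summable_stepSize_sq {η₀ a : ℝ} (ha : 1 / 2 < a) :
    Summable fun t => stepSize η₀ a t ^ 2 := by
  rw [← summable_nat_add_iff 1]
  have h : Summable fun t : ℕ => η₀ ^ 2 * ((t + 1 : ℕ) : ℝ) ^ (-(2 * a)) :=
    ((summable_nat_add_iff 1).2 (Real.summable_nat_rpow.2 (by linarith))).mul_left _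
  refine h.congr fun t => ?_
  rw [stepSize_succ, mul_pow, ← Real.rpow_mul_natCast (by positivity)]
  push_cast
  congr 2
  ring

lemma not_summable_stepSize {η₀ a : ℝ} (hη₀ : 0 < η₀) (ha : a ≤ 1) :
    ¬ Summable (stepSize η₀ a) := by
  rw [← summable_nat_add_iff 1]
  intro h
  have h2 : Summable fun t : ℕ => ((t + 1 : ℕ) : ℝ) ^ (-a) := by
    refine (h.mul_left η₀⁻¹).congr fun t => ?_
    rw [stepSize_succ, ← mul_assoc, inv_mul_cancel₀ hη₀.ne', one_mul]
    push_cast; rfl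
  have h3 := Real.summable_nat_rpow.1 ((summable_nat_add_iff 1).1 h2)
  linarith

lemma tendsto_stepSize {η₀ a : ℝ} (ha : 0 < a) :
    Tendsto (stepSize η₀ a) atTop (𝓝 0) := by
  have h : Tendsto (fun t : ℕ => η₀ * (t : ℝ) ^ (-a)) atTop (𝓝 0) := by
    simpa using ((tendsto_rpow_neg_atTop ha).comp tendsto_natCast_atTop_atTop).const_mul η₀
  refine h.congr' ?_
  filter_upwards [eventually_ne_atTop 0] with t ht
  simp [stepSize, ht]

/-- The properties of the step sizes that make the rescaled recursion contract. -/
lemma eventually_stepSize_contraction {η₀ a l C : ℝ} (hη₀ : 0 < η₀) (ha : 0 < a) (ha1 : a < 1)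
    (hl : 0 < l) (hC : 0 ≤ C) :
    ∀ᶠ t in atTop, stepSize η₀ a t ≤ 1 ∧ l * stepSize η₀ a t ≤ 1 ∧
      stepSize η₀ a t / stepSize η₀ a (t + 1) ≤ 2 ∧
      stepSize η₀ a t / stepSize η₀ a (t + 1)
        * (1 + C * stepSize η₀ a t ^ 2 - l * stepSize η₀ a t) ≤ 1 - l / 2 * stepSize η₀ a t := by
  have h0 := tendsto_stepSize (η₀ := η₀) ha
  have h1 : ∀ᶠ t in atTop, stepSize η₀ a t ≤ 1 := h0.eventually_le_const one_pos
  have h0' : ∀ b : ℝ, Tendsto (fun t => b * stepSize η₀ a t) atTop (𝓝 0) := fun b => by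
    simpa using h0.const_mul b
  have h2 : ∀ᶠ t in atTop, l * stepSize η₀ a t ≤ 1 := (h0' l).eventually_le_const one_pos
  have h3 : ∀ᶠ t in atTop, C * stepSize η₀ a t ≤ min 1 (l / 4) :=
    (h0' C).eventually_le_const (by positivity)
  have h4 : ∀ᶠ t : ℕ in atTop, (t : ℝ) ^ (-(1 - a)) ≤ l / 8 * η₀ :=
    ((tendsto_rpow_neg_atTop (by linarith : 0 < 1 - a)).comp
      tendsto_natCast_atTop_atTop).eventually_le_const (by positivity)
  filter_upwards [h1, h2, h3, h4, eventually_ge_atTop 1] with t h1 h2 h3 h4 ht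
  have hpos := stepSize_pos hη₀ a t
  have hpos' := stepSize_pos hη₀ a (t + 1)
  have ht0 : (1 : ℝ) ≤ t := by exact_mod_cast ht
  have htpos : (0 : ℝ) < t := by linarith
  have hval : stepSize η₀ a t = η₀ * (t : ℝ) ^ (-a) := by
    simp [stepSize, Nat.one_le_iff_ne_zero.1 ht]
  have hratio : stepSize η₀ a t / stepSize η₀ a (t + 1) ≤ 1 + (t : ℝ)⁻¹ := by
    rw [hval, stepSize_succ, mul_div_mul_left _ _ hη₀.ne', Real.rpow_neg htpos.le,
      Real.rpow_neg (by positivity), inv_div_inv, ← Real.div_rpow (by positivity) htpos.le]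
    calc (((t : ℝ) + 1) / t) ^ a ≤ (((t : ℝ) + 1) / t) ^ (1 : ℝ) :=
          Real.rpow_le_rpow_of_exponent_le (by rw [le_div_iff₀ htpos]; linarith) ha1.le
      _ = 1 + (t : ℝ)⁻¹ := by rw [Real.rpow_one]; field_simp
  have hinv : (t : ℝ)⁻¹ ≤ 1 := inv_le_one_of_one_le₀ ht0
  -- Here `a < 1` enters: the relative change 1/t of the step is negligible against the step itself.
  -- The ratio and the quadratic term each consume at most `l / 4` of the rate, leaving `l / 2`.
  have hinv2 : (t : ℝ)⁻¹ ≤ l / 8 * stepSize η₀ a t := by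
    have e : (t : ℝ)⁻¹ = (t : ℝ) ^ (-(1 - a)) * (t : ℝ) ^ (-a) := by
      rw [← Real.rpow_add htpos, ← Real.rpow_neg_one]; congr 1; ring
    rw [e, hval, ← mul_assoc]
    gcongr
  refine ⟨h1, h2, by linarith, ?_⟩
  set η := stepSize η₀ a t
  have h5 : C * η ^ 2 ≤ l / 4 * η := by
    have := mul_le_mul_of_nonneg_right (h3.trans (min_le_right _ _)) hpos.le
    linarith
  have h6 : C * η ^ 2 ≤ 1 := by
    have := mul_le_mul (h3.trans (min_le_left _ _)) h1 hpos.le zero_le_one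
    linarith
  have h7 : 0 ≤ C * η ^ 2 := by positivity
  calc η / stepSize η₀ a (t + 1) * (1 + C * η ^ 2 - l * η)
      ≤ (1 + (t : ℝ)⁻¹) * (1 + C * η ^ 2 - l * η) :=
        mul_le_mul_of_nonneg_right hratio (by linarith)
    _ ≤ 1 - l / 2 * η := by
        have h8 : (t : ℝ)⁻¹ * (1 + C * η ^ 2 - l * η) ≤ l / 8 * η * 2 :=
          mul_le_mul hinv2 (by nlinarith) (by linarith) (by positivity)
        linarith

end StepSize

/-! ### Localized moment bounds for the rescaled Lyapunov value -/

section Localized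

variable {E : Type*} [NormedAddCommGroup E]
  {Ω : Type*} {mΩ : MeasurableSpace Ω} {P : Measure Ω} {ℱ : Filtration ℕ mΩ}
  {γ : E → E} {V : E → ℝ} {dV : E → E} {μ L Lγ : ℝ} {η : ℕ → ℝ} {Δ e : ℕ → Ω → E}

/-- The event that `Δ` stays in the ball of radius `δ` during `[n, t]`; empty for `t < n`. -/
def localSet (Δ : ℕ → Ω → E) (δ : ℝ) (n t : ℕ) : Set Ω :=
  {ω | n ≤ t ∧ ∀ s, n ≤ s → s ≤ t → ‖Δ s ω‖ ≤ δ}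

lemma measurableSet_localSet (h : ∀ t, StronglyMeasurable[ℱ t] (Δ t)) (δ : ℝ) (n t : ℕ) :
    MeasurableSet[ℱ t] (localSet Δ δ n t) := by
  have : localSet Δ δ n t = {ω | n ≤ t} ∩ ⋂ s ∈ Finset.Icc n t, {ω | ‖Δ s ω‖ ≤ δ} := by
    ext ω
    simp [localSet]
  rw [this]
  refine MeasurableSet.inter (MeasurableSet.const _) (Finset.measurableSet_biInter _ fun s hs => ?_)
  exact ((h s).mono (ℱ.mono (Finset.mem_Icc.1 hs).2)).norm.measurableSet_le stronglyMeasurable_const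

lemma localSet_succ_subset {Δ : ℕ → Ω → E} {δ : ℝ} {n t : ℕ} (hnt : n ≤ t) :
    localSet Δ δ n (t + 1) ⊆ localSet Δ δ n t :=
  fun _ hω => ⟨hnt, fun s h1 h2 => hω.2 s h1 (h2.trans (Nat.le_succ t))⟩

lemma norm_le_of_mem_localSet {Δ : ℕ → Ω → E} {δ : ℝ} {n t : ℕ} {ω : Ω}
    (hω : ω ∈ localSet Δ δ n t) : ‖Δ t ω‖ ≤ δ := hω.2 t hω.1 le_rfl

/-- On the localized event the iterate lies in a compact ball, where continuous functions are
bounded. This settles the integrability of localized functions of the current iterate. -/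
lemma memLp_comp_restrict_localSet [ProperSpace E] [IsFiniteMeasure P]
    {F : Type*} [NormedAddCommGroup F]
    (h : ∀ t, StronglyMeasurable[ℱ t] (Δ t)) {f : E → F} (hf : Continuous f) (δ : ℝ) (n t : ℕ)
    (p : ℝ≥0∞) : MemLp (fun ω => f (Δ t ω)) p (P.restrict (localSet Δ δ n t)) := by
  obtain ⟨C, hC⟩ := (isCompact_closedBall (0 : E) δ).exists_bound_of_continuousOn hf.continuousOn
  refine MemLp.of_bound (hf.comp_stronglyMeasurable
    ((h t).mono (ℱ.le t))).aestronglyMeasurable C ?_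
  refine (ae_restrict_iff' (ℱ.le t _ (measurableSet_localSet h δ n t))).2 (ae_of_all _ fun ω hω => ?_)
  exact hC _ (by simpa using norm_le_of_mem_localSet hω)

variable [InnerProductSpace ℝ E]

/-- A function of the rescaled Lyapunov value that contracts up to martingale terms and integrable
perturbations has bounded localized expectation. -/
lemma IsNoisyDescent.exists_setIntegral_le [ProperSpace E] [IsFiniteMeasure P]
    (h : IsNoisyDescent P ℱ η γ Δ e) (hV : IsLyapunov γ V dV μ L Lγ) {δ : ℝ} {n : ℕ}
    {Φ : ℝ → ℝ} (hΦ : Continuous Φ) (hΦ0 : ∀ w, 0 ≤ w → 0 ≤ Φ w)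
    {ψ : ℕ → ℝ → ℝ} (hψ : ∀ t, Continuous (ψ t)) {S : ℕ → Ω → ℝ} (hS : ∀ t, Integrable (S t) P)
    (hS0 : ∀ t ω, 0 ≤ S t ω) {B c C : ℝ} (hSB : ∀ t, ∫ ω, S t ω ∂P ≤ B) (hc : 0 < c) (hC : 0 ≤ C)
    (hcη : ∀ t, n ≤ t → c * η t ≤ 1)
    (hstep : ∀ t, n ≤ t → ∀ᵐ ω ∂P, ‖Δ t ω‖ ≤ δ → Φ (V (Δ (t + 1) ω) / η (t + 1)) ≤
      (1 - c * η t) * Φ (V (Δ t ω) / η t)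
        + ψ t (V (Δ t ω) / η t) * inner ℝ (dV (Δ t ω)) (e t ω) + C * η t * S t ω) :
    ∃ M : ℝ, ∀ t, ∫ ω in localSet Δ δ n t, Φ (V (Δ t ω) / η t) ∂P ≤ M := by
  set A := localSet Δ δ n with hA
  set w : ℕ → ℝ := fun t => ∫ ω in A t, Φ (V (Δ t ω) / η t) ∂P with hw
  have hAm : ∀ t, MeasurableSet (A t) := fun t =>
    ℱ.le t _ (measurableSet_localSet h.stronglyMeasurable δ n t)
  have hW0 : ∀ t ω, 0 ≤ V (Δ t ω) / η t := fun t ω =>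
    div_nonneg (hV.nonneg _) (h.step_pos t).le
  have hint : ∀ t, IntegrableOn (fun ω => Φ (V (Δ t ω) / η t)) (A t) P := fun t =>
    memLp_one_iff_integrable.1 (memLp_comp_restrict_localSet (P := P) h.stronglyMeasurable
      (f := fun y => Φ (V y / η t)) (hΦ.comp (hV.continuous.div_const _)) δ n t 1)
  have hrec : ∀ t, n ≤ t → w (t + 1) ≤ (1 - c * η t) * w t + c * η t * (C * B / c) := by
    intro t ht
    have hφ : MemLp (fun ω => ψ t (V (Δ t ω) / η t) • dV (Δ t ω)) 2 (P.restrict (A t)) :=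
      memLp_comp_restrict_localSet (P := P) h.stronglyMeasurable
        (f := fun y => ψ t (V y / η t) • dV y)
        (((hψ t).comp (hV.continuous.div_const _)).smul hV.continuous_grad) δ n t 2
    have hφm : StronglyMeasurable[ℱ t] (fun ω => ψ t (V (Δ t ω) / η t) • dV (Δ t ω)) :=
      Continuous.comp_stronglyMeasurable (g := fun y => ψ t (V y / η t) • dV y)
        (((hψ t).comp (hV.continuous.div_const _)).smul hV.continuous_grad) (h.stronglyMeasurable t)
    have hzero := h.noise.setIntegral_inner t hφm
      (measurableSet_localSet h.stronglyMeasurable δ n t) hφ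
    have hXint := integrable_inner_of_memLp_two hφ ((h.noise.memLp t).restrict (A t))
    simp only [real_inner_smul_left] at hzero hXint
    have hi1 : IntegrableOn (fun ω => (1 - c * η t) * Φ (V (Δ t ω) / η t)
        + ψ t (V (Δ t ω) / η t) * inner ℝ (dV (Δ t ω)) (e t ω)) (A t) P :=
      ((hint t).const_mul _).add hXint
    have hi2 : IntegrableOn (fun ω => C * η t * S t ω) (A t) P :=
      ((hS t).const_mul _).integrableOn
    have hR : IntegrableOn (fun ω => (1 - c * η t) * Φ (V (Δ t ω) / η t)
        + ψ t (V (Δ t ω) / η t) * inner ℝ (dV (Δ t ω)) (e t ω) + C * η t * S t ω) (A t) P :=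
      hi1.add hi2
    have hsub : A (t + 1) ⊆ A t := localSet_succ_subset ht
    have hle : ∀ᵐ ω ∂P.restrict (A t), Φ (V (Δ (t + 1) ω) / η (t + 1)) ≤
        (1 - c * η t) * Φ (V (Δ t ω) / η t)
        + ψ t (V (Δ t ω) / η t) * inner ℝ (dV (Δ t ω)) (e t ω) + C * η t * S t ω := by
      refine (ae_restrict_iff' (hAm t)).2 ?_
      filter_upwards [hstep t ht] with ω h1 h2
      exact h1 (norm_le_of_mem_localSet h2)
    calc w (t + 1) ≤ ∫ ω in A (t + 1), ((1 - c * η t) * Φ (V (Δ t ω) / η t)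
        + ψ t (V (Δ t ω) / η t) * inner ℝ (dV (Δ t ω)) (e t ω) + C * η t * S t ω) ∂P :=
          integral_mono_ae (hint (t + 1)) (hR.mono_set hsub) (ae_restrict_of_ae_restrict_of_subset hsub hle)
      _ ≤ ∫ ω in A t, ((1 - c * η t) * Φ (V (Δ t ω) / η t)
        + ψ t (V (Δ t ω) / η t) * inner ℝ (dV (Δ t ω)) (e t ω) + C * η t * S t ω) ∂P := by
          -- The domain grows from `A (t + 1)` to `A t`, which is known at time `t`, so that the
          -- martingale term integrates to zero. This is legitimate because on `A t` the integrand
          -- dominates `Φ` of the next value, which is nonnegative.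
          refine setIntegral_mono_set hR ?_ (Eventually.of_forall hsub)
          filter_upwards [hle] with ω hω using (hΦ0 _ (hW0 _ _)).trans hω
      _ = (1 - c * η t) * w t + C * η t * ∫ ω in A t, S t ω ∂P := by
          rw [integral_add hi1 hi2, integral_add ((hint t).const_mul _) hXint, hzero,
            integral_const_mul, integral_const_mul, add_zero]
      _ ≤ (1 - c * η t) * w t + c * η t * (C * B / c) := by
          have h1 : ∫ ω in A t, S t ω ∂P ≤ B :=
            (setIntegral_le_integral (hS t) (ae_of_all _ (hS0 t))).trans (hSB t)
          have h2 := mul_le_mul_of_nonneg_left h1 (mul_nonneg hC (h.step_pos t).le)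
          have h3 : c * η t * (C * B / c) = C * η t * B := by field_simp
          linarith
  refine ⟨max 0 (max (w n) (C * B / c)), fun t => ?_⟩
  rcases lt_or_ge t n with ht | ht
  · have : localSet Δ δ n t = ∅ := by
      ext ω; simp [localSet, ht]
    simp [hA, this]
  · refine le_trans ?_ (le_max_right _ _)
    exact le_max_of_contraction (τ := fun t => c * η t)
      (fun s hs => ⟨mul_nonneg hc.le (h.step_pos s).le, hcη s hs⟩) hrec t ht

/-- The recursion for the rescaled Lyapunov value `V(Δ_t) / η_t` near the origin. -/
lemma IsLyapunov.rescaled_step_le (hV : IsLyapunov γ V dV μ L Lγ) {l η η' : ℝ} {y e : E}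
    (hη : 0 < η) (hη' : 0 < η') (hratio : η / η' ≤ 2)
    (hcontr : η / η' * (1 + 2 * L * Lγ ^ 2 / μ * η ^ 2 - l * η) ≤ 1 - l / 2 * η)
    (hdrift : l * V y ≤ inner ℝ (dV y) (γ y)) :
    V (y - η • (γ y - e)) / η' ≤ (1 - l / 2 * η) * (V y / η) + η / η' * inner ℝ (dV y) e
        + (4 * L + 4 * L ^ 2 / μ) * η * ‖e‖ ^ 2 ∧
    (η / η' * inner ℝ (dV y) e) ^ 2 ≤ (4 * L + 4 * L ^ 2 / μ) * (η * (V y / η) * ‖e‖ ^ 2) := by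
  have hL := hV.pos_upper
  have hμ := hV.pos_lower
  have hVy := hV.nonneg y
  have hr0 : 0 < η / η' := div_pos hη hη'
  constructor
  · have h1 := hV.step_le η y e
    have h2 : V (y - η • (γ y - e)) ≤ (1 + 2 * L * Lγ ^ 2 / μ * η ^ 2 - l * η) * V y
        + η * inner ℝ (dV y) e + 2 * L * η ^ 2 * ‖e‖ ^ 2 := by
      have := mul_le_mul_of_nonneg_left hdrift hη.le
      linarith
    have h3 := div_le_div_of_nonneg_right h2 hη'.le
    have h4 : ((1 + 2 * L * Lγ ^ 2 / μ * η ^ 2 - l * η) * V y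
        + η * inner ℝ (dV y) e + 2 * L * η ^ 2 * ‖e‖ ^ 2) / η'
        = η / η' * (1 + 2 * L * Lγ ^ 2 / μ * η ^ 2 - l * η) * (V y / η)
          + η / η' * inner ℝ (dV y) e + η / η' * (2 * L * η * ‖e‖ ^ 2) := by
      field_simp
    have h5 : η / η' * (2 * L * η * ‖e‖ ^ 2) ≤ 2 * (2 * L * η * ‖e‖ ^ 2) := by gcongr
    have h6 := mul_le_mul_of_nonneg_right hcontr (div_nonneg hVy hη.le)
    have h7 : 0 ≤ 4 * L ^ 2 / μ * η * ‖e‖ ^ 2 := by positivity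
    rw [h4] at h3
    linarith
  -- The martingale increment is controlled by the square root of `V y`, through the gradient bound
  -- and the quadratic lower bound. Its square is thus linear in the rescaled value, as the power
  -- and exponential estimates require.
  · have h1 : |inner ℝ (dV y) e| ≤ L * ‖y‖ * ‖e‖ :=
      (abs_real_inner_le_norm _ _).trans (mul_le_mul_of_nonneg_right (hV.grad_le y) (norm_nonneg _))
    have h2 : (inner ℝ (dV y) e) ^ 2 ≤ L ^ 2 * (V y / μ) * ‖e‖ ^ 2 := by
      calc (inner ℝ (dV y) e) ^ 2 = |inner ℝ (dV y) e| ^ 2 := (sq_abs _).symm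
        _ ≤ (L * ‖y‖ * ‖e‖) ^ 2 := pow_le_pow_left₀ (abs_nonneg _) h1 2
        _ = L ^ 2 * ‖y‖ ^ 2 * ‖e‖ ^ 2 := by ring
        _ ≤ _ := by gcongr; exact hV.norm_sq_le y
    have h3 : (η / η') ^ 2 ≤ 4 := by nlinarith
    have h4 : η * (V y / η) = V y := by field_simp
    rw [h4, mul_pow]
    calc (η / η') ^ 2 * inner ℝ (dV y) e ^ 2 ≤ 4 * (L ^ 2 * (V y / μ) * ‖e‖ ^ 2) := by
          gcongr
      _ = 4 * L ^ 2 / μ * (V y * ‖e‖ ^ 2) := by ring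
      _ ≤ _ := by
          have : 0 ≤ 4 * L * (V y * ‖e‖ ^ 2) := by positivity
          linarith

/-- Nonnegative functions with bounded localized integrals, damped by `(s + 1)⁻¹ (log s)⁻²`, have
bounded partial sums almost surely. -/
lemma ae_exists_sum_indicator_le {f : ℕ → Ω → ℝ} {A : ℕ → Set Ω} (hA : ∀ t, MeasurableSet (A t))
    (hf0 : ∀ t ω, 0 ≤ f t ω) (hf : ∀ t, IntegrableOn (f t) (A t) P) {M : ℝ}
    (hM : ∀ t, ∫ ω in A t, f t ω ∂P ≤ M) :
    ∀ᵐ ω ∂P, ∃ C, ∀ t, ∑ s ∈ Finset.range t,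
      (((s : ℝ) + 1) * logWeight s ^ 2)⁻¹ * (A s).indicator (f s) ω ≤ C := by
  have hw : ∀ s : ℕ, 0 ≤ (((s : ℝ) + 1) * logWeight s ^ 2)⁻¹ := fun s => by
    have := logWeight_pos s; positivity
  have hM0 : 0 ≤ M := (integral_nonneg (hf0 0)).trans (hM 0)
  have h := ae_summable_of_sum_integral_le (P := P)
    (f := fun s ω => (((s : ℝ) + 1) * logWeight s ^ 2)⁻¹ * (A s).indicator (f s) ω)
    (fun s ω => mul_nonneg (hw s) (Set.indicator_nonneg (fun ω _ => hf0 s ω) ω))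
    (fun s => ((hf s).integrable_indicator (hA s)).const_mul _) (B := 2 * M) (fun t => by
      calc _ ≤ ∑ s ∈ Finset.range t, (((s : ℝ) + 1) * logWeight s ^ 2)⁻¹ * M := by
            refine Finset.sum_le_sum fun s _ => ?_
            rw [integral_const_mul, integral_indicator (hA s)]
            exact mul_le_mul_of_nonneg_left (hM s) (hw s)
        _ ≤ 2 * M := by
            rw [← Finset.sum_mul]
            exact mul_le_mul_of_nonneg_right (sum_inv_mul_logWeight_sq_le_two t) hM0)
  filter_upwards [h] with ω hω
  exact ⟨_, fun t => hω.sum_le_tsum _ fun s _ =>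
    mul_nonneg (hw s) (Set.indicator_nonneg (fun ω _ => hf0 s ω) ω)⟩

/-- A single term of a bounded series of nonnegative terms is bounded; no maximal inequality is
needed. Taking `C ≥ 1` makes its logarithm nonnegative in the exponential case. -/
lemma ae_exists_le_of_setIntegral_le {f : ℕ → Ω → ℝ} {A : ℕ → Set Ω}
    (hA : ∀ t, MeasurableSet (A t))
    (hf0 : ∀ t ω, 0 ≤ f t ω) (hf : ∀ t, IntegrableOn (f t) (A t) P) {M : ℝ}
    (hM : ∀ t, ∫ ω in A t, f t ω ∂P ≤ M) :
    ∀ᵐ ω ∂P, ∃ C, 1 ≤ C ∧ ∀ t, ω ∈ A t → f t ω ≤ C * (((t : ℝ) + 1) * logWeight t ^ 2) := by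
  filter_upwards [ae_exists_sum_indicator_le hA hf0 hf hM] with ω ⟨C, hC⟩
  refine ⟨max 1 C, le_max_left _ _, fun t ht => ?_⟩
  have hw : ∀ s : ℕ, 0 < ((s : ℝ) + 1) * logWeight s ^ 2 := fun s => by
    have := logWeight_pos s; positivity
  have h1 := hC (t + 1)
  rw [Finset.sum_range_succ, Set.indicator_of_mem ht] at h1
  have h2 : 0 ≤ ∑ s ∈ Finset.range t,
      (((s : ℝ) + 1) * logWeight s ^ 2)⁻¹ * (A s).indicator (f s) ω :=
    Finset.sum_nonneg fun s _ =>
      mul_nonneg (inv_nonneg.2 (hw s).le) (Set.indicator_nonneg (fun ω _ => hf0 s ω) ω)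
  have h3 : (((t : ℝ) + 1) * logWeight t ^ 2)⁻¹ * f t ω ≤ max 1 C :=
    (by linarith : _ ≤ C).trans (le_max_right _ _)
  rwa [← div_eq_inv_mul, div_le_iff₀ (hw t)] at h3

/-- Localized moment and almost sure rates of `V(Δ_t) / η_t` for noise with bounded `2p`-th
moments. -/
theorem IsNoisyDescent.localized_rate_of_moment [ProperSpace E] [IsProbabilityMeasure P]
    (h : IsNoisyDescent P ℱ η γ Δ e) (hV : IsLyapunov γ V dV μ L Lγ) {δ l p B : ℝ} (hp : 2 ≤ p)
    (hl : 0 < l) {n : ℕ}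
    (hdrift : ∀ y, ‖y‖ ≤ δ → l * V y ≤ inner ℝ (dV y) (γ y))
    (hη : ∀ t, n ≤ t → η t ≤ 1 ∧ l * η t ≤ 1 ∧ η t / η (t + 1) ≤ 2 ∧
      η t / η (t + 1) * (1 + 2 * L * Lγ ^ 2 / μ * η t ^ 2 - l * η t) ≤ 1 - l / 2 * η t)
    (hei : ∀ t, Integrable (fun ω => (‖e t ω‖ ^ 2) ^ p) P)
    (heB : ∀ t, ∫ ω, (‖e t ω‖ ^ 2) ^ p ∂P ≤ B) :
    (∃ M, ∀ t, ∫ ω in localSet Δ δ n t, V (Δ t ω) / η t ∂P ≤ M) ∧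
    ∀ᵐ ω ∂P, ∃ C, ∀ t, ω ∈ localSet Δ δ n t →
      V (Δ t ω) / η t ≤ C * (((t : ℝ) + 1) ^ p⁻¹ * logWeight t) := by
  have hL := hV.pos_upper
  have hμ := hV.pos_lower
  have hW0 : ∀ t ω, 0 ≤ V (Δ t ω) / η t := fun t ω =>
    div_nonneg (hV.nonneg _) (h.step_pos t).le
  have hA : ∀ t, MeasurableSet (localSet Δ δ n t) := fun t =>
    ℱ.le t _ (measurableSet_localSet h.stronglyMeasurable δ n t)
  obtain ⟨C, hC0, hC⟩ := exists_rpow_contraction_step (p := p) (c := l / 2)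
    (K := 4 * L + 4 * L ^ 2 / μ) hp (by positivity) (by positivity)
  have hcont : Continuous fun w : ℝ => w ^ p := Real.continuous_rpow_const (by linarith)
  obtain ⟨M, hM⟩ := h.exists_setIntegral_le hV (δ := δ) (n := n) (Φ := fun w => w ^ p) hcont
    (fun w hw => Real.rpow_nonneg hw _)
    -- The coefficient of `inner ℝ (dV (Δ t ω)) (e t ω)` in the power step: the derivative of the
    -- p-th power at the contracted value, times the step ratio contained in `X`.
    (ψ := fun t w => p * ((1 - l / 2 * η t) * w) ^ (p - 1) * (η t / η (t + 1)))
    (fun t => by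
      have : Continuous fun w : ℝ => w ^ (p - 1) := Real.continuous_rpow_const (by linarith)
      fun_prop)
    hei (fun t ω => by positivity) heB (c := l / 2 / 2) (by positivity) hC0
    (fun t ht => by
      have := (hη t ht).2.1
      have h2 := mul_pos hl (h.step_pos t)
      linarith)
    (fun t ht => ae_of_all _ fun ω hω => by
      obtain ⟨h1, h2, h3, h4⟩ := hη t ht
      obtain ⟨h5, h6⟩ := hV.rescaled_step_le (e := e t ω) (h.step_pos t) (h.step_pos (t + 1)) h3 h4
        (hdrift _ hω)
      rw [← h.recursion] at h5
      have hlη := mul_pos hl (h.step_pos t)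
      have := hC (η t) (V (Δ t ω) / η t) (‖e t ω‖ ^ 2) _ _ (h.step_pos t) h1 (by linarith)
        (hW0 t ω) (by positivity) h6 (hW0 (t + 1) ω) h5
      refine this.trans (le_of_eq ?_)
      ring)
  have hint : ∀ t, IntegrableOn (fun ω => (V (Δ t ω) / η t) ^ p) (localSet Δ δ n t) P := fun t =>
    memLp_one_iff_integrable.1 (memLp_comp_restrict_localSet (P := P) h.stronglyMeasurable
      (f := fun y => (V y / η t) ^ p) (hcont.comp (hV.continuous.div_const _)) δ n t 1)
  have hint1 : ∀ t, IntegrableOn (fun ω => V (Δ t ω) / η t) (localSet Δ δ n t) P := fun t =>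
    memLp_one_iff_integrable.1 (memLp_comp_restrict_localSet (P := P) h.stronglyMeasurable
      (f := fun y => V y / η t) (hV.continuous.div_const _) δ n t 1)
  refine ⟨⟨1 + M, fun t => ?_⟩, ?_⟩
  · calc ∫ ω in localSet Δ δ n t, V (Δ t ω) / η t ∂P
        ≤ ∫ ω in localSet Δ δ n t, (1 + (V (Δ t ω) / η t) ^ p) ∂P := by
          refine integral_mono (hint1 t) ((integrable_const _).add (hint t)) fun ω => ?_
          rcases le_total (V (Δ t ω) / η t) 1 with h1 | h1
          · exact h1.trans (le_add_of_nonneg_right (Real.rpow_nonneg (hW0 t ω) _))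
          · have := Real.self_le_rpow_of_one_le h1 (show 1 ≤ p by linarith)
            simp only
            linarith
      _ = P.real (localSet Δ δ n t) + ∫ ω in localSet Δ δ n t, (V (Δ t ω) / η t) ^ p ∂P := by
          rw [integral_add (integrable_const _) (hint t)]
          simp
      _ ≤ 1 + M := add_le_add measureReal_le_one (hM t)
  · filter_upwards [ae_exists_le_of_setIntegral_le hA (fun t ω => Real.rpow_nonneg (hW0 t ω) p)
      hint hM] with ω ⟨C', hC'1, hC'⟩
    refine ⟨C' ^ p⁻¹, fun t ht => ?_⟩
    have h1 := Real.rpow_le_rpow (Real.rpow_nonneg (hW0 t ω) p) (hC' t ht)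
      (show 0 ≤ p⁻¹ by positivity)
    rw [Real.rpow_rpow_inv (hW0 t ω) (by linarith)] at h1
    have hℓ := one_le_logWeight t
    refine h1.trans ?_
    rw [Real.mul_rpow (by linarith) (by positivity), Real.mul_rpow (by positivity) (by positivity)]
    gcongr
    -- The p-th root turns the squared logarithm into the power `2 / p ≤ 1`.
    rw [← Real.rpow_natCast_mul (by linarith)]
    calc logWeight t ^ ((2 : ℕ) * p⁻¹ : ℝ) ≤ logWeight t ^ (1 : ℝ) := by
          refine Real.rpow_le_rpow_of_exponent_le hℓ ?_
          push_cast
          rw [← div_eq_mul_inv, div_le_one (by linarith)]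
          exact hp
      _ = logWeight t := Real.rpow_one _

/-- Localized moment and almost sure rates of `V(Δ_t) / η_t` for bounded noise. -/
theorem IsNoisyDescent.localized_rate_of_bounded [ProperSpace E] [IsProbabilityMeasure P]
    (h : IsNoisyDescent P ℱ η γ Δ e) (hV : IsLyapunov γ V dV μ L Lγ) {δ l B : ℝ}
    (hl : 0 < l) {n : ℕ}
    (hdrift : ∀ y, ‖y‖ ≤ δ → l * V y ≤ inner ℝ (dV y) (γ y))
    (hη : ∀ t, n ≤ t → η t ≤ 1 ∧ l * η t ≤ 1 ∧ η t / η (t + 1) ≤ 2 ∧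
      η t / η (t + 1) * (1 + 2 * L * Lγ ^ 2 / μ * η t ^ 2 - l * η t) ≤ 1 - l / 2 * η t)
    (heB : ∀ t, ∀ᵐ ω ∂P, ‖e t ω‖ ≤ B) :
    (∃ M, ∀ t, ∫ ω in localSet Δ δ n t, V (Δ t ω) / η t ∂P ≤ M) ∧
    ∀ᵐ ω ∂P, ∃ C, ∀ t, ω ∈ localSet Δ δ n t → V (Δ t ω) / η t ≤ C * logWeight t := by
  have hL := hV.pos_upper
  have hμ := hV.pos_lower
  have hW0 : ∀ t ω, 0 ≤ V (Δ t ω) / η t := fun t ω =>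
    div_nonneg (hV.nonneg _) (h.step_pos t).le
  have hA : ∀ t, MeasurableSet (localSet Δ δ n t) := fun t =>
    ℱ.le t _ (measurableSet_localSet h.stronglyMeasurable δ n t)
  set K : ℝ := (4 * L + 4 * L ^ 2 / μ) * (B ^ 2 + 1) with hK
  have hK0 : 0 < K := by positivity
  -- The largest `θ` allowed by the exponential step with contraction rate `c = l / 2`, namely `θ *
  -- K = c / 2`.
  set θ : ℝ := l / 2 / 2 / K with hθ
  have hθ0 : 0 < θ := by positivity
  have hcont : Continuous fun w : ℝ => Real.exp (θ * w) := by fun_prop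
  obtain ⟨M, hM⟩ := h.exists_setIntegral_le hV (δ := δ) (n := n) (Φ := fun w => Real.exp (θ * w))
    hcont (fun w hw => (Real.exp_pos _).le)
    (ψ := fun t w => θ * Real.exp (θ * ((1 - l / 2 * η t) * w + K * η t)) * (η t / η (t + 1)))
    (fun t => by fun_prop) (S := fun _ _ => Real.exp (θ * K / (l / 2 / 2)))
    (fun t => integrable_const _) (fun t ω => (Real.exp_pos _).le)
    (B := Real.exp (θ * K / (l / 2 / 2)))
    (fun t => by simp) (c := l / 2 / 2) (C := l / 2 / 2) (by positivity) (by positivity)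
    (fun t ht => by
      have := (hη t ht).2.1
      have h2 := mul_pos hl (h.step_pos t)
      linarith)
    (fun t ht => by
      filter_upwards [heB t] with ω hB hω
      obtain ⟨h1, h2, h3, h4⟩ := hη t ht
      obtain ⟨h5, h6⟩ := hV.rescaled_step_le (e := e t ω) (h.step_pos t) (h.step_pos (t + 1)) h3 h4
        (hdrift _ hω)
      rw [← h.recursion] at h5
      have hlη := mul_pos hl (h.step_pos t)
      have he2 : ‖e t ω‖ ^ 2 ≤ B ^ 2 + 1 := by
        have := pow_le_pow_left₀ (norm_nonneg _) hB 2
        linarith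
      have hηp := h.step_pos t
      have := exp_contraction_step (c := l / 2) (K := K) (θ := θ) (η := η t)
        (x := V (Δ t ω) / η t) (X := η t / η (t + 1) * inner ℝ (dV (Δ t ω)) (e t ω))
        (w := V (Δ (t + 1) ω) / η (t + 1)) (by positivity) hθ0 hηp (by linarith)
        (hW0 t ω) (le_of_eq (by rw [hθ]; field_simp))
        (h6.trans (by
          rw [hK, mul_assoc _ (B ^ 2 + 1), mul_comm (B ^ 2 + 1)]
          have := hW0 t ω
          gcongr))
        (h5.trans (by
          rw [hK, mul_assoc _ (B ^ 2 + 1), mul_comm (B ^ 2 + 1), ← mul_assoc]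
          gcongr))
      refine this.trans (le_of_eq ?_)
      ring)
  have hint : ∀ t, IntegrableOn (fun ω => Real.exp (θ * (V (Δ t ω) / η t)))
      (localSet Δ δ n t) P := fun t =>
    memLp_one_iff_integrable.1 (memLp_comp_restrict_localSet (P := P) h.stronglyMeasurable
      (f := fun y => Real.exp (θ * (V y / η t))) (hcont.comp (hV.continuous.div_const _)) δ n t 1)
  have hint1 : ∀ t, IntegrableOn (fun ω => V (Δ t ω) / η t) (localSet Δ δ n t) P := fun t =>
    memLp_one_iff_integrable.1 (memLp_comp_restrict_localSet (P := P) h.stronglyMeasurable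
      (f := fun y => V y / η t) (hV.continuous.div_const _) δ n t 1)
  refine ⟨⟨θ⁻¹ * M, fun t => ?_⟩, ?_⟩
  · calc ∫ ω in localSet Δ δ n t, V (Δ t ω) / η t ∂P
        ≤ ∫ ω in localSet Δ δ n t, θ⁻¹ * Real.exp (θ * (V (Δ t ω) / η t)) ∂P := by
          refine integral_mono (hint1 t) ((hint t).const_mul _) fun ω => ?_
          simp only
          rw [← div_eq_inv_mul, le_div_iff₀ hθ0, mul_comm]
          linarith [Real.add_one_le_exp (θ * (V (Δ t ω) / η t))]
      _ ≤ θ⁻¹ * M := by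
          rw [integral_const_mul]
          exact mul_le_mul_of_nonneg_left (hM t) (by positivity)
  · filter_upwards [ae_exists_le_of_setIntegral_le hA (fun t ω => (Real.exp_pos _).le)
      hint hM] with ω ⟨C, hC1, hC⟩
    -- Taking logarithms gives log C + log(t+1) + 2 log(`logWeight t`); the last two summands are at
    -- most three times `logWeight t`.
    refine ⟨(Real.log C + 3) / θ, fun t ht => ?_⟩
    have hℓ := one_le_logWeight t
    have ht1 : (1 : ℝ) ≤ (t : ℝ) + 1 := by linarith [Nat.cast_nonneg (α := ℝ) t]
    have hlog : 0 ≤ Real.log C := Real.log_nonneg hC1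
    have h1 := (Real.le_log_iff_exp_le (by positivity)).2 (hC t ht)
    rw [Real.log_mul (by linarith) (by positivity), Real.log_mul (by linarith) (by positivity),
      Real.log_pow] at h1
    have h2 : Real.log ((t : ℝ) + 1) ≤ logWeight t := by unfold logWeight; linarith
    have h3 : Real.log (logWeight t) ≤ logWeight t := by
      linarith [Real.log_le_sub_one_of_pos (logWeight_pos t)]
    rw [div_mul_eq_mul_div, le_div_iff₀ hθ0]
    push_cast at h1
    nlinarith [mul_le_mul_of_nonneg_left hℓ hlog]

end Localized

/-! ### Pathwise expansion of the sum of the iterates -/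

section Pathwise

variable {E : Type*} [NormedAddCommGroup E]

lemma inv_stepSize_le {η₀ a : ℝ} (hη₀ : 0 < η₀) (ha : 0 < a) (t : ℕ) :
    (stepSize η₀ a t)⁻¹ ≤ η₀⁻¹ * ((t : ℝ) + 1) ^ a := by
  have h := inv_anti₀ (by positivity) (le_stepSize hη₀ ha t)
  rwa [mul_inv, Real.rpow_neg (by positivity), inv_inv] at h

/-- The increment of the concave power `x ^ a`, obtained from `x / (x + 1) ≤ (x / (x + 1)) ^ a`. At
`s = 0` the difference vanishes, because the steps at times 0 and 1 both equal `η₀`. -/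
lemma abs_inv_stepSize_sub_le {η₀ a : ℝ} (hη₀ : 0 < η₀) (ha : 0 < a) (ha1 : a ≤ 1) (s : ℕ) :
    |(stepSize η₀ a (s + 1))⁻¹ - (stepSize η₀ a s)⁻¹| ≤ η₀⁻¹ * ((s : ℝ) + 1) ^ (a - 1) := by
  cases s with
  | zero => simp [stepSize]; exact hη₀.le
  | succ s =>
    rw [stepSize_succ, stepSize_succ, mul_inv, mul_inv, ← mul_sub, abs_mul,
      abs_of_pos (inv_pos.2 hη₀)]
    gcongr η₀⁻¹ * ?_
    have h1 : (0 : ℝ) < (s : ℝ) + 1 := by positivity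
    push_cast
    set x : ℝ := (s : ℝ) + 1 with hx
    rw [Real.rpow_neg (by positivity), Real.rpow_neg (by positivity), inv_inv, inv_inv]
    have h2 : x ^ a ≤ (x + 1) ^ a := Real.rpow_le_rpow h1.le (by linarith) ha.le
    rw [abs_of_nonneg (by linarith), Real.rpow_sub_one (by positivity)]
    have h3 : x / (x + 1) ≤ (x / (x + 1)) ^ a := by
      calc x / (x + 1) = (x / (x + 1)) ^ (1 : ℝ) := (Real.rpow_one _).symm
        _ ≤ _ := Real.rpow_le_rpow_of_exponent_ge (by positivity)
          (by rw [div_le_one (by positivity)]; linarith) ha1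
    rw [Real.div_rpow h1.le (by positivity), div_le_div_iff₀ (by positivity) (by positivity)] at h3
    rw [le_div_iff₀ (by positivity)]
    nlinarith

lemma rpow_le_one_add {y θ : ℝ} (hy : 0 ≤ y) (hθ : 0 ≤ θ) (hθ1 : θ ≤ 1) : y ^ θ ≤ 1 + y := by
  rcases le_total y 1 with h | h
  · have := Real.rpow_le_one hy h hθ
    linarith
  · have := Real.rpow_le_rpow_of_exponent_le h hθ1
    rw [Real.rpow_one] at this
    linarith

/-- With $y=(s+1)^a\|\Delta_s\|^2$, the summand is $(s+1)^{-a(1+\lambda)/2}y^{(1+\lambda)/2}$, and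
the last power is at most $1+y$ since $\lambda\le1$. Using the weighted sum of squares instead of
the pointwise rate avoids losing a power $t^{1/p}$ in the linearization error. -/
lemma sum_norm_rpow_le {a lam C : ℝ} (ha : 0 < a) (ha1 : a ≤ 1) (hlam : 0 ≤ lam) (hlam1 : lam ≤ 1)
    {Δ : ℕ → E} (hΔ : ∀ t, ∑ s ∈ Finset.range t,
      (((s : ℝ) + 1) * logWeight s ^ 2)⁻¹ * (((s : ℝ) + 1) ^ a * ‖Δ s‖ ^ 2) ≤ C) (t : ℕ) :
    ∑ s ∈ Finset.range t, ‖Δ s‖ ^ (1 + lam)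
      ≤ (1 + C) * (((t : ℝ) + 1) ^ (1 - a * (1 + lam) / 2) * logWeight t ^ 2) := by
  set θ := (1 + lam) / 2 with hθ
  set R : ℝ := ((t : ℝ) + 1) ^ (1 - a * (1 + lam) / 2) with hR
  have hexp : 0 ≤ 1 - a * (1 + lam) / 2 := by nlinarith
  have hℓ := one_le_logWeight t
  have hterm : ∀ s ∈ Finset.range t, ‖Δ s‖ ^ (1 + lam) ≤ R * ((s : ℝ) + 1)⁻¹
      + R * logWeight t ^ 2 * ((((s : ℝ) + 1) * logWeight s ^ 2)⁻¹
        * (((s : ℝ) + 1) ^ a * ‖Δ s‖ ^ 2)) := by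
    intro s hs
    have hst : s ≤ t := (Finset.mem_range.1 hs).le
    have hst' : (s : ℝ) ≤ t := by exact_mod_cast hst
    have hs0 : (0 : ℝ) < (s : ℝ) + 1 := by positivity
    have hℓs := logWeight_pos s
    set y : ℝ := ((s : ℝ) + 1) ^ a * ‖Δ s‖ ^ 2 with hy
    have hy0 : 0 ≤ y := by positivity
    have h1 : y ^ θ = ((s : ℝ) + 1) ^ (a * (1 + lam) / 2) * ‖Δ s‖ ^ (1 + lam) := by
      rw [hy, Real.mul_rpow (by positivity) (by positivity), ← Real.rpow_mul hs0.le,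
        ← Real.rpow_natCast_mul (norm_nonneg _)]
      congr 2
      · rw [hθ]; ring
      · rw [hθ]; push_cast; ring
    have h2 := rpow_le_one_add hy0 (θ := θ) (by positivity) (by rw [hθ]; linarith)
    have h3 : ‖Δ s‖ ^ (1 + lam) = ((s : ℝ) + 1) ^ (1 - a * (1 + lam) / 2)
        * ((s : ℝ) + 1)⁻¹ * y ^ θ := by
      rw [h1, Real.rpow_sub hs0, Real.rpow_one]
      field_simp
    have h4 : ((s : ℝ) + 1) ^ (1 - a * (1 + lam) / 2) ≤ R := by
      rw [hR]; gcongr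
    have h5 : ((s : ℝ) + 1)⁻¹ * y ≤ logWeight t ^ 2 * ((((s : ℝ) + 1) * logWeight s ^ 2)⁻¹ * y) := by
      have h6 : 1 ≤ logWeight t ^ 2 * (logWeight s ^ 2)⁻¹ := by
        rw [← div_eq_mul_inv, le_div_iff₀ (by positivity), one_mul]
        exact pow_le_pow_left₀ hℓs.le (logWeight_mono hst) 2
      have h7 : 0 ≤ ((s : ℝ) + 1)⁻¹ * y := by positivity
      calc ((s : ℝ) + 1)⁻¹ * y ≤ (logWeight t ^ 2 * (logWeight s ^ 2)⁻¹) * (((s : ℝ) + 1)⁻¹ * y) :=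
            le_mul_of_one_le_left h7 h6
        _ = _ := by rw [mul_inv]; ring
    calc ‖Δ s‖ ^ (1 + lam) ≤ R * ((s : ℝ) + 1)⁻¹ * (1 + y) := by
          rw [h3]; gcongr
      _ = R * ((s : ℝ) + 1)⁻¹ + R * (((s : ℝ) + 1)⁻¹ * y) := by ring
      _ ≤ R * ((s : ℝ) + 1)⁻¹
          + R * (logWeight t ^ 2 * ((((s : ℝ) + 1) * logWeight s ^ 2)⁻¹ * y)) := by gcongr
      _ = _ := by ring
  refine (Finset.sum_le_sum hterm).trans ?_
  rw [Finset.sum_add_distrib, ← Finset.mul_sum, ← Finset.mul_sum]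
  have hR0 : 0 ≤ R := by positivity
  have h1 : R * ∑ s ∈ Finset.range t, ((s : ℝ) + 1)⁻¹ ≤ R * logWeight t ^ 2 :=
    mul_le_mul_of_nonneg_left ((sum_inv_le_logWeight t).trans (by nlinarith)) hR0
  have h2 := mul_le_mul_of_nonneg_left (hΔ t) (show 0 ≤ R * logWeight t ^ 2 by positivity)
  linarith

variable [NormedSpace ℝ E]

/-- Summation by parts. The last boundary term has size $t^a t^{(q-a)/2}=t^{(q+a)/2}$; in the
interior the increments $s^{a-1}$ of the inverse steps give $s^{(q+a)/2}s^{-1}$, so the harmonic sum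
costs one more logarithm. The factor 3 counts two boundary terms and the interior. -/
lemma norm_sum_inv_stepSize_smul_le {η₀ a q C : ℝ} (hη₀ : 0 < η₀) (ha : 0 < a) (ha1 : a ≤ 1)
    (hq : 0 ≤ q) (hqa : q ≤ a) {Δ : ℕ → E}
    (hΔ : ∀ t : ℕ, ‖Δ t‖ ≤ C * (((t : ℝ) + 1) ^ ((q - a) / 2) * logWeight t)) (t : ℕ) :
    ‖∑ s ∈ Finset.range t, (stepSize η₀ a s)⁻¹ • (Δ s - Δ (s + 1))‖
      ≤ 3 * η₀⁻¹ * C * (((t : ℝ) + 1) ^ ((q + a) / 2) * logWeight t ^ 2) := by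
  set η := stepSize η₀ a with hηdef
  have hC : 0 ≤ C := by
    have := (norm_nonneg _).trans (hΔ 0)
    simpa [logWeight] using this
  have hid : ∀ t, ∑ s ∈ Finset.range t, (η s)⁻¹ • (Δ s - Δ (s + 1))
      = (η 0)⁻¹ • Δ 0 - (η t)⁻¹ • Δ t
        + ∑ s ∈ Finset.range t, ((η (s + 1))⁻¹ - (η s)⁻¹) • Δ (s + 1) := by
    intro t
    induction t with
    | zero => simp
    | succ n ih =>
      rw [Finset.sum_range_succ, ih, Finset.sum_range_succ, smul_sub, sub_smul]
      abel
  have hN : (1 : ℝ) ≤ (t : ℝ) + 1 := by linarith [Nat.cast_nonneg (α := ℝ) t]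
  have hℓ := one_le_logWeight t
  set R : ℝ := ((t : ℝ) + 1) ^ ((q + a) / 2) with hR
  have hR1 : 1 ≤ R := Real.one_le_rpow hN (by positivity)
  have hℓ2 : logWeight t ≤ logWeight t ^ 2 := by nlinarith
  have h1 : ‖(η 0)⁻¹ • Δ 0‖ ≤ η₀⁻¹ * C * (R * logWeight t ^ 2) := by
    have h0 : ‖Δ 0‖ ≤ C := by simpa [logWeight] using hΔ 0
    have e : η 0 = η₀ := by simp [hηdef, stepSize]
    rw [norm_smul, e, Real.norm_of_nonneg (by positivity)]
    have : 1 ≤ R * logWeight t ^ 2 := one_le_mul_of_one_le_of_one_le hR1 (hℓ.trans hℓ2)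
    calc η₀⁻¹ * ‖Δ 0‖ ≤ η₀⁻¹ * C * 1 := by rw [mul_one]; gcongr
      _ ≤ _ := by gcongr
  have h2 : ‖(η t)⁻¹ • Δ t‖ ≤ η₀⁻¹ * C * (R * logWeight t ^ 2) := by
    rw [norm_smul, Real.norm_of_nonneg (inv_nonneg.2 (stepSize_pos hη₀ a t).le)]
    calc (η t)⁻¹ * ‖Δ t‖ ≤ (η₀⁻¹ * ((t : ℝ) + 1) ^ a)
          * (C * (((t : ℝ) + 1) ^ ((q - a) / 2) * logWeight t)) :=
          mul_le_mul (inv_stepSize_le hη₀ ha t) (hΔ t) (norm_nonneg _) (by positivity)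
      _ = η₀⁻¹ * C * ((((t : ℝ) + 1) ^ a * ((t : ℝ) + 1) ^ ((q - a) / 2)) * logWeight t) := by ring
      _ = η₀⁻¹ * C * (R * logWeight t) := by
          rw [← Real.rpow_add (by linarith), hR]; congr 4; ring
      _ ≤ _ := by gcongr
  have h3 : ‖∑ s ∈ Finset.range t, ((η (s + 1))⁻¹ - (η s)⁻¹) • Δ (s + 1)‖
      ≤ η₀⁻¹ * C * (R * logWeight t ^ 2) := by
    calc _ ≤ ∑ s ∈ Finset.range t, η₀⁻¹ * C * (R * logWeight t) * ((s : ℝ) + 1)⁻¹ := by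
          refine norm_sum_le_of_le _ fun s hs => ?_
          have hst : s + 1 ≤ t := Finset.mem_range.1 hs
          have hst' : (s : ℝ) + 1 ≤ (t : ℝ) + 1 := by
            have : ((s + 1 : ℕ) : ℝ) ≤ t := by exact_mod_cast hst
            push_cast at this; linarith
          have hs0 : (0 : ℝ) < (s : ℝ) + 1 := by positivity
          have hx : (((s + 1 : ℕ) : ℝ) + 1) ^ ((q - a) / 2) ≤ ((s : ℝ) + 1) ^ ((q - a) / 2) :=
            Real.rpow_le_rpow_of_nonpos hs0 (by push_cast; linarith) (by linarith)
          rw [norm_smul, Real.norm_eq_abs]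
          calc |(η (s + 1))⁻¹ - (η s)⁻¹| * ‖Δ (s + 1)‖
              ≤ (η₀⁻¹ * ((s : ℝ) + 1) ^ (a - 1))
                * (C * (((s : ℝ) + 1) ^ ((q - a) / 2) * logWeight t)) := by
                refine mul_le_mul (abs_inv_stepSize_sub_le hη₀ ha ha1 s) ((hΔ (s + 1)).trans ?_)
                  (norm_nonneg _) (by positivity)
                have := logWeight_mono hst
                have := logWeight_pos (s + 1)
                gcongr
            _ = η₀⁻¹ * C * ((((s : ℝ) + 1) ^ (a - 1) * ((s : ℝ) + 1) ^ ((q - a) / 2))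
                  * logWeight t) := by ring
            _ = η₀⁻¹ * C * (((s : ℝ) + 1) ^ ((q + a) / 2) * logWeight t) * ((s : ℝ) + 1)⁻¹ := by
                rw [← Real.rpow_add hs0, show a - 1 + (q - a) / 2 = (q + a) / 2 - 1 by ring,
                  Real.rpow_sub_one hs0.ne']
                ring
            _ ≤ _ := by
                rw [hR]
                gcongr
      _ ≤ η₀⁻¹ * C * (R * logWeight t) * logWeight t := by
          rw [← Finset.mul_sum]
          exact mul_le_mul_of_nonneg_left (sum_inv_le_logWeight t) (by positivity)
      _ = _ := by ring
  rw [hid]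
  refine (norm_add_le _ _).trans ?_
  have := norm_sub_le ((η 0)⁻¹ • Δ 0) ((η t)⁻¹ • Δ t)
  linarith

/-- The pathwise expansion of the sum of the iterates of a recursion driven by an approximately
linear field. -/
theorem exists_norm_sum_sub_le {η₀ a q lam C₁ C₂ C₃ C₄ : ℝ} (hη₀ : 0 < η₀) (ha : 0 < a)
    (ha1 : a ≤ 1) (hq : 0 ≤ q) (hqa : q ≤ a) (hlam : 0 ≤ lam) (hlam1 : lam ≤ 1)
    {Δ f e e' : ℕ → E} {H Hi : E →L[ℝ] E} (hH : ∀ y, Hi (H y) = y)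
    (hrec : ∀ t, Δ (t + 1) = Δ t - stepSize η₀ a t • (f t - e t))
    (h₁ : ∀ t : ℕ, ‖Δ t‖ ≤ C₁ * (((t : ℝ) + 1) ^ ((q - a) / 2) * logWeight t))
    (h₂ : ∀ t, ∑ s ∈ Finset.range t,
      (((s : ℝ) + 1) * logWeight s ^ 2)⁻¹ * (((s : ℝ) + 1) ^ a * ‖Δ s‖ ^ 2) ≤ C₂)
    (h₃ : ∀ t, ‖∑ s ∈ Finset.range t,
      (((s : ℝ) + 1) ^ ((1 - a) / 2) * logWeight s)⁻¹ • (e s - e' s)‖ ≤ C₃)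
    (hC₄ : 0 ≤ C₄) (h₄ : ∀ s, ‖f s - H (Δ s)‖ ≤ C₄ * ‖Δ s‖ ^ (1 + lam)) :
    ∃ C, 0 ≤ C ∧ ∀ t : ℕ,
      ‖∑ s ∈ Finset.range t, Δ (s + 1) - ∑ s ∈ Finset.range t, Hi (e' s)‖
      ≤ C * ((1 + ((t : ℝ) + 1) ^ (1 - a * (1 + lam) / 2) + ((t : ℝ) + 1) ^ ((q + a) / 2)
        + ((t : ℝ) + 1) ^ ((1 - a) / 2)) * logWeight t ^ 2) := by
  have hC₁ : 0 ≤ C₁ := by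
    have := (norm_nonneg _).trans (h₁ 0)
    simpa [logWeight] using this
  have hC₂ : 0 ≤ C₂ := by simpa using h₂ 0
  have hC₃ : 0 ≤ C₃ := by simpa using h₃ 0
  refine ⟨‖Hi‖ * (3 * η₀⁻¹ * C₁ + 2 * C₃ + C₄ * (1 + C₂)) + 2 * C₁, by positivity, fun t => ?_⟩
  set η := stepSize η₀ a with hη
  have hηpos : ∀ s, 0 < η s := stepSize_pos hη₀ a
  -- The recursion solved for the linear part, with the root noise `e'` split off from `e`.
  have hf : ∀ s, H (Δ s) = (η s)⁻¹ • (Δ s - Δ (s + 1)) + (e s - e' s) + e' s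
      - (f s - H (Δ s)) := by
    intro s
    rw [hrec s, sub_sub_cancel, smul_smul, inv_mul_cancel₀ (hηpos s).ne', one_smul]
    abel
  have hid : ∑ s ∈ Finset.range t, Δ (s + 1) - ∑ s ∈ Finset.range t, Hi (e' s)
      = Hi (∑ s ∈ Finset.range t, (η s)⁻¹ • (Δ s - Δ (s + 1))
          + ∑ s ∈ Finset.range t, (e s - e' s) - ∑ s ∈ Finset.range t, (f s - H (Δ s)))
        + (Δ t - Δ 0) := by
    -- The average starts at index 1 while the recursion controls indices from 0; the shift costs
    -- only `Δ t - Δ 0`.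
    have h1 : ∑ s ∈ Finset.range t, Δ (s + 1) = ∑ s ∈ Finset.range t, Hi (H (Δ s)) + (Δ t - Δ 0) := by
      rw [← Finset.sum_range_sub, ← Finset.sum_add_distrib]
      refine Finset.sum_congr rfl fun s _ => ?_
      rw [hH]; abel
    have h2 : ∑ s ∈ Finset.range t, Hi (H (Δ s)) = Hi (∑ s ∈ Finset.range t, H (Δ s)) :=
      (map_sum Hi _ _).symm
    have h3 : ∑ s ∈ Finset.range t, H (Δ s)
        = ∑ s ∈ Finset.range t, (η s)⁻¹ • (Δ s - Δ (s + 1))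
          + ∑ s ∈ Finset.range t, (e s - e' s) + ∑ s ∈ Finset.range t, e' s
          - ∑ s ∈ Finset.range t, (f s - H (Δ s)) := by
      rw [← Finset.sum_add_distrib, ← Finset.sum_add_distrib, ← Finset.sum_sub_distrib]
      exact Finset.sum_congr rfl fun s _ => hf s
    rw [h1, h2, h3, ← map_sum Hi]
    simp only [map_add, map_sub]
    abel
  have hN : (1 : ℝ) ≤ (t : ℝ) + 1 := by linarith [Nat.cast_nonneg (α := ℝ) t]
  have hℓ := one_le_logWeight t
  have hℓ2 : logWeight t ≤ logWeight t ^ 2 := by nlinarith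
  have b1 := norm_sum_inv_stepSize_smul_le hη₀ ha ha1 hq hqa h₁ t
  have b2 : ‖∑ s ∈ Finset.range t, (e s - e' s)‖
      ≤ 2 * C₃ * (((t : ℝ) + 1) ^ ((1 - a) / 2) * logWeight t) := by
    refine norm_sum_le_of_norm_sum_smul_le
      (b := fun s => ((s : ℝ) + 1) ^ ((1 - a) / 2) * logWeight s) (fun s => ?_) ?_ h₃ t
    · have := logWeight_pos s; positivity
    · intro s s' hs
      have h0 : (s : ℝ) ≤ s' := by exact_mod_cast hs
      have h1 := logWeight_mono hs
      have h2 := logWeight_pos s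
      have h3 : 0 ≤ (1 - a) / 2 := by linarith
      simp only
      gcongr
  have b3 : ‖∑ s ∈ Finset.range t, (f s - H (Δ s))‖
      ≤ C₄ * ((1 + C₂) * (((t : ℝ) + 1) ^ (1 - a * (1 + lam) / 2) * logWeight t ^ 2)) := by
    refine (norm_sum_le_of_le _ fun s _ => h₄ s).trans ?_
    rw [← Finset.mul_sum]
    exact mul_le_mul_of_nonneg_left (sum_norm_rpow_le ha ha1 hlam hlam1 h₂ t) hC₄
  have b4 : ∀ s, ‖Δ s‖ ≤ C₁ * logWeight s := by
    intro s
    refine (h₁ s).trans ?_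
    have : ((s : ℝ) + 1) ^ ((q - a) / 2) ≤ 1 :=
      Real.rpow_le_one_of_one_le_of_nonpos (by linarith [Nat.cast_nonneg (α := ℝ) s]) (by linarith)
    have h2 := logWeight_pos s
    calc C₁ * (((s : ℝ) + 1) ^ ((q - a) / 2) * logWeight s) ≤ C₁ * (1 * logWeight s) := by gcongr
      _ = _ := by ring
  set A := ((t : ℝ) + 1) ^ (1 - a * (1 + lam) / 2)
  set A' := ((t : ℝ) + 1) ^ ((q + a) / 2)
  set A'' := ((t : ℝ) + 1) ^ ((1 - a) / 2)
  have hA : 0 ≤ A := by positivity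
  have hA' : 0 ≤ A' := by positivity
  have hA'' : 0 ≤ A'' := by positivity
  set Q := logWeight t ^ 2 with hQ
  have hQ0 : 0 ≤ Q := by positivity
  have hT : 0 ≤ (1 + A + A' + A'') * Q := by positivity
  have c1 : 3 * η₀⁻¹ * C₁ * (A' * Q) ≤ 3 * η₀⁻¹ * C₁ * ((1 + A + A' + A'') * Q) := by
    gcongr; linarith
  have c2 : 2 * C₃ * (A'' * logWeight t) ≤ 2 * C₃ * ((1 + A + A' + A'') * Q) := by
    gcongr; linarith
  have c3 : C₄ * ((1 + C₂) * (A * Q)) ≤ C₄ * (1 + C₂) * ((1 + A + A' + A'') * Q) := by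
    rw [mul_assoc]
    gcongr
    linarith
  have c4 : ‖Δ t - Δ 0‖ ≤ 2 * C₁ * ((1 + A + A' + A'') * Q) := by
    have h1 := norm_sub_le (Δ t) (Δ 0)
    have h2 := b4 t
    have h3 := b4 0
    have h4 : logWeight t ≤ (1 + A + A' + A'') * Q :=
      hℓ2.trans (le_mul_of_one_le_left hQ0 (by linarith))
    have h5 : C₁ * logWeight 0 ≤ C₁ * logWeight t :=
      mul_le_mul_of_nonneg_left (logWeight_mono (Nat.zero_le t)) hC₁
    have h6 := mul_le_mul_of_nonneg_left h4 hC₁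
    linarith
  rw [hid]
  refine (norm_add_le _ _).trans ?_
  have c5 : ‖Hi (∑ s ∈ Finset.range t, (η s)⁻¹ • (Δ s - Δ (s + 1))
          + ∑ s ∈ Finset.range t, (e s - e' s) - ∑ s ∈ Finset.range t, (f s - H (Δ s)))‖
      ≤ ‖Hi‖ * ((3 * η₀⁻¹ * C₁ + 2 * C₃ + C₄ * (1 + C₂)) * ((1 + A + A' + A'') * Q)) := by
    refine (Hi.le_opNorm _).trans (mul_le_mul_of_nonneg_left ?_ (norm_nonneg _))
    refine (norm_sub_le _ _).trans ?_
    have := norm_add_le (∑ s ∈ Finset.range t, (η s)⁻¹ • (Δ s - Δ (s + 1)))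
      (∑ s ∈ Finset.range t, (e s - e' s))
    linarith
  linarith

end Pathwise

/-! ### Comparison of powers and logarithms -/

section Asymptotics

lemma toReal_two_mul_inv (p : ℝ≥0∞) : ((2 * p)⁻¹).toReal = (p⁻¹).toReal / 2 := by
  rw [ENNReal.mul_inv (by simp) (by simp), ENNReal.toReal_mul]
  simp; ring

/-- Powers of `t` dominate powers of logarithms. -/
lemma isLittleO_rpow_mul_log {b b' : ℝ} (h : b < b') (k k' : ℝ) :
    (fun t : ℕ => (t : ℝ) ^ b * Real.log t ^ k) =o[atTop]
      fun t : ℕ => (t : ℝ) ^ b' * Real.log t ^ k' := by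
  have h1 : (fun x : ℝ => Real.log x ^ (k - k')) =o[atTop] fun x => x ^ (b' - b) :=
    isLittleO_log_rpow_rpow_atTop _ (by linarith)
  have h2 := h1.comp_tendsto (tendsto_natCast_atTop_atTop (R := ℝ))
  have h3 := (isBigO_refl (fun t : ℕ => (t : ℝ) ^ b * Real.log t ^ k') atTop).mul_isLittleO h2
  have hlog : ∀ᶠ t : ℕ in atTop, 0 < Real.log t :=
    (Real.tendsto_log_atTop.comp tendsto_natCast_atTop_atTop).eventually_gt_atTop 0
  refine h3.congr' ?_ ?_
  · filter_upwards [hlog] with t ht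
    simp only [Function.comp]
    rw [mul_assoc, ← Real.rpow_add ht]
    congr 2; ring
  · filter_upwards [eventually_gt_atTop 0] with t ht
    have : (0 : ℝ) < t := by exact_mod_cast ht
    simp only [Function.comp]
    rw [mul_right_comm, ← Real.rpow_add this]
    congr 2; ring

lemma isBigO_rpow_mul_log {b b' : ℝ} (h : b ≤ b') {k k' : ℝ} (hk : k ≤ k') :
    (fun t : ℕ => (t : ℝ) ^ b * Real.log t ^ k) =O[atTop]
      fun t : ℕ => (t : ℝ) ^ b' * Real.log t ^ k' := by
  have hlog : ∀ᶠ t : ℕ in atTop, 1 ≤ Real.log t :=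
    (Real.tendsto_log_atTop.comp tendsto_natCast_atTop_atTop).eventually_ge_atTop 1
  refine IsBigO.of_bound 1 ?_
  filter_upwards [hlog, eventually_ge_atTop 1] with t h1 h2
  have h3 : (1 : ℝ) ≤ t := by exact_mod_cast h2
  rw [one_mul, Real.norm_of_nonneg (by positivity), Real.norm_of_nonneg (by positivity)]
  exact mul_le_mul (Real.rpow_le_rpow_of_exponent_le h3 h)
    (Real.rpow_le_rpow_of_exponent_le h1 hk) (by positivity) (by positivity)

/-- A bound of the unnormalized error turns into a rate for the average. -/
lemma isLittleO_overallRate {E : Type*} [NormedAddCommGroup E] [NormedSpace ℝ E]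
    {a lam ε : ℝ} {p : ℝ≥0∞} (ha : 0 < a) (ha1 : a ≤ 1) (hlam : 0 ≤ lam)
    (hq : (p⁻¹).toReal ≤ a) (hε : 0 ≤ ε) {F : ℕ → E} {C : ℝ} (hC : 0 ≤ C)
    (hF : ∀ t : ℕ, ‖F t‖ ≤ C * ((1 + ((t : ℝ) + 1) ^ (1 - a * (1 + lam) / 2)
      + ((t : ℝ) + 1) ^ (((p⁻¹).toReal + a) / 2)
      + ((t : ℝ) + 1) ^ ((1 - a) / 2)) * logWeight t ^ 2)) :
    (fun t : ℕ => (t : ℝ)⁻¹ • F t) =o[atTop]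
      fun t : ℕ => overallRate lam p ε a t * Real.log t ^ (3 : ℝ) := by
  set q := (p⁻¹).toReal with hqdef
  have hq0 : 0 ≤ q := ENNReal.toReal_nonneg
  have hlog : ∀ᶠ t : ℕ in atTop, 1 ≤ Real.log t :=
    (Real.tendsto_log_atTop.comp tendsto_natCast_atTop_atTop).eventually_ge_atTop 1
  have hbig : (fun t : ℕ => (t : ℝ)⁻¹ • F t) =O[atTop]
      fun t : ℕ => overallRate lam p ε a t * Real.log t ^ (2 : ℝ) := by
    -- The 2 replaces `t + 1` by `t` in powers with exponent at most 1; the 9 comes from `logWeight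
    -- t ≤ 3 * Real.log t`.
    refine IsBigO.of_bound (C * (2 * 9)) ?_
    filter_upwards [hlog, eventually_ge_atTop 1] with t h1 h2
    have ht1 : (1 : ℝ) ≤ t := by exact_mod_cast h2
    have ht0 : (0 : ℝ) < t := by linarith
    have hℓ0 := logWeight_pos t
    have hℓ : logWeight t ≤ 3 * Real.log t := by
      have : Real.log ((t : ℝ) + 1) ≤ Real.log (2 * t) := Real.log_le_log (by linarith) (by linarith)
      rw [Real.log_mul (by norm_num) ht0.ne'] at this
      have h3 : Real.log 2 ≤ 1 := by linarith [Real.log_two_lt_d9]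
      unfold logWeight
      linarith
    have hℓ2 : logWeight t ^ 2 ≤ 9 * Real.log t ^ 2 := by
      calc logWeight t ^ 2 ≤ (3 * Real.log t) ^ 2 := pow_le_pow_left₀ hℓ0.le hℓ 2
        _ = _ := by ring
    have hpow : ∀ β : ℝ, 0 ≤ β ∨ β ≤ 0 → β ≤ 1 → ((t : ℝ) + 1) ^ β ≤ 2 * (t : ℝ) ^ β := by
      intro β hβ hβ1
      rcases hβ with hβ | hβ
      · calc ((t : ℝ) + 1) ^ β ≤ (2 * t) ^ β := Real.rpow_le_rpow (by positivity) (by linarith) hβ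
          _ = 2 ^ β * (t : ℝ) ^ β := Real.mul_rpow (by norm_num) ht0.le
          _ ≤ 2 ^ (1 : ℝ) * (t : ℝ) ^ β := by
              gcongr
              norm_num
          _ = _ := by rw [Real.rpow_one]
      · have h3 : ((t : ℝ) + 1) ^ β ≤ (t : ℝ) ^ β :=
          Real.rpow_le_rpow_of_nonpos ht0 (by linarith) hβ
        have h4 : 0 ≤ (t : ℝ) ^ β := by positivity
        linarith
    have hdiv : ∀ β : ℝ, (t : ℝ)⁻¹ * (t : ℝ) ^ β = (t : ℝ) ^ (β - 1) := fun β => by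
      rw [Real.rpow_sub_one ht0.ne', div_eq_inv_mul]
    have hle : ∀ b k : ℝ, 0 ≤ k → (t : ℝ) ^ b ≤ (t : ℝ) ^ b * Real.log t ^ k := fun b k hk =>
      le_mul_of_one_le_right (by positivity) (Real.one_le_rpow h1 hk)
    have e1 := hpow (1 - a * (1 + lam) / 2) (le_total _ _) (by nlinarith)
    have e2 := hpow ((q + a) / 2) (le_total _ _) (by linarith)
    have e3 := hpow ((1 - a) / 2) (le_total _ _) (by linarith)
    have f0 := hle (-1) ε hε
    have f1 := hle (-(a * (1 + lam) / 2)) (1 + ε) (by linarith)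
    have f2 := hle (q / 2 - (2 - a) / 2) (q / 2 + ε) (by positivity)
    have f3 := hle (-((1 + a) / 2)) (1 / 2 + ε) (by positivity)
    have d1 := hdiv (1 - a * (1 + lam) / 2)
    have d2 := hdiv ((q + a) / 2)
    have d3 := hdiv ((1 - a) / 2)
    rw [show 1 - a * (1 + lam) / 2 - 1 = -(a * (1 + lam) / 2) by ring] at d1
    rw [show (q + a) / 2 - 1 = q / 2 - (2 - a) / 2 by ring] at d2
    rw [show (1 - a) / 2 - 1 = -((1 + a) / 2) by ring] at d3
    have hrate : (t : ℝ)⁻¹ * (1 + (t : ℝ) ^ (1 - a * (1 + lam) / 2) + (t : ℝ) ^ ((q + a) / 2)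
        + (t : ℝ) ^ ((1 - a) / 2)) ≤ overallRate lam p ε a t := by
      unfold overallRate
      rw [toReal_two_mul_inv, ← hqdef, mul_add, mul_add, mul_add, d1, d2, d3, mul_one,
        ← Real.rpow_neg_one]
      linarith
    have hrate0 : 0 ≤ overallRate lam p ε a t := le_trans (by positivity) hrate
    rw [norm_smul, Real.norm_of_nonneg (by positivity : (0 : ℝ) ≤ (t : ℝ)⁻¹),
      Real.norm_of_nonneg (mul_nonneg hrate0 (by positivity)), Real.rpow_two]
    calc (t : ℝ)⁻¹ * ‖F t‖ ≤ (t : ℝ)⁻¹ * (C * ((1 + ((t : ℝ) + 1) ^ (1 - a * (1 + lam) / 2)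
          + ((t : ℝ) + 1) ^ ((q + a) / 2)
          + ((t : ℝ) + 1) ^ ((1 - a) / 2)) * logWeight t ^ 2)) := by gcongr; exact hF t
      _ ≤ (t : ℝ)⁻¹ * (C * ((2 * (1 + (t : ℝ) ^ (1 - a * (1 + lam) / 2)
          + (t : ℝ) ^ ((q + a) / 2) + (t : ℝ) ^ ((1 - a) / 2))) * (9 * Real.log t ^ 2))) := by
          gcongr
          linarith
      _ = C * (2 * 9) * (((t : ℝ)⁻¹ * (1 + (t : ℝ) ^ (1 - a * (1 + lam) / 2)
          + (t : ℝ) ^ ((q + a) / 2) + (t : ℝ) ^ ((1 - a) / 2))) * Real.log t ^ 2) := by ring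
      _ ≤ _ := by gcongr
  -- One spare logarithm upgrades the big-O to a little-o.
  refine hbig.trans_isLittleO ((isBigO_refl _ _).mul_isLittleO ?_)
  have h := (isLittleO_pow_pow_atTop_of_lt (𝕜 := ℝ) (show 2 < 3 by norm_num)).comp_tendsto
    (Real.tendsto_log_atTop.comp (tendsto_natCast_atTop_atTop (R := ℝ)))
  exact h.congr (fun t => (Real.rpow_two _).symm) fun t => (Real.rpow_ofNat _ 3).symm

end Asymptotics

/-! ### From localized bounds to almost every path -/

lemma norm_sum_range_le_of_eq_zero {E : Type*} [NormedAddCommGroup E] {f : ℕ → E} {n : ℕ}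
    (hf : ∀ s, n ≤ s → f s = 0) (t : ℕ) :
    ‖∑ s ∈ Finset.range t, f s‖ ≤ ∑ s ∈ Finset.range n, ‖f s‖ := by
  refine (norm_sum_le _ _).trans ?_
  rw [← Finset.sum_filter_ne_zero]
  refine Finset.sum_le_sum_of_subset_of_nonneg (fun s hs => ?_) fun s _ _ => norm_nonneg _
  by_contra h
  exact (Finset.mem_filter.1 hs).2 (by rw [hf s (by simpa using h), norm_zero])

lemma exists_forall_le_mul_of_forall_ge {u v : ℕ → ℝ} (hv : ∀ t, 0 < v t) {n : ℕ} {C : ℝ}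
    (h : ∀ t, n ≤ t → u t ≤ C * v t) : ∃ C', ∀ t, u t ≤ C' * v t := by
  refine ⟨|C| + ∑ s ∈ Finset.range n, |u s / v s|, fun t => ?_⟩
  have h0 : 0 ≤ ∑ s ∈ Finset.range n, |u s / v s| := Finset.sum_nonneg fun s _ => abs_nonneg _
  rcases le_or_gt n t with ht | ht
  · refine (h t ht).trans (mul_le_mul_of_nonneg_right ?_ (hv t).le)
    linarith [le_abs_self C]
  · rw [← div_le_iff₀ (hv t)]
    have h1 : |u t / v t| ≤ ∑ s ∈ Finset.range n, |u s / v s| :=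
      Finset.single_le_sum (f := fun s => |u s / v s|) (fun s _ => abs_nonneg _)
        (Finset.mem_range.2 ht)
    linarith [le_abs_self (u t / v t), abs_nonneg C]

variable {E : Type*} [NormedAddCommGroup E] [InnerProductSpace ℝ E]
  {Ω : Type*} {mΩ : MeasurableSpace Ω} {P : Measure Ω} {ℱ : Filtration ℕ mΩ}
  {γ : E → E} {V : E → ℝ} {dV : E → E} {μ L Lγ : ℝ} {Δ e e' : ℕ → Ω → E}

/-- The weighted martingale of the noise differences is almost surely bounded, after
localization. -/
lemma IsNoisyDescent.ae_bdd_weighted_noise_diff [ProperSpace E] [IsProbabilityMeasure P]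
    {η₀ a δ K : ℝ} (hη₀ : 0 < η₀) (ha : 0 < a) (ha1 : a ≤ 1)
    (h : IsNoisyDescent P ℱ (stepSize η₀ a) γ Δ e) (hV : IsLyapunov γ V dV μ L Lγ) {n : ℕ}
    {M : ℝ} (hM : ∀ t, ∫ ω in localSet Δ δ n t, V (Δ t ω) / stepSize η₀ a t ∂P ≤ M)
    (hD : IsMartingaleDiff P ℱ fun t ω => e t ω - e' t ω) (hK : 0 ≤ K)
    (hD2 : ∀ t A, MeasurableSet[ℱ t] A → IntegrableOn (fun ω => ‖Δ t ω‖ ^ 2) A P →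
      ∫ ω in A, ‖e t ω - e' t ω‖ ^ 2 ∂P ≤ K * ∫ ω in A, ‖Δ t ω‖ ^ 2 ∂P) :
    ∀ᵐ ω ∂P, ∃ C, ∀ t, ‖∑ s ∈ Finset.range t, (localSet Δ δ n s).indicator
      (fun ω => (((s : ℝ) + 1) ^ ((1 - a) / 2) * logWeight s)⁻¹ • (e s ω - e' s ω)) ω‖ ≤ C := by
  have hAm := fun t => measurableSet_localSet h.stronglyMeasurable δ n t
  have hμ := hV.pos_lower
  refine (hD.indicator_smul hAm
    fun s => (((s : ℝ) + 1) ^ ((1 - a) / 2) * logWeight s)⁻¹).ae_bddAbove_norm_sum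
    (B := 2 * (K * (2 * η₀ * M / μ))) fun t => ?_
  have hM0 : 0 ≤ M := le_trans (integral_nonneg fun ω =>
    div_nonneg (hV.nonneg _) (h.step_pos 0).le) (hM 0)
  calc _ ≤ ∑ s ∈ Finset.range t, (((s : ℝ) + 1) * logWeight s ^ 2)⁻¹ * (K * (2 * η₀ * M / μ)) := by
        refine Finset.sum_le_sum fun s _ => ?_
        have hs0 : (0 : ℝ) < (s : ℝ) + 1 := by positivity
        have hℓ := logWeight_pos s
        set c : ℝ := (((s : ℝ) + 1) ^ ((1 - a) / 2) * logWeight s)⁻¹ with hc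
        have h1 : ∀ ω, ‖(localSet Δ δ n s).indicator (fun ω => c • (e s ω - e' s ω)) ω‖ ^ 2
            = (localSet Δ δ n s).indicator (fun ω => c ^ 2 * ‖e s ω - e' s ω‖ ^ 2) ω := by
          intro ω
          by_cases hω : ω ∈ localSet Δ δ n s
          · simp [hω, norm_smul, mul_pow]
          · simp [hω]
        simp_rw [h1]
        rw [integral_indicator (ℱ.le s _ (hAm s)), integral_const_mul]
        have hint : ∀ f : E → ℝ, Continuous f →
            IntegrableOn (fun ω => f (Δ s ω)) (localSet Δ δ n s) P := fun f hf =>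
          memLp_one_iff_integrable.1
            (memLp_comp_restrict_localSet (P := P) h.stronglyMeasurable hf δ n s 1)
        have hsq := hint (fun y => ‖y‖ ^ 2) (by fun_prop)
        have hVint := hint (fun y => V y / stepSize η₀ a s) (hV.continuous.div_const _)
        have h2 : ∫ ω in localSet Δ δ n s, ‖Δ s ω‖ ^ 2 ∂P ≤ stepSize η₀ a s / μ * M := by
          calc _ ≤ ∫ ω in localSet Δ δ n s, stepSize η₀ a s / μ * (V (Δ s ω) / stepSize η₀ a s) ∂P := by
                refine integral_mono hsq (hVint.const_mul _) fun ω => ?_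
                have := hV.norm_sq_le (Δ s ω)
                have h3 := (h.step_pos s).ne'
                simp only
                refine this.trans (le_of_eq ?_)
                field_simp
            _ ≤ _ := by
                rw [integral_const_mul]
                exact mul_le_mul_of_nonneg_left (hM s) (div_nonneg (h.step_pos s).le hμ.le)
        -- The weight is chosen so that its square times the localized second moment of `Δ s`, of
        -- order `(s + 1) ^ (-a)`, is the summable logarithmic weight.
        have h3 : c ^ 2 = ((s : ℝ) + 1) ^ a * (((s : ℝ) + 1) * logWeight s ^ 2)⁻¹ := by
          rw [hc, inv_pow, mul_pow, ← Real.rpow_mul_natCast hs0.le]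
          push_cast
          rw [div_mul_cancel₀ _ (two_ne_zero), Real.rpow_sub hs0, Real.rpow_one]
          have : (0 : ℝ) < ((s : ℝ) + 1) ^ a := by positivity
          field_simp
        have h4 : ((s : ℝ) + 1) ^ a * stepSize η₀ a s ≤ 2 * η₀ := by
          have := mul_le_mul_of_nonneg_left (stepSize_le hη₀ ha ha1 s)
            (show 0 ≤ ((s : ℝ) + 1) ^ a by positivity)
          refine this.trans (le_of_eq ?_)
          rw [Real.rpow_neg hs0.le]
          have : (0 : ℝ) < ((s : ℝ) + 1) ^ a := by positivity
          field_simp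
        calc c ^ 2 * ∫ ω in localSet Δ δ n s, ‖e s ω - e' s ω‖ ^ 2 ∂P
            ≤ c ^ 2 * (K * (stepSize η₀ a s / μ * M)) := by
              refine mul_le_mul_of_nonneg_left ((hD2 s _ (hAm s) hsq).trans ?_) (sq_nonneg c)
              exact mul_le_mul_of_nonneg_left h2 hK
          _ = (((s : ℝ) + 1) * logWeight s ^ 2)⁻¹
              * (K * (((s : ℝ) + 1) ^ a * stepSize η₀ a s * M / μ)) := by rw [h3]; ring
          _ ≤ _ := by gcongr
    _ ≤ _ := by
        rw [← Finset.sum_mul]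
        exact mul_le_mul_of_nonneg_right (sum_inv_mul_logWeight_sq_le_two t) (by positivity)

/-- Almost sure expansion of the sums of a noisy descent with polynomial step sizes. -/
theorem IsNoisyDescent.ae_exists_norm_sum_sub_le [ProperSpace E] [IsProbabilityMeasure P]
    {η₀ a q lam δ K C₄ : ℝ} (hη₀ : 0 < η₀) (ha : 0 < a) (ha1 : a ≤ 1) (hq : 0 ≤ q) (hqa : q ≤ a)
    (hlam : 0 ≤ lam) (hlam1 : lam ≤ 1) (hδ : 0 < δ)
    (h : IsNoisyDescent P ℱ (stepSize η₀ a) γ Δ e) (hV : IsLyapunov γ V dV μ L Lγ)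
    (hconv : ∀ᵐ ω ∂P, Tendsto (fun t => Δ t ω) atTop (𝓝 0)) {n₀ : ℕ}
    (hrate : ∀ n, n₀ ≤ n →
      (∃ M, ∀ t, ∫ ω in localSet Δ δ n t, V (Δ t ω) / stepSize η₀ a t ∂P ≤ M) ∧
      ∀ᵐ ω ∂P, ∃ C, ∀ t, ω ∈ localSet Δ δ n t →
        V (Δ t ω) / stepSize η₀ a t ≤ C * (((t : ℝ) + 1) ^ q * logWeight t))
    (hD : IsMartingaleDiff P ℱ fun t ω => e t ω - e' t ω) (hK : 0 ≤ K)
    (hD2 : ∀ t A, MeasurableSet[ℱ t] A → IntegrableOn (fun ω => ‖Δ t ω‖ ^ 2) A P →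
      ∫ ω in A, ‖e t ω - e' t ω‖ ^ 2 ∂P ≤ K * ∫ ω in A, ‖Δ t ω‖ ^ 2 ∂P)
    {H Hi : E →L[ℝ] E} (hH : ∀ y, Hi (H y) = y)
    (hC₄ : 0 ≤ C₄) (hlin : ∀ y, ‖γ y - H y‖ ≤ C₄ * ‖y‖ ^ (1 + lam)) :
    ∀ᵐ ω ∂P, ∃ C, 0 ≤ C ∧ ∀ t : ℕ,
      ‖∑ s ∈ Finset.range t, Δ (s + 1) ω - ∑ s ∈ Finset.range t, Hi (e' s ω)‖
      ≤ C * ((1 + ((t : ℝ) + 1) ^ (1 - a * (1 + lam) / 2) + ((t : ℝ) + 1) ^ ((q + a) / 2)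
        + ((t : ℝ) + 1) ^ ((1 - a) / 2)) * logWeight t ^ 2) := by
  have hμ := hV.pos_lower
  have hW0 : ∀ t ω, 0 ≤ V (Δ t ω) / stepSize η₀ a t := fun t ω =>
    div_nonneg (hV.nonneg _) (h.step_pos t).le
  have hsq : ∀ (t : ℕ) ω, ((t : ℝ) + 1) ^ a * ‖Δ t ω‖ ^ 2
      ≤ 2 * η₀ / μ * (V (Δ t ω) / stepSize η₀ a t) := by
    intro t ω
    have h1 := stepSize_le hη₀ ha ha1 t
    have hpos := h.step_pos t
    have ht0 : (0 : ℝ) < ((t : ℝ) + 1) ^ a := by positivity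
    rw [Real.rpow_neg (by positivity), ← div_eq_mul_inv, le_div_iff₀ ht0] at h1
    have h2 := hV.norm_sq_le (Δ t ω)
    have h3 := hV.nonneg (Δ t ω)
    calc ((t : ℝ) + 1) ^ a * ‖Δ t ω‖ ^ 2 ≤ ((t : ℝ) + 1) ^ a * (V (Δ t ω) / μ) := by gcongr
      _ = (stepSize η₀ a t * ((t : ℝ) + 1) ^ a) / μ * (V (Δ t ω) / stepSize η₀ a t) := by
          field_simp
      _ ≤ _ := by gcongr
  have hbd : ∀ n, ∀ᵐ ω ∂P, n₀ ≤ n →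
      (∃ C, ∀ t, ω ∈ localSet Δ δ n t →
        V (Δ t ω) / stepSize η₀ a t ≤ C * (((t : ℝ) + 1) ^ q * logWeight t)) ∧
      (∃ C, ∀ t, ∑ s ∈ Finset.range t, (((s : ℝ) + 1) * logWeight s ^ 2)⁻¹
        * (localSet Δ δ n s).indicator (fun ω => V (Δ s ω) / stepSize η₀ a s) ω ≤ C) ∧
      ∃ C, ∀ t, ‖∑ s ∈ Finset.range t, (localSet Δ δ n s).indicator
        (fun ω => (((s : ℝ) + 1) ^ ((1 - a) / 2) * logWeight s)⁻¹ • (e s ω - e' s ω)) ω‖ ≤ C := by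
    intro n
    by_cases hn : n₀ ≤ n
    · obtain ⟨⟨M, hM⟩, h2⟩ := hrate n hn
      have hint : ∀ t, IntegrableOn (fun ω => V (Δ t ω) / stepSize η₀ a t)
          (localSet Δ δ n t) P := fun t =>
        memLp_one_iff_integrable.1 (memLp_comp_restrict_localSet (P := P) h.stronglyMeasurable
          (f := fun y => V y / stepSize η₀ a t) (hV.continuous.div_const _) δ n t 1)
      filter_upwards [h2, ae_exists_sum_indicator_le
        (fun t => ℱ.le t _ (measurableSet_localSet h.stronglyMeasurable δ n t)) hW0 hint hM,
        h.ae_bdd_weighted_noise_diff hη₀ ha ha1 hV hM hD hK hD2] with ω h1 h2 h3 _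
      exact ⟨h1, h2, h3⟩
    · exact ae_of_all _ fun ω hn' => absurd hn' hn
  filter_upwards [hconv, ae_all_iff.2 hbd] with ω hω hall
  -- The time after which a path stays in the ball depends on the path, which is why the bounds were
  -- collected for all `n` simultaneously. From that time on the path belongs to every localized
  -- event.
  obtain ⟨n₁, hn₁⟩ : ∃ n₁, ∀ s, n₁ ≤ s → ‖Δ s ω‖ ≤ δ := by
    have := (tendsto_zero_iff_norm_tendsto_zero.1 hω).eventually_le_const hδ
    exact eventually_atTop.1 this
  set n := max n₀ n₁ with hn
  have hmem : ∀ t, n ≤ t → ω ∈ localSet Δ δ n t := fun t ht =>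
    ⟨ht, fun s hs _ => hn₁ s ((le_max_right _ _).trans hs)⟩
  obtain ⟨⟨C, hC⟩, ⟨C', hC'⟩, C'', hC''⟩ := hall n (le_max_left _ _)
  have hw0 : ∀ s : ℕ, 0 ≤ (((s : ℝ) + 1) * logWeight s ^ 2)⁻¹ := fun s => by
    have := logWeight_pos s; positivity
  obtain ⟨C₁, hC₁⟩ : ∃ C₁, ∀ t : ℕ,
      ‖Δ t ω‖ ≤ C₁ * (((t : ℝ) + 1) ^ ((q - a) / 2) * logWeight t) := by
    refine exists_forall_le_mul_of_forall_ge (n := n)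
      (C := Real.sqrt (2 * η₀ / μ * |C|)) (fun t => ?_) fun t ht => ?_
    · have := logWeight_pos t; positivity
    · have ht0 : (0 : ℝ) < (t : ℝ) + 1 := by positivity
      have hℓ := one_le_logWeight t
      have h1 := hC t (hmem t ht)
      have h2 := hsq t ω
      have h3 : ‖Δ t ω‖ ^ 2 ≤ 2 * η₀ / μ * |C| * (((t : ℝ) + 1) ^ ((q - a) / 2) * logWeight t) ^ 2 := by
        have hta : (0 : ℝ) < ((t : ℝ) + 1) ^ a := by positivity
        have e1 : (((t : ℝ) + 1) ^ ((q - a) / 2)) ^ 2 = ((t : ℝ) + 1) ^ q / ((t : ℝ) + 1) ^ a := by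
          rw [← Real.rpow_mul_natCast ht0.le, ← Real.rpow_sub ht0]
          push_cast
          congr 1
          ring
        rw [mul_pow, e1, ← mul_le_mul_iff_right₀ hta]
        calc ((t : ℝ) + 1) ^ a * ‖Δ t ω‖ ^ 2
            ≤ 2 * η₀ / μ * (C * (((t : ℝ) + 1) ^ q * logWeight t)) :=
              h2.trans (mul_le_mul_of_nonneg_left h1 (by positivity))
          _ ≤ 2 * η₀ / μ * (|C| * (((t : ℝ) + 1) ^ q * logWeight t ^ 2)) := by
              gcongr
              · exact le_abs_self C
              · nlinarith
          _ = _ := by field_simp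
      have hX : 0 ≤ ((t : ℝ) + 1) ^ ((q - a) / 2) * logWeight t := by positivity
      rw [← Real.sqrt_sq hX, ← Real.sqrt_mul (by positivity)]
      exact Real.le_sqrt_of_sq_le h3
  set u : ℕ → ℝ := fun s => (((s : ℝ) + 1) * logWeight s ^ 2)⁻¹
    * (((s : ℝ) + 1) ^ a * ‖Δ s ω‖ ^ 2) with hu
  have hu0 : ∀ s, 0 ≤ u s := fun s => by have := hw0 s; simp only [hu]; positivity
  -- The finitely many times before `n` contribute a constant; afterwards the indicators equal 1 and
  -- the localized bound applies. The noise sum below is split in the same way.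
  have h₂ : ∀ t, ∑ s ∈ Finset.range t, u s
      ≤ ∑ s ∈ Finset.range n, ‖if n ≤ s then 0 else u s‖ + 2 * η₀ / μ * C' := by
    intro t
    have h1 : ∑ s ∈ Finset.range t, (if n ≤ s then 0 else u s)
        ≤ ∑ s ∈ Finset.range n, ‖if n ≤ s then 0 else u s‖ :=
      (Real.le_norm_self _).trans
        (norm_sum_range_le_of_eq_zero (f := fun s => if n ≤ s then 0 else u s)
          (fun s hs => if_pos hs) t)
    have h2 : ∑ s ∈ Finset.range t, (if n ≤ s then u s else 0) ≤ 2 * η₀ / μ * C' := by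
      refine le_trans ?_ (mul_le_mul_of_nonneg_left (hC' t) (by positivity))
      rw [Finset.mul_sum]
      refine Finset.sum_le_sum fun s _ => ?_
      split_ifs with hs
      · rw [Set.indicator_of_mem (hmem s hs)]
        have := mul_le_mul_of_nonneg_left (hsq s ω) (hw0 s)
        simp only [hu]
        linarith
      · exact mul_nonneg (by positivity)
          (mul_nonneg (hw0 s) (Set.indicator_nonneg (fun ω _ => hW0 s ω) ω))
    have h3 : ∀ s, u s = (if n ≤ s then 0 else u s) + (if n ≤ s then u s else 0) := fun s => by
      split_ifs <;> simp
    rw [Finset.sum_congr rfl fun s _ => h3 s, Finset.sum_add_distrib]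
    linarith
  set y : ℕ → E := fun s =>
    (((s : ℝ) + 1) ^ ((1 - a) / 2) * logWeight s)⁻¹ • (e s ω - e' s ω) with hy
  set y' : ℕ → E := fun s => (localSet Δ δ n s).indicator
    (fun ω => (((s : ℝ) + 1) ^ ((1 - a) / 2) * logWeight s)⁻¹ • (e s ω - e' s ω)) ω with hy'
  have h₃ : ∀ t, ‖∑ s ∈ Finset.range t, y s‖ ≤ ∑ s ∈ Finset.range n, ‖y s - y' s‖ + C'' := by
    intro t
    have h1 := norm_sum_range_le_of_eq_zero (f := fun s => y s - y' s) (n := n)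
      (fun s hs => by simp only [hy, hy']; rw [Set.indicator_of_mem (hmem s hs), sub_self]) t
    have h2 : ∑ s ∈ Finset.range t, y s
        = ∑ s ∈ Finset.range t, (y s - y' s) + ∑ s ∈ Finset.range t, y' s := by
      rw [← Finset.sum_add_distrib]; simp
    rw [h2]
    exact (norm_add_le _ _).trans (add_le_add h1 (hC'' t))
  exact exists_norm_sum_sub_le (f := fun s => γ (Δ s ω)) hη₀ ha ha1 hq hqa hlam hlam1 hH
    (fun t => h.recursion t ω) hC₁ h₂ h₃ hC₄ fun s => hlin _

/-! ### Functions with Lipschitz gradient -/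

section Gradient

variable {E : Type*} [NormedAddCommGroup E] [InnerProductSpace ℝ E] [CompleteSpace E]

/-- The descent inequality for a function with Lipschitz gradient. -/
lemma descent_of_lipschitz_gradient {V : E → ℝ} {L : ℝ} (hL : 0 ≤ L) (hV : Differentiable ℝ V)
    (hlip : ∀ y z, ‖gradient V y - gradient V z‖ ≤ L * ‖y - z‖) (y h : E) :
    V (y + h) ≤ V y + inner ℝ (gradient V y) h + L * ‖h‖ ^ 2 := by
  -- The mean value inequality for `V` minus its linearization at `y`, on the ball of radius `‖h‖`.
  -- It yields the constant `L` rather than `L / 2`, which suffices here.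
  have h1 := Convex.norm_image_sub_le_of_norm_hasFDerivWithin_le' (𝕜 := ℝ) (f := V)
    (f' := fun z => InnerProductSpace.toDual ℝ E (gradient V z))
    (φ := InnerProductSpace.toDual ℝ E (gradient V y)) (C := L * ‖h‖)
    (s := Metric.closedBall y ‖h‖) (x := y) (y := y + h)
    (fun z _ => (hV z).hasGradientAt.hasFDerivAt.hasFDerivWithinAt)
    (fun z hz => by
      rw [← map_sub, LinearIsometryEquiv.norm_map]
      refine (hlip z y).trans (mul_le_mul_of_nonneg_left ?_ hL)
      simpa [dist_eq_norm] using hz)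
    (convex_closedBall _ _) (by simp) (by simp)
  simp only [add_sub_cancel_left, InnerProductSpace.toDual_apply_apply] at h1
  have h2 := (Real.le_norm_self _).trans h1
  nlinarith

lemma gradient_eq_zero_of_forall_le {V : E → ℝ} {y : E} (hy : ∀ z, V y ≤ V z) :
    gradient V y = 0 := by
  have : IsLocalMin V y := Eventually.of_forall hy
  rw [gradient, this.fderiv_eq_zero, map_zero]

end Gradient

/-! ### Moments from bounds on L^r norms -/

section Moments

variable {α F : Type*} [MeasurableSpace α] {m : Measure α} [NormedAddCommGroup F]

lemma integral_norm_rpow_le_of_eLpNorm_le {f : α → F} {r : ℝ≥0∞} (hr0 : r ≠ 0) (hr : r ≠ ⊤)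
    (hf : MemLp f r m) {C : ℝ} (hC0 : 0 ≤ C) (hC : eLpNorm f r m ≤ ENNReal.ofReal C) :
    ∫ z, ‖f z‖ ^ r.toReal ∂m ≤ C ^ r.toReal := by
  have hr' : 0 < r.toReal := ENNReal.toReal_pos hr0 hr
  have h0 : 0 ≤ ∫ z, ‖f z‖ ^ r.toReal ∂m := integral_nonneg fun z => by positivity
  rw [MemLp.eLpNorm_eq_integral_rpow_norm hr0 hr hf, ENNReal.ofReal_le_ofReal_iff hC0] at hC
  calc _ = ((∫ z, ‖f z‖ ^ r.toReal ∂m) ^ r.toReal⁻¹) ^ r.toReal :=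
        (Real.rpow_inv_rpow h0 hr'.ne').symm
    _ ≤ _ := Real.rpow_le_rpow (by positivity) hC hr'.le

lemma integral_norm_sq_le_of_eLpNorm_le {f : α → F} (hf : MemLp f 2 m) {C : ℝ} (hC0 : 0 ≤ C)
    (hC : eLpNorm f 2 m ≤ ENNReal.ofReal C) : ∫ z, ‖f z‖ ^ 2 ∂m ≤ C ^ 2 := by
  have := integral_norm_rpow_le_of_eLpNorm_le two_ne_zero ENNReal.ofNat_ne_top hf hC0 hC
  simpa using this

end Moments

/-! ### The stochastic approximation process as a noisy descent -/

section Model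

variable {d : ℕ} {Ω Ξ : Type*} [mΩ : MeasurableSpace Ω] [MeasurableSpace Ξ]
  {P : Measure Ω} {ℱ : Filtration ℕ mΩ} {ν : Measure Ξ}
  {G : EuclideanSpace ℝ (Fin d) → Ξ → EuclideanSpace ℝ (Fin d)} {η : ℕ → ℝ}
  {ξ : ℕ → Ω → Ξ} {x : ℕ → Ω → EuclideanSpace ℝ (Fin d)}

lemma IsSAProcess.measurable_data' (h : IsSAProcess P ℱ ν G η ξ x) (t : ℕ) :
    Measurable (ξ (t + 1)) := (h.measurable_data t).mono (ℱ.le _) le_rfl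

lemma IsSAProcess.isProbabilityMeasure [IsProbabilityMeasure P] (h : IsSAProcess P ℱ ν G η ξ x) :
    IsProbabilityMeasure ν := by
  rw [← h.law_data 0]
  exact Measure.isProbabilityMeasure_map (h.measurable_data' 0).aemeasurable

lemma IsSAProcess.measurable (h : IsSAProcess P ℱ ν G η ξ x) (t : ℕ) : Measurable[ℱ t] (x t) := by
  induction t with
  | zero => exact h.measurable_init
  | succ n ih =>
    have h1 : x (n + 1) = fun ω => x n ω - η n • G (x n ω) (ξ (n + 1) ω) :=
      funext fun ω => h.recursion n ω
    have h2 : Measurable[ℱ (n + 1)] (x n) := ih.mono (ℱ.mono (Nat.le_succ n)) le_rfl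
    have h3 : Measurable[ℱ (n + 1)] fun ω => G (x n ω) (ξ (n + 1) ω) :=
      h.measurable_G.comp (h2.prodMk (h.measurable_data n))
    rw [h1]
    exact h2.sub ((measurable_const_smul (η n)).comp h3)

/-- The next data point is independent of everything known before. -/
lemma IsSAProcess.map_prodMk [IsProbabilityMeasure P] (h : IsSAProcess P ℱ ν G η ξ x) (t : ℕ)
    {β : Type*} [MeasurableSpace β] {Y : Ω → β} (hY : Measurable[ℱ t] Y) :
    P.map (fun ω => (Y ω, ξ (t + 1) ω)) = (P.map Y).prod ν := by
  have hY' : Measurable Y := hY.mono (ℱ.le t) le_rfl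
  have hind : IndepFun Y (ξ (t + 1)) P := by
    rw [IndepFun_iff_Indep]
    exact indep_of_indep_of_le_left (h.indep_data t).symm hY.comap_le
  rw [(indepFun_iff_map_prod_eq_prod_map_map hY'.aemeasurable
    (h.measurable_data' t).aemeasurable).1 hind, h.law_data t]

/-- Centred functions of the current state and the next data point are martingale differences. -/
lemma IsSAProcess.isMartingaleDiff [IsProbabilityMeasure P] (h : IsSAProcess P ℱ ν G η ξ x)
    {f : EuclideanSpace ℝ (Fin d) → Ξ → EuclideanSpace ℝ (Fin d)}
    (hf : Measurable (Function.uncurry f)) (hint : ∀ y, Integrable (f y) ν)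
    (hzero : ∀ y, ∫ z, f y z ∂ν = 0)
    (hL2 : ∀ t, MemLp (fun ω => f (x t ω) (ξ (t + 1) ω)) 2 P) :
    IsMartingaleDiff P ℱ fun t ω => f (x t ω) (ξ (t + 1) ω) where
  stronglyMeasurable t := by
    have h2 : Measurable[ℱ (t + 1)] (x t) :=
      (h.measurable t).mono (ℱ.mono (Nat.le_succ t)) le_rfl
    have h3 : Measurable[ℱ (t + 1)] fun ω => f (x t ω) (ξ (t + 1) ω) :=
      hf.comp (h2.prodMk (h.measurable_data t))
    exact h3.stronglyMeasurable
  memLp := hL2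
  orthogonal t φ hφ hφ2 := by
    have := h.isProbabilityMeasure
    -- Test vector and state together are known at time `t`, so their joint law with the next data
    -- point is a product. Fubini integrates the data point out first, where `f` is centred.
    set Y : Ω → EuclideanSpace ℝ (Fin d) × EuclideanSpace ℝ (Fin d) := fun ω => (φ ω, x t ω)
    have hY : Measurable[ℱ t] Y := hφ.measurable.prodMk (h.measurable t)
    have hmap := h.map_prodMk t hY
    set J : (EuclideanSpace ℝ (Fin d) × EuclideanSpace ℝ (Fin d)) × Ξ → ℝ :=
      fun q => inner ℝ q.1.1 (f q.1.2 q.2) with hJ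
    have hJm : Measurable J := by
      have h1 : Measurable fun q : (EuclideanSpace ℝ (Fin d) × EuclideanSpace ℝ (Fin d)) × Ξ =>
          f q.1.2 q.2 := hf.comp ((measurable_snd.comp measurable_fst).prodMk measurable_snd)
      exact (measurable_fst.comp measurable_fst).inner h1
    have hpair : Measurable fun ω => (Y ω, ξ (t + 1) ω) :=
      (hY.mono (ℱ.le t) le_rfl).prodMk (h.measurable_data' t)
    have hJint : Integrable J ((P.map Y).prod ν) := by
      rw [← hmap, integrable_map_measure hJm.aestronglyMeasurable hpair.aemeasurable]
      exact integrable_inner_of_memLp_two hφ2 (hL2 t)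
    calc ∫ ω, inner ℝ (φ ω) (f (x t ω) (ξ (t + 1) ω)) ∂P
        = ∫ q, J q ∂(P.map fun ω => (Y ω, ξ (t + 1) ω)) :=
          (integral_map hpair.aemeasurable hJm.aestronglyMeasurable).symm
      _ = ∫ w, ∫ z, J (w, z) ∂ν ∂(P.map Y) := by rw [hmap, integral_prod _ hJint]
      _ = 0 := by
          simp only [hJ]
          simp_rw [integral_inner (hint _), hzero, inner_zero_right, integral_zero]

/-- Conditional second moments given the past are computed by freezing the current state. -/
lemma IsSAProcess.setIntegral_norm_sq_le [IsProbabilityMeasure P] (h : IsSAProcess P ℱ ν G η ξ x)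
    {f : EuclideanSpace ℝ (Fin d) → Ξ → EuclideanSpace ℝ (Fin d)}
    (hf : Measurable (Function.uncurry f)) (hf2 : ∀ y, MemLp (f y) 2 ν)
    {b : EuclideanSpace ℝ (Fin d) → ℝ} (hb : ∀ y, ∫ z, ‖f y z‖ ^ 2 ∂ν ≤ b y) (t : ℕ)
    (hL2 : MemLp (fun ω => f (x t ω) (ξ (t + 1) ω)) 2 P) {A : Set Ω} (hA : MeasurableSet[ℱ t] A)
    (hbA : IntegrableOn (fun ω => b (x t ω)) A P) :
    ∫ ω in A, ‖f (x t ω) (ξ (t + 1) ω)‖ ^ 2 ∂P ≤ ∫ ω in A, b (x t ω) ∂P := by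
  have := h.isProbabilityMeasure
  have hb0 : ∀ y, 0 ≤ b y := fun y => (integral_nonneg fun z => by positivity).trans (hb y)
  have hA' := ℱ.le t _ hA
  -- The indicator of the conditioning event travels as a coordinate of the past, and nonnegative
  -- extended values let Tonelli apply without prior integrability.
  set Y : Ω → ℝ≥0∞ × EuclideanSpace ℝ (Fin d) := fun ω => (A.indicator 1 ω, x t ω)
  have hind1 : StronglyMeasurable[ℱ t] (A.indicator (1 : Ω → ℝ≥0∞)) :=
    stronglyMeasurable_one.indicator hA
  have hY : Measurable[ℱ t] Y := hind1.measurable.prodMk (h.measurable t)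
  have hY' : Measurable Y := hY.mono (ℱ.le t) le_rfl
  have hmap := h.map_prodMk t hY
  set J : (ℝ≥0∞ × EuclideanSpace ℝ (Fin d)) × Ξ → ℝ≥0∞ :=
    fun q => q.1.1 * ENNReal.ofReal (‖f q.1.2 q.2‖ ^ 2) with hJ
  have hfm : Measurable fun q : (ℝ≥0∞ × EuclideanSpace ℝ (Fin d)) × Ξ => f q.1.2 q.2 :=
    hf.comp ((measurable_snd.comp measurable_fst).prodMk measurable_snd)
  have hJm : Measurable J :=
    (measurable_fst.comp measurable_fst).mul (hfm.norm.pow_const 2).ennreal_ofReal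
  have hpair : Measurable fun ω => (Y ω, ξ (t + 1) ω) := hY'.prodMk (h.measurable_data' t)
  have hind : ∀ g : Ω → ℝ≥0∞, ∫⁻ ω, A.indicator 1 ω * g ω ∂P = ∫⁻ ω in A, g ω ∂P := by
    intro g
    rw [← lintegral_indicator hA']
    congr 1 with ω
    by_cases hω : ω ∈ A <;> simp [hω]
  have h1 : ∫⁻ ω in A, ENNReal.ofReal (‖f (x t ω) (ξ (t + 1) ω)‖ ^ 2) ∂P
      = ∫⁻ ω in A, ∫⁻ z, ENNReal.ofReal (‖f (x t ω) z‖ ^ 2) ∂ν ∂P := by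
    calc _ = ∫⁻ q, J q ∂(P.map fun ω => (Y ω, ξ (t + 1) ω)) := by
          rw [lintegral_map hJm hpair, ← hind]
      _ = ∫⁻ w, ∫⁻ z, J (w, z) ∂ν ∂(P.map Y) := by rw [hmap, lintegral_prod _ hJm.aemeasurable]
      _ = ∫⁻ ω, ∫⁻ z, J (Y ω, z) ∂ν ∂P := lintegral_map hJm.lintegral_prod_right' hY'
      _ = _ := by
          rw [← hind]
          congr 1 with ω
          simp only [hJ]
          have hfy : Measurable (f (x t ω)) := hf.of_uncurry_left
          rw [lintegral_const_mul _ (hfy.norm.pow_const 2).ennreal_ofReal]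
  have h2 : ∀ y, ∫⁻ z, ENNReal.ofReal (‖f y z‖ ^ 2) ∂ν ≤ ENNReal.ofReal (b y) := fun y => by
    rw [← ofReal_integral_eq_lintegral_ofReal ((hf2 y).integrable_norm_pow two_ne_zero)
      (ae_of_all _ fun z => by positivity)]
    exact ENNReal.ofReal_le_ofReal (hb y)
  rw [← ENNReal.ofReal_le_ofReal_iff (integral_nonneg fun ω => hb0 _),
    ofReal_integral_eq_lintegral_ofReal (hL2.integrable_norm_pow two_ne_zero).restrict
      (ae_of_all _ fun ω => by positivity),
    ofReal_integral_eq_lintegral_ofReal hbA (ae_of_all _ fun ω => hb0 _), h1]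
  exact lintegral_mono fun ω => h2 _

variable {xs : EuclideanSpace ℝ (Fin d)}

lemma memLp_two_of_lipschitz [IsProbabilityMeasure ν] (hG : Measurable (Function.uncurry G))
    {LG : ℝ} (hlip : ∀ x y,
      eLpNorm (fun z => G x z - G y z) 2 ν ≤ ENNReal.ofReal (LG * ‖x - y‖))
    (hxs : MemLp (G xs) 2 ν) (y : EuclideanSpace ℝ (Fin d)) : MemLp (G y) 2 ν := by
  have hm : ∀ y, Measurable (G y) := fun y => hG.of_uncurry_left
  have h1 : MemLp (fun z => G y z - G xs z) 2 ν :=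
    ⟨((hm y).sub (hm xs)).aestronglyMeasurable, (hlip y xs).trans_lt ENNReal.ofReal_lt_top⟩
  have h2 := h1.add hxs
  refine h2.congr_norm (hm y).aestronglyMeasurable (ae_of_all _ fun z => ?_)
  simp

/-- On a probability space the L¹ norm is at most the L² norm, so the L² Lipschitz bound passes to
the mean. -/
lemma norm_meanField_sub_le [IsProbabilityMeasure ν] (hG : Measurable (Function.uncurry G))
    {LG : ℝ} (hLG : 0 ≤ LG) (hlip : ∀ x y,
      eLpNorm (fun z => G x z - G y z) 2 ν ≤ ENNReal.ofReal (LG * ‖x - y‖))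
    (hxs : MemLp (G xs) 2 ν) (y z : EuclideanSpace ℝ (Fin d)) :
    ‖meanField ν G y - meanField ν G z‖ ≤ LG * ‖y - z‖ := by
  have hint : ∀ y, Integrable (G y) ν := fun y =>
    (memLp_two_of_lipschitz hG hlip hxs y).integrable one_le_two
  have hm : ∀ y, Measurable (G y) := fun y => hG.of_uncurry_left
  unfold meanField
  rw [← integral_sub (hint y) (hint z), ← ENNReal.ofReal_le_ofReal_iff (by positivity),
    ofReal_norm]
  refine (enorm_integral_le_lintegral_enorm _).trans ?_
  rw [← eLpNorm_one_eq_lintegral_enorm]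
  exact (eLpNorm_le_eLpNorm_of_exponent_le one_le_two
    ((hm y).sub (hm z)).aestronglyMeasurable).trans (hlip y z)

/-- The Lyapunov condition in terms of the displacement from the root. -/
lemma LyapunovCondition.exists_isLyapunov {g : EuclideanSpace ℝ (Fin d) → EuclideanSpace ℝ (Fin d)}
    (h : LyapunovCondition g xs) {LG : ℝ} (hLG : 0 ≤ LG) (hroot : g xs = 0)
    (hg : ∀ y z, ‖g y - g z‖ ≤ LG * ‖y - z‖) :
    ∃ (V : EuclideanSpace ℝ (Fin d) → ℝ) (dV : EuclideanSpace ℝ (Fin d) → EuclideanSpace ℝ (Fin d))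
      (δ μ L l : ℝ), 0 < δ ∧ 0 < l ∧ IsLyapunov (fun y => g (xs + y)) V dV μ L LG ∧
      ∀ y, ‖y‖ ≤ δ → l * V y ≤ inner ℝ (dV y) (g (xs + y)) := by
  obtain ⟨V, δ, μ, L, l, hδ, hμ, hL, hl, hdiff, hV0, hlow, hlip, hpos, hloc⟩ := h
  have hlow' : ∀ y, μ * ‖y‖ ^ 2 ≤ V y := fun y => by simpa using hlow (xs + y)
  -- The quadratic lower bound makes the origin a global minimum. With the vanishing gradient there,
  -- the Lipschitz bound yields linear growth of the gradient and the quadratic upper bound on `V`.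
  have hgrad0 : gradient V 0 = 0 := gradient_eq_zero_of_forall_le fun z => by
    rw [hV0]; exact le_trans (by positivity) (hlow' z)
  have hdesc := descent_of_lipschitz_gradient hL.le hdiff hlip
  refine ⟨V, gradient V, δ, μ, L, l, hδ, hl, ?_, fun y hy => ?_⟩
  · refine ⟨hμ, hL, ?_, fun y => ?_, ?_, fun y => ?_, hdiff.continuous, hlow', fun y => ?_, hdesc,
      fun y hy => ?_⟩
    · have : LipschitzWith LG.toNNReal g := LipschitzWith.of_dist_le_mul fun y z => by
        rw [dist_eq_norm, dist_eq_norm, Real.coe_toNNReal _ hLG]; exact hg y z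
      exact this.continuous.comp (continuous_const.add continuous_id)
    · have := hg (xs + y) xs
      simpa [hroot] using this
    · have : LipschitzWith L.toNNReal (gradient V) := LipschitzWith.of_dist_le_mul fun y z => by
        rw [dist_eq_norm, dist_eq_norm, Real.coe_toNNReal _ hL.le]; exact hlip y z
      exact this.continuous
    · simpa [hgrad0] using hlip y 0
    · have := hdesc 0 y
      simpa [hgrad0, hV0] using this
    · have := hpos (xs + y) (by simpa using hy)
      simpa using this
  · have := hloc (xs + y) (by simpa using hy)
    simpa using this

lemma exists_continuousLinearMap_eq_toEuclideanLin (H : Matrix (Fin d) (Fin d) ℝ) :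
    ∃ T : EuclideanSpace ℝ (Fin d) →L[ℝ] EuclideanSpace ℝ (Fin d),
      ∀ y, T y = Matrix.toEuclideanLin H y :=
  ⟨(Matrix.toEuclideanLin H).toContinuousLinearMap, fun y => by
    rw [LinearMap.coe_toContinuousLinearMap']⟩

/-- Local linearity extends to all displacements when the field is Lipschitz. -/
lemma LocalLinearity.exists_forall_le {g : EuclideanSpace ℝ (Fin d) → EuclideanSpace ℝ (Fin d)}
    {H : Matrix (Fin d) (Fin d) ℝ} {LH lam LG : ℝ} (h : LocalLinearity g xs H LH lam)
    (hlam : 0 ≤ lam) (hLH : 0 ≤ LH) (hLG : 0 ≤ LG) (hroot : g xs = 0)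
    (hg : ∀ y z, ‖g y - g z‖ ≤ LG * ‖y - z‖) :
    ∃ C, 0 ≤ C ∧ ∀ y, ‖g (xs + y) - Matrix.toEuclideanLin H y‖
      ≤ C * ‖y‖ ^ (1 + lam) := by
  obtain ⟨⟨δ, hδ, hloc⟩, -⟩ := h
  obtain ⟨T, hT⟩ := exists_continuousLinearMap_eq_toEuclideanLin H
  have hδl : 0 < δ ^ lam := Real.rpow_pos_of_pos hδ lam
  -- Outside the ball of radius `δ` the error grows at most linearly, and `‖y‖ ≤ ‖y‖ ^ (1 + lam) / δ
  -- ^ lam` there.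
  refine ⟨LH + (LG + ‖T‖) / δ ^ lam, by positivity, fun y => ?_⟩
  rw [← hT]
  have hp : 0 ≤ ‖y‖ ^ (1 + lam) := by positivity
  rcases le_total ‖y‖ δ with hy | hy
  · have h1 := hloc (xs + y) (by simpa using hy)
    rw [add_sub_cancel_left, ← hT] at h1
    refine h1.trans (mul_le_mul_of_nonneg_right ?_ hp)
    have : 0 ≤ (LG + ‖T‖) / δ ^ lam := by positivity
    linarith
  · have hy0 : 0 < ‖y‖ := hδ.trans_le hy
    have h1 : ‖g (xs + y)‖ ≤ LG * ‖y‖ := by simpa [hroot] using hg (xs + y) xs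
    have h2 : ‖y‖ ≤ ‖y‖ ^ (1 + lam) / δ ^ lam := by
      rw [le_div_iff₀ hδl, Real.rpow_add hy0, Real.rpow_one]
      gcongr
    calc ‖g (xs + y) - T y‖ ≤ LG * ‖y‖ + ‖T‖ * ‖y‖ :=
          (norm_sub_le _ _).trans (add_le_add h1 (T.le_opNorm y))
      _ = (LG + ‖T‖) * ‖y‖ := by ring
      _ ≤ (LG + ‖T‖) * (‖y‖ ^ (1 + lam) / δ ^ lam) := by gcongr
      _ = (LG + ‖T‖) / δ ^ lam * ‖y‖ ^ (1 + lam) := by ring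
      _ ≤ _ := by
          gcongr
          linarith

/-- Zero has no positive real part, so it is not an eigenvalue of the complexified matrix; the
determinant is therefore nonzero already over the reals. -/
lemma LocalLinearity.inv_apply {g : EuclideanSpace ℝ (Fin d) → EuclideanSpace ℝ (Fin d)}
    {H : Matrix (Fin d) (Fin d) ℝ} {LH lam : ℝ} (h : LocalLinearity g xs H LH lam)
    (y : EuclideanSpace ℝ (Fin d)) :
    Matrix.toEuclideanLin H⁻¹ (Matrix.toEuclideanLin H y) = y := by
  have h0 : (0 : ℂ) ∉ spectrum ℂ (H.map (algebraMap ℝ ℂ)) := fun h0 => by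
    simpa using h.2 0 h0
  rw [spectrum.zero_notMem_iff, Matrix.isUnit_iff_isUnit_det] at h0
  have hdet : (H.map (algebraMap ℝ ℂ)).det = algebraMap ℝ ℂ H.det :=
    (RingHom.map_det (algebraMap ℝ ℂ) H).symm
  rw [hdet] at h0
  have hH : IsUnit H.det := by
    rw [isUnit_iff_ne_zero] at h0 ⊢
    intro h1
    exact h0 (by rw [h1, map_zero])
  have : Matrix.toEuclideanLin (H⁻¹ * H) y = y := by
    rw [Matrix.nonsing_inv_mul _ hH]; simp
  simpa using this

end Model

/-! ### The optimal step exponent -/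

section Rates

variable {lam : ℝ} {p : ℝ≥0∞}

lemma optStep_eq (hp : p ≠ 0) : optStep lam p = (2 - (p⁻¹).toReal) / (2 + lam) := by
  unfold optStep
  split_ifs with h
  · simp [h]
  · have h1 : p.toReal ≠ 0 := ENNReal.toReal_ne_zero.2 ⟨hp, h⟩
    rw [ENNReal.toReal_inv]
    field_simp

/-- Together with `optExponent_eq'`: the optimal exponent is the common value at which the
linearization and matrix-inverse rates cross. -/
lemma optExponent_eq (hlam : 0 < lam) (hp : p ≠ 0) :
    optExponent lam p = optStep lam p * (1 + lam) / 2 := by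
  rw [optStep_eq hp]
  unfold optExponent
  split_ifs with h
  · simp [h]; field_simp
  · have h1 : p.toReal ≠ 0 := ENNReal.toReal_ne_zero.2 ⟨hp, h⟩
    rw [ENNReal.toReal_inv]
    field_simp

lemma optExponent_eq' (hlam : 0 < lam) (hp : p ≠ 0) :
    -optExponent lam p = ((2 * p)⁻¹).toReal - (2 - optStep lam p) / 2 := by
  rw [optExponent_eq hlam hp, optStep_eq hp, toReal_two_mul_inv]
  field_simp
  ring

lemma toReal_inv_lt_of_rate (hlam : 0 < lam) (h : ENNReal.ofReal ((1 + lam) / lam) < p) :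
    (p⁻¹).toReal * (1 + lam) < lam := by
  rcases eq_or_ne p ⊤ with rfl | hp
  · simpa using hlam
  · have h1 : (1 + lam) / lam < p.toReal := by
      rwa [ENNReal.ofReal_lt_iff_lt_toReal (by positivity) hp] at h
    have h2 : 0 < p.toReal := lt_trans (by positivity) h1
    rw [div_lt_iff₀ hlam] at h1
    rw [ENNReal.toReal_inv, ← div_eq_inv_mul, div_lt_iff₀ h2]
    linarith

/-- With $q=1/p$ and $a^*=(2-q)/(2+\lambda)$, the lower and the upper bound of the rate condition
are both equivalent to $q(1+\lambda)<\lambda$, which is the condition on $p$. -/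
lemma optStep_admissible (hlam : 0 < lam) (hlam1 : lam ≤ 1)
    (h : ENNReal.ofReal ((1 + lam) / lam) < p) :
    1 / 2 < optStep lam p ∧ optStep lam p < 1 ∧ RateCondition lam (optStep lam p) p := by
  have hp : p ≠ 0 := (bot_le.trans_lt h).ne'
  have hq := toReal_inv_lt_of_rate hlam h
  have hq0 : 0 ≤ (p⁻¹).toReal := ENNReal.toReal_nonneg
  unfold RateCondition
  rw [optStep_eq hp]
  set q := (p⁻¹).toReal
  refine ⟨?_, ?_, h, ?_, ?_⟩
  · rw [lt_div_iff₀ (by linarith)]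
    nlinarith
  · rw [div_lt_one (by linarith)]; linarith
  · rw [div_lt_div_iff₀ (by linarith) (by linarith)]; nlinarith
  · rw [div_lt_iff₀ (by linarith)]; nlinarith

lemma overallRate_terms_nonneg (lam : ℝ) (p : ℝ≥0∞) (ε a : ℝ) (t : ℕ) :
    0 ≤ (t : ℝ) ^ (-1 : ℝ) * Real.log t ^ ε ∧
    0 ≤ (t : ℝ) ^ (-(a * (1 + lam) / 2)) * Real.log t ^ (1 + ε) ∧
    0 ≤ (t : ℝ) ^ (((2 * p)⁻¹).toReal - (2 - a) / 2) * Real.log t ^ (((2 * p)⁻¹).toReal + ε) ∧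
    0 ≤ (t : ℝ) ^ (-((1 + a) / 2)) * Real.log t ^ (1 / 2 + ε) := by
  have := Real.log_natCast_nonneg t
  exact ⟨by positivity, by positivity, by positivity, by positivity⟩

/-- At the crossing the two balanced terms have the same power of t, and the largest logarithmic
power is that of the linearization term. The initialization and calibration terms have powers no
larger, since `a* * lam ≤ 1` and `a* * (1 + lam) ≤ 2`. -/
lemma overallRate_optStep_isBigO (hlam : 0 < lam) (hlam1 : lam ≤ 1)
    (h : ENNReal.ofReal ((1 + lam) / lam) < p) (ε : ℝ) :
    overallRate lam p ε (optStep lam p) =O[atTop]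
      fun t : ℕ => (t : ℝ) ^ (-optExponent lam p) * Real.log t ^ (1 + ε) := by
  have hp : p ≠ 0 := (bot_le.trans_lt h).ne'
  obtain ⟨h1, h2, -⟩ := optStep_admissible hlam hlam1 h
  have hq := toReal_inv_lt_of_rate hlam h
  have hq0 : 0 ≤ (p⁻¹).toReal := ENNReal.toReal_nonneg
  have e1 := optExponent_eq hlam hp
  have e2 := optExponent_eq' hlam hp
  unfold overallRate
  refine ((IsBigO.add (isBigO_rpow_mul_log ?_ ?_) (isBigO_rpow_mul_log ?_ ?_)).add
    (isBigO_rpow_mul_log ?_ ?_)).add (isBigO_rpow_mul_log ?_ ?_)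
  · rw [e1]; nlinarith
  · linarith
  · rw [e1]
  · exact le_rfl
  · rw [e2]
  · rw [toReal_two_mul_inv]; nlinarith
  · rw [e1]; nlinarith
  · linarith

/-- Below the crossing the linearization term alone is polynomially too large, above it the
matrix-inverse term; as all terms are nonnegative, that one term bounds the sum from below. -/
lemma isLittleO_overallRate_of_ne_optStep (hlam : 0 < lam)
    (h : ENNReal.ofReal ((1 + lam) / lam) < p) (ε : ℝ) {a : ℝ} (ha : a ≠ optStep lam p) (k : ℝ) :
    (fun t : ℕ => (t : ℝ) ^ (-optExponent lam p) * Real.log t ^ k)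
      =o[atTop] overallRate lam p ε a := by
  have hp : p ≠ 0 := (bot_le.trans_lt h).ne'
  have e1 := optExponent_eq hlam hp
  have e2 := optExponent_eq' hlam hp
  rcases lt_or_gt_of_ne ha with ha | ha
  · refine (isLittleO_rpow_mul_log (b' := -(a * (1 + lam) / 2)) ?_ k (1 + ε)).trans_isBigO
      (IsBigO.of_bound 1 (Eventually.of_forall fun t => ?_))
    · rw [e1]; nlinarith
    · obtain ⟨h1, h2, h3, h4⟩ := overallRate_terms_nonneg lam p ε a t
      rw [one_mul, Real.norm_of_nonneg h2]
      refine le_trans ?_ (Real.le_norm_self _)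
      unfold overallRate
      linarith
  · refine (isLittleO_rpow_mul_log (b' := ((2 * p)⁻¹).toReal - (2 - a) / 2) ?_ k
      (((2 * p)⁻¹).toReal + ε)).trans_isBigO
      (IsBigO.of_bound 1 (Eventually.of_forall fun t => ?_))
    · rw [e2]; linarith
    · obtain ⟨h1, h2, h3, h4⟩ := overallRate_terms_nonneg lam p ε a t
      rw [one_mul, Real.norm_of_nonneg h3]
      refine le_trans ?_ (Real.le_norm_self _)
      unfold overallRate
      linarith

end Rates

/-! ### Assembly of the expansion -/

lemma AveragedExpansion.of_isBigO {d : ℕ} {Ω Ξ : Type*} [MeasurableSpace Ω] [MeasurableSpace Ξ]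
    {P : Measure Ω} {ν : Measure Ξ}
    {G : EuclideanSpace ℝ (Fin d) → Ξ → EuclideanSpace ℝ (Fin d)}
    {ξ : ℕ → Ω → Ξ} {x : ℕ → Ω → EuclideanSpace ℝ (Fin d)} {xs : EuclideanSpace ℝ (Fin d)}
    {H : Matrix (Fin d) (Fin d) ℝ} {r r' : ℕ → ℝ} {k' : ℝ}
    (h : AveragedExpansion P ν G ξ x xs H r)
    (hr : r =O[atTop] fun t : ℕ => r' t * Real.log t ^ k') :
    AveragedExpansion P ν G ξ x xs H r' := by
  obtain ⟨k, hk⟩ := h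
  refine ⟨k' + k, ?_⟩
  filter_upwards [hk] with ω hω
  refine hω.trans_isBigO ?_
  have h1 := hr.mul (isBigO_refl (fun t : ℕ => Real.log t ^ k) atTop)
  have hlog : ∀ᶠ t : ℕ in atTop, 0 < Real.log t :=
    (Real.tendsto_log_atTop.comp tendsto_natCast_atTop_atTop).eventually_gt_atTop 0
  refine h1.congr' EventuallyEq.rfl ?_
  filter_upwards [hlog] with t ht
  rw [mul_assoc, ← Real.rpow_add ht]

set_option maxHeartbeats 400000 in
/-- The expansion of the averaged iterate with the rate `overallRate`. -/
theorem averagedExpansion_overallRate {d : ℕ} {Ω Ξ : Type*} [mΩ : MeasurableSpace Ω]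
    [MeasurableSpace Ξ] {P : Measure Ω} [IsProbabilityMeasure P] {ℱ : Filtration ℕ mΩ}
    {ν : Measure Ξ} {G : EuclideanSpace ℝ (Fin d) → Ξ → EuclideanSpace ℝ (Fin d)}
    {ξ : ℕ → Ω → Ξ} {x : ℕ → Ω → EuclideanSpace ℝ (Fin d)} {xs : EuclideanSpace ℝ (Fin d)}
    {H S : Matrix (Fin d) (Fin d) ℝ} {η₀ a LH lam : ℝ} {p : ℝ≥0∞}
    (hη₀ : 0 < η₀) (ha : 1 / 2 < a) (ha' : a < 1)
    (hLH : 0 < LH) (hlam : 0 < lam) (hlam' : lam ≤ 1)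
    (hSA : IsSAProcess P ℱ ν G (stepSize η₀ a) ξ x)
    (hroot : meanField ν G xs = 0)
    (hLyapunov : LyapunovCondition (meanField ν G) xs)
    (hLinear : LocalLinearity (meanField ν G) xs H LH lam)
    (hLipschitz : LipschitzCondition ν G)
    (hNoise : NoiseCondition P ℱ ν G ξ x xs S p)
    (hRate : RateCondition lam a p) {ε : ℝ} (hε : 0 ≤ ε) :
    AveragedExpansion P ν G ξ x xs H (overallRate lam p ε a) := by
  have hν := hSA.isProbabilityMeasure
  have ha0 : 0 < a := by linarith
  have hG := hSA.measurable_G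
  have hGm : ∀ y, Measurable (G y) := fun y => hG.of_uncurry_left
  obtain ⟨LG, hLG, hlip⟩ := hLipschitz
  obtain ⟨C₀, hmom, hmom'⟩ := hNoise.moments
  -- exponents
  have h2p : (2 : ℝ≥0∞) ≤ 2 * p := le_mul_of_one_le_right zero_le hNoise.one_lt.le
  -- Since `lam ≤ 1`, the threshold `(1 + lam) / lam` is at least 2; the second-order expansion of
  -- the p-th power relies on this.
  have hp2 : 2 ≤ p := by
    refine le_trans ?_ hRate.1.le
    rw [← ENNReal.ofReal_ofNat]
    refine ENNReal.ofReal_le_ofReal ?_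
    rw [le_div_iff₀ hlam]; linarith
  have hq0 : 0 ≤ (p⁻¹).toReal := ENNReal.toReal_nonneg
  -- The upper bound on `a` gives 1/p < 1 - a, and 1 - a < a because a > 1/2.
  have hqa : (p⁻¹).toReal ≤ a := by have := hRate.2.2; linarith
  -- the mean field
  have hGxs : MemLp (G xs) 2 ν :=
    (show MemLp (G xs) (2 * p) ν from ⟨(hGm xs).aestronglyMeasurable,
      hmom'.trans_lt ENNReal.ofReal_lt_top⟩).mono_exponent h2p
  have hG2 := memLp_two_of_lipschitz hG hlip hGxs
  have hGi : ∀ y, Integrable (G y) ν := fun y => (hG2 y).integrable one_le_two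
  have hg := norm_meanField_sub_le hG hLG.le hlip hGxs
  have hgm : Measurable (meanField ν G) :=
    (StronglyMeasurable.integral_prod_right hG.stronglyMeasurable).measurable
  obtain ⟨V, dV, δ, μ, L, l, hδ, hl, hV, hdrift⟩ :=
    hLyapunov.exists_isLyapunov hLG.le hroot hg
  obtain ⟨C₄, hC₄, hlin⟩ := hLinear.exists_forall_le hlam.le hLH.le hLG.le hroot hg
  -- the noise
  set f : EuclideanSpace ℝ (Fin d) → Ξ → EuclideanSpace ℝ (Fin d) :=
    fun y z => meanField ν G y - G y z with hf
  have hfm : Measurable (Function.uncurry f) := (hgm.comp measurable_fst).sub hG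
  have hf2 : ∀ y, MemLp (f y) 2 ν := fun y => (memLp_const _).sub (hG2 y)
  have hfz : ∀ y, ∫ z, f y z ∂ν = 0 := fun y => by
    simp only [hf]
    rw [integral_sub (integrable_const _) (hGi y), integral_const]
    simp [meanField]
  have hxm : ∀ t, Measurable (x t) := fun t => (hSA.measurable t).mono (ℱ.le t) le_rfl
  have hem : ∀ t, Measurable (noise ν G ξ x t) := fun t =>
    hfm.comp ((hxm t).prodMk (hSA.measurable_data' t))
  have he2p : ∀ t, MemLp (noise ν G ξ x t) (2 * p) P := fun t =>
    ⟨(hem t).aestronglyMeasurable, (hmom t).trans_lt ENNReal.ofReal_lt_top⟩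
  have he2 : ∀ t, MemLp (noise ν G ξ x t) 2 P := fun t => (he2p t).mono_exponent h2p
  have hmart : IsMartingaleDiff P ℱ (noise ν G ξ x) :=
    hSA.isMartingaleDiff hfm (fun y => (hf2 y).integrable one_le_two) hfz he2
  have hdesc : IsNoisyDescent P ℱ (stepSize η₀ a) (fun y => meanField ν G (xs + y))
      (fun t ω => x t ω - xs) (noise ν G ξ x) := by
    refine ⟨hmart, fun t => ((hSA.measurable t).sub_const xs).stronglyMeasurable,
      stepSize_pos hη₀ a, fun t ω => ?_⟩
    simp only [noise]
    rw [hSA.recursion t ω, add_sub_cancel, sub_sub_cancel]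
    abel
  -- the noise differences
  set f' : EuclideanSpace ℝ (Fin d) → Ξ → EuclideanSpace ℝ (Fin d) :=
    fun y z => f y z - f xs z with hf'
  have hfm' : Measurable (Function.uncurry f') :=
    hfm.sub ((hfm.of_uncurry_left (x := xs)).comp measurable_snd)
  have hf2' : ∀ y, MemLp (f' y) 2 ν := fun y => (hf2 y).sub (hf2 xs)
  have hroot2 : ∀ t, MemLp (rootNoise ν G ξ xs t) 2 P := fun t => by
    have hpres : MeasurePreserving (ξ (t + 1)) P ν := ⟨hSA.measurable_data' t, hSA.law_data t⟩
    exact (hf2 xs).comp_measurePreserving hpres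
  have hD2 : ∀ t, MemLp (fun ω => f' (x t ω) (ξ (t + 1) ω)) 2 P := fun t =>
    (he2 t).sub (hroot2 t)
  have hD : IsMartingaleDiff P ℱ fun t ω => noise ν G ξ x t ω - rootNoise ν G ξ xs t ω :=
    hSA.isMartingaleDiff hfm' (fun y => (hf2' y).integrable one_le_two) (fun y => by
      simp only [hf']
      rw [integral_sub ((hf2 y).integrable one_le_two) ((hf2 xs).integrable one_le_two), hfz, hfz,
        sub_zero]) hD2
  have hDle : ∀ t A, MeasurableSet[ℱ t] A → IntegrableOn (fun ω => ‖x t ω - xs‖ ^ 2) A P →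
      ∫ ω in A, ‖noise ν G ξ x t ω - rootNoise ν G ξ xs t ω‖ ^ 2 ∂P
        ≤ (2 * LG) ^ 2 * ∫ ω in A, ‖x t ω - xs‖ ^ 2 ∂P := by
    intro t A hA hint
    rw [← integral_const_mul]
    refine hSA.setIntegral_norm_sq_le hfm' hf2' (b := fun y => (2 * LG) ^ 2 * ‖y - xs‖ ^ 2)
      (fun y => ?_) t (hD2 t) hA (hint.const_mul _)
    rw [← mul_pow]
    refine integral_norm_sq_le_of_eLpNorm_le (hf2' y) (by positivity) ?_
    -- The noise difference splits into a difference of means and a difference of samples, each with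
    -- L² norm at most `LG * ‖y - xs‖`; hence the constant `2 * LG`.
    have e : f' y = (fun _ => meanField ν G y - meanField ν G xs) - fun z => G y z - G xs z := by
      ext1 z
      simp only [hf', hf, Pi.sub_apply]
      abel
    rw [e]
    refine (eLpNorm_sub_le aestronglyMeasurable_const
      ((hGm y).sub (hGm xs)).aestronglyMeasurable one_le_two).trans ?_
    rw [eLpNorm_const _ two_ne_zero (IsProbabilityMeasure.ne_zero ν), measure_univ, ENNReal.one_rpow,
      mul_one, ← ofReal_norm]
    refine (add_le_add (ENNReal.ofReal_le_ofReal (hg y xs)) (hlip y xs)).trans (le_of_eq ?_)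
    rw [← ENNReal.ofReal_add (by positivity) (by positivity)]
    congr 1
    ring
  -- moments of the noise
  set B := max C₀ 0 with hB
  have hB0 : 0 ≤ B := le_max_right _ _
  have hmomB : ∀ t, eLpNorm (noise ν G ξ x t) (2 * p) P ≤ ENNReal.ofReal B := fun t =>
    (hmom t).trans (ENNReal.ofReal_le_ofReal (le_max_left _ _))
  have hsecond : ∀ t, ∫ ω, ‖noise ν G ξ x t ω‖ ^ 2 ∂P ≤ B ^ 2 := fun t =>
    integral_norm_sq_le_of_eLpNorm_le (he2 t) hB0
      ((eLpNorm_le_eLpNorm_of_exponent_le h2p (hem t).aestronglyMeasurable).trans (hmomB t))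
  have hconv := hdesc.ae_tendsto_zero hV hsecond (summable_stepSize_sq ha)
    (not_summable_stepSize hη₀ ha'.le)
  obtain ⟨n₀, hn₀⟩ := eventually_atTop.1 (eventually_stepSize_contraction hη₀ ha0 ha' hl
    (show 0 ≤ 2 * L * LG ^ 2 / μ by have := hV.pos_lower; have := hV.pos_upper; positivity))
  have hrate : ∀ n, n₀ ≤ n →
      (∃ M, ∀ t, ∫ ω in localSet (fun t ω => x t ω - xs) δ n t,
        V (x t ω - xs) / stepSize η₀ a t ∂P ≤ M) ∧
      ∀ᵐ ω ∂P, ∃ C, ∀ t, ω ∈ localSet (fun t ω => x t ω - xs) δ n t →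
        V (x t ω - xs) / stepSize η₀ a t
          ≤ C * (((t : ℝ) + 1) ^ (p⁻¹).toReal * logWeight t) := by
    intro n hn
    have hcontr := fun t (ht : n ≤ t) => hn₀ t (hn.trans ht)
    -- Essentially bounded noise allows exponential moments and the rate with 1/p = 0; otherwise the
    -- p-th moment of the rescaled value is used.
    rcases eq_or_ne p ⊤ with hp | hp
    · have hbdd : ∀ t, ∀ᵐ ω ∂P, ‖noise ν G ξ x t ω‖ ≤ B := fun t => by
        have h1 := hmomB t
        rw [hp, ENNReal.mul_top two_ne_zero, eLpNorm_exponent_top] at h1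
        filter_upwards [ae_le_eLpNormEssSup (f := noise ν G ξ x t) (μ := P)] with ω hω
        have h2 := hω.trans h1
        rwa [← ofReal_norm, ENNReal.ofReal_le_ofReal_iff hB0] at h2
      have h1 := hdesc.localized_rate_of_bounded hV hl hdrift hcontr hbdd
      simpa [hp] using h1
    · have hp0 : p ≠ 0 := (zero_lt_two.trans_le hp2).ne'
      have h2p0 : 2 * p ≠ 0 := mul_ne_zero two_ne_zero hp0
      have h2pt : 2 * p ≠ ⊤ := ENNReal.mul_ne_top ENNReal.ofNat_ne_top hp
      have hpow : ∀ t ω, (‖noise ν G ξ x t ω‖ ^ 2) ^ p.toReal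
          = ‖noise ν G ξ x t ω‖ ^ (2 * p).toReal := fun t ω => by
        rw [← Real.rpow_natCast_mul (norm_nonneg _), ENNReal.toReal_mul]
        simp
      have hp2' : 2 ≤ p.toReal := by
        simpa using ENNReal.toReal_mono hp hp2
      have h1 := hdesc.localized_rate_of_moment hV (δ := δ) (B := B ^ (2 * p).toReal) hp2' hl hdrift
        hcontr
        (fun t => by
          simp_rw [hpow]
          exact (he2p t).integrable_norm_rpow h2p0 h2pt)
        (fun t => by
          simp_rw [hpow]
          exact integral_norm_rpow_le_of_eLpNorm_le h2p0 h2pt (he2p t) hB0 (hmomB t))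
      rw [ENNReal.toReal_inv]
      exact h1
  obtain ⟨T, hT⟩ := exists_continuousLinearMap_eq_toEuclideanLin H
  obtain ⟨Ti, hTi⟩ := exists_continuousLinearMap_eq_toEuclideanLin H⁻¹
  have hTT : ∀ y, Ti (T y) = y := fun y => by rw [hT, hTi, hLinear.inv_apply]
  have hlin' : ∀ y, ‖meanField ν G (xs + y) - T y‖ ≤ C₄ * ‖y‖ ^ (1 + lam) := fun y => by
    rw [hT]; exact hlin y
  have hmain := hdesc.ae_exists_norm_sum_sub_le (e' := rootNoise ν G ξ xs) (K := (2 * LG) ^ 2)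
    (q := (p⁻¹).toReal) hη₀ ha0 ha'.le hq0 hqa
    hlam.le hlam' hδ hV hconv hrate hD (sq_nonneg _) hDle hTT hC₄ hlin'
  refine ⟨3, ?_⟩
  filter_upwards [hmain] with ω ⟨C, hC, hCt⟩
  refine (isLittleO_overallRate ha0 ha'.le hlam.le hqa hε hC hCt).congr' ?_ EventuallyEq.rfl
  filter_upwards [eventually_ne_atTop 0] with t ht
  have ht' : (t : ℝ) ≠ 0 := by exact_mod_cast ht
  simp only [average, hTi, smul_sub, Finset.sum_sub_distrib,
    Finset.sum_const, Finset.card_range]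
  rw [← Nat.cast_smul_eq_nsmul ℝ, smul_smul, inv_mul_cancel₀ ht', one_smul]

end SA

theorem mainTheorem3 {d : ℕ} {Ω Ξ : Type*} [mΩ : MeasurableSpace Ω] [MeasurableSpace Ξ]
    (P : Measure Ω) [IsProbabilityMeasure P] (ℱ : Filtration ℕ mΩ) (ν : Measure Ξ)
    (G : EuclideanSpace ℝ (Fin d) → Ξ → EuclideanSpace ℝ (Fin d))
    (ξ : ℕ → Ω → Ξ) (x : ℕ → Ω → EuclideanSpace ℝ (Fin d)) (xs : EuclideanSpace ℝ (Fin d))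
    (H S : Matrix (Fin d) (Fin d) ℝ) (η₀ a LH lam : ℝ) (p : ℝ≥0∞)
    (hη₀ : 0 < η₀) (ha : 1 / 2 < a) (ha' : a < 1)
    (hLH : 0 < LH) (hlam : 0 < lam) (hlam' : lam ≤ 1)
    (hSA : SA.IsSAProcess P ℱ ν G (SA.stepSize η₀ a) ξ x)
    (hroot : SA.meanField ν G xs = 0)
    (hLyapunov : SA.LyapunovCondition (SA.meanField ν G) xs)
    (hLinear : SA.LocalLinearity (SA.meanField ν G) xs H LH lam)
    (hLipschitz : SA.LipschitzCondition ν G)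
    (hNoise : SA.NoiseCondition P ℱ ν G ξ x xs S p)
    (hRate : SA.RateCondition lam a p) :
    -- the expansion at the step exponent `(2p - 1) / ((2 + lam) p)`
    (a = SA.optStep lam p →
      SA.AveragedExpansion P ν G ξ x xs H (fun t : ℕ => (t : ℝ) ^ (-SA.optExponent lam p))) ∧
    -- the special case `lam = 1`, `p = ∞`
    (lam = 1 → p = ⊤ → a = 2 / 3 →
      SA.AveragedExpansion P ν G ξ x xs H (fun t : ℕ => (t : ℝ) ^ (-(2 / 3 : ℝ)))) ∧
    -- optimality: `r_{t,ε}(a)` is the approximation rate at every admissible `a` ...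
    (∀ ε : ℝ, 0 < ε → SA.AveragedExpansion P ν G ξ x xs H (SA.overallRate lam p ε a)) ∧
    -- ... the exponent `optStep` is admissible ...
    (1 / 2 < SA.optStep lam p ∧ SA.optStep lam p < 1 ∧
      SA.RateCondition lam (SA.optStep lam p) p) ∧
    -- ... it attains `t ^ (-optExponent)` up to logarithms, and no other exponent does
    (∀ ε : ℝ, 0 < ε →
      (∃ k : ℝ, SA.overallRate lam p ε (SA.optStep lam p) =O[atTop]
        fun t : ℕ => (t : ℝ) ^ (-SA.optExponent lam p) * Real.log t ^ k) ∧
      ∀ a' : ℝ, 1 / 2 < a' → a' < 1 → a' ≠ SA.optStep lam p → ∀ k : ℝ,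
        (fun t : ℕ => (t : ℝ) ^ (-SA.optExponent lam p) * Real.log t ^ k)
          =o[atTop] SA.overallRate lam p ε a') := by
  have hexp : ∀ ε : ℝ, 0 < ε → SA.AveragedExpansion P ν G ξ x xs H (SA.overallRate lam p ε a) :=
    fun ε hε => SA.averagedExpansion_overallRate hη₀ ha ha' hLH hlam hlam' hSA hroot hLyapunov
      hLinear hLipschitz hNoise hRate hε.le
  have hopt : a = SA.optStep lam p →
      SA.AveragedExpansion P ν G ξ x xs H (fun t : ℕ => (t : ℝ) ^ (-SA.optExponent lam p)) := by
    rintro rfl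
    -- Any positive `ε` would do, since the logarithmic power is absorbed by the free exponent in
    -- the expansion.
    exact (hexp 1 one_pos).of_isBigO (SA.overallRate_optStep_isBigO hlam hlam' hRate.1 1)
  refine ⟨hopt, ?_, hexp, SA.optStep_admissible hlam hlam' hRate.1, fun ε _ =>
    ⟨⟨_, SA.overallRate_optStep_isBigO hlam hlam' hRate.1 ε⟩, fun a' _ _ hne k =>
      SA.isLittleO_overallRate_of_ne_optStep hlam hRate.1 ε hne k⟩⟩
  rintro rfl rfl rfl
  have h1 : SA.optStep 1 ⊤ = 2 / 3 := by norm_num [SA.optStep]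
  have h2 : SA.optExponent 1 ⊤ = 2 / 3 := by norm_num [SA.optExponent]
  simpa only [h2] using hopt h1.symm
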